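/- **Setting.** Let $\mathbb V\subseteq\mathbb H$ (continuously embedded) and $\mathbb M$ be real or complex Hilbert spaces, $A_\star:\mathbb V\to\mathbb H$ and $B:\mathbb V\to\mathbb M$ bounded linear operators, and $A:=A_\star|_{\ker B}$, regarded as an operator in $\mathbb H$. Assume: (i) there is a bounded linear $\mathcal L:\mathbb M\to\mathbb V$ with $B\mathcal L x=x$ and $A_\star\mathcal L x=\mathcal L x$ for all $x\in\mathbb M$; (ii) $\operatorname{Re}(Av,v)_{\mathbb H}=0$ for all $v\in\ker B$; (iii) there is $K>0$ such that for all scalars $z$ with $\operatorname{Re}z>0$ the inverse $(A-z)^{-1}:\mathbb H\to\mathbb H$ exists and $\|(A-z)^{-1}\|_{\mathbb H\to\mathbb H}\le K/\operatorname{Re}z$. For boundary data $\xi$ with values in $\mathbb M$, the abstract wave problem on $[0,T]$ is to find $u$ with values in $\mathbb V$ (continuous into $\mathbb H$ on $[0,T]$) such that $$u(0)=0,\qquad \dot u(t)=A_\star u(t)\ (0<t<T),\qquad Bu(t)=\xi(t)\ (0<t\le T).$$ **Discretization.** Fix $k>0$, $p\in\mathbb N_0$, $t_n:=nk$. Let $\mathcal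 S^{p}\otimes\mathbb X$ be the space of functions $\mathbb R_+\to\mathbb X$ that are a polynomial of degree at most $p$ on each $(t_n,t_{n+1}]$, and $\widetilde{\mathcal S}^{p}\otimes\mathbb X$ its subspace of functions of bounded support ($\mathcal S^{-1}:=\{0\}$). For $\xi:\mathbb R_+\to\mathbb M$ locally integrable on $[0,\infty)$ and left-continuous at the nodes $t_j$, $j\ge1$, the projection $\mathcal I_p\xi\in\mathcal S^{p}\otimes\mathbb M$ is defined by $$\mathcal I_p\xi(t_j)=\xi(t_j)\ \ (j\ge 1),\qquad \int_0^\infty v\,\mathcal I_p\xi\,dt=\int_0^\infty v\,\xi\,dt\quad\forall v\in\widetilde{\mathcal S}^{p-1}.$$ The DG-timestepping solution is $u^k\in\mathcal S^{p}\otimes\mathbb V$ with $$\int_0^\infty\big(\dot u^k(t)-A_\star u^k(t),v(t)\big)_{\mathbb H}\,dt+\sum_{n=0}^\infty\big(u^k(t_n^+)-u^k(t_n^-),v(t_n^+)\big)_{\mathbb H}=0\quad\forall v\in\widetilde{\mathcal S}^{p}\otimes\mathbb H,$$ and $Bu^k(t)=\mathcal I_p\xi(t)$ for all $t>0$, where $\dot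 u^k$ is taken on each cell separately and $u^k(t_0^-):=0$. Put $t_\star:=\max(k\lceil t/k\rceil,1)$. **Statement.** Let $\omega\ge1$ and $\gamma>0$. There is $\sigma>0$, depending only on $\omega$ and $\gamma$, and for every system $(\mathbb V,\mathbb H,\mathbb M,A_\star,B)$ as above there is $C>0$, depending only on $\omega$, $\gamma$ and this system, such that the following holds for all $T>0$, $C_u>0$, $k>0$, $p\in\mathbb N_0$ and all $\xi$ as above. If the abstract wave problem on $[0,T]$ has a solution $u\in C^\infty((0,T);\mathbb V)$ with $$\sup_{t\in(0,T)}\|u^{(\ell)}(t)\|_{\mathbb V}\le C_u\,\gamma^\ell(\ell!)^\omega\qquad\forall\ell\in\mathbb N_0,$$ and $u^k$ is a DG-timestepping solution for the boundary data $\xi$, then for every $t\in(0,T]$ with $k\lceil t/k\rceil\le T$ (that is, for all $t\in(0,T]$ if $T$ is a node of the time grid) $$\|u(t)-u^k(t)\|_{\mathbb V}\le C\,C_u\,t_\star\left(\frac{k^{1/\omega}}{k^{1/\omega}+\sigma}\right)^{p^{1/\omega}}.$$ -/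

import Mathlib

open Set Filter Topology MeasureTheory

/-- Piecewise polynomials of degree `< m` (in time) with values in `X` on the mesh
`0 < h < 2 h < ⋯`, normalised to be left-continuous: on every cell `(n h, (n+1) h]` the function
is a polynomial `∑ i < m, t ^ i • c i`. The space `S^{p,0}(T_h) ⊗ X` is the case `m = p + 1`, and
`S^{p-1,0}(T_h) ⊗ X` is the case `m = p` (which is `{0}` for `p = 0`).
Only the values at `t > 0` are constrained. -/
def IsPiecewisePoly {X : Type*} [AddCommGroup X] [Module ℝ X] (h : ℝ) (m : ℕ) (w : ℝ → X) :
    Prop :=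
  ∀ n : ℕ, ∃ c : ℕ → X, ∀ t ∈ Ioc ((n : ℝ) * h) (((n : ℝ) + 1) * h),
    w t = ∑ i ∈ Finset.range m, t ^ i • c i

/-- Bounded support (towards `+∞`) for functions of time `t > 0`. -/
def HasBoundedTimeSupport {X : Type*} [Zero X] (v : ℝ → X) : Prop :=
  ∃ R : ℝ, ∀ t : ℝ, R < t → v t = 0

/-- The one-sided limit `v(t⁺)`. It exists for piecewise polynomials at all `t ≥ 0`. -/
noncomputable def limRight {X : Type*} [TopologicalSpace X] [Nonempty X] (v : ℝ → X) (t : ℝ) : X :=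
  limUnder (𝓝[>] t) v

/-- The jump `w(t_n⁺) - w(t_n⁻)` at the node `t_n = n h` of a left-continuous piecewise polynomial,
with the convention `w(t_0⁻) = 0` at the initial time (homogeneous initial condition). -/
noncomputable def timeJump {X : Type*} [TopologicalSpace X] [AddCommGroup X]
    (h : ℝ) (w : ℝ → X) (n : ℕ) : X :=
  limRight w ((n : ℝ) * h) - (if n = 0 then 0 else w ((n : ℝ) * h))

/-- `w` is the projection `I_p ξ ∈ S^{p,0}(T_h) ⊗ X` of `ξ : ℝ₊ → X` (on `t > 0`).
The first two fields say that `ξ` belongs to the domain of `I_p` (locally integrable on `[0, ∞)`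
and left-continuous at the nodes); the last two are the defining conditions. -/
structure IsDGProjection {X : Type*} [NormedAddCommGroup X] [NormedSpace ℝ X]
    (h : ℝ) (p : ℕ) (ξ w : ℝ → X) : Prop where
  integrableOn : ∀ R : ℝ, IntegrableOn ξ (Ioc 0 R)
  leftContinuous : ∀ j : ℕ, 1 ≤ j → ContinuousWithinAt ξ (Iic ((j : ℝ) * h)) ((j : ℝ) * h)
  piecewisePoly : IsPiecewisePoly h (p + 1) w
  interpolation : ∀ j : ℕ, 1 ≤ j → w ((j : ℝ) * h) = ξ ((j : ℝ) * h)
  orthogonality : ∀ v : ℝ → ℝ, IsPiecewisePoly h p v → HasBoundedTimeSupport v →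
    ∫ t in Ioi (0 : ℝ), v t • w t = ∫ t in Ioi (0 : ℝ), v t • ξ t

/-- The data of an abstract wave problem: Hilbert spaces `V ⊆ H` (the inclusion is the continuous
injection `incl`) and `M`, and bounded operators `Astar : V → H`, `B : V → M`. -/
structure WaveSystem (𝕜 V H M : Type*) [RCLike 𝕜]
    [NormedAddCommGroup V] [InnerProductSpace 𝕜 V]
    [NormedAddCommGroup H] [InnerProductSpace 𝕜 H]
    [NormedAddCommGroup M] [InnerProductSpace 𝕜 M] where
  incl : V →L[𝕜] H
  incl_injective : Function.Injective incl
  Astar : V →L[𝕜] H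
  B : V →L[𝕜] M

namespace WaveSystem

variable {𝕜 V H M : Type*} [RCLike 𝕜]
  [NormedAddCommGroup V] [InnerProductSpace 𝕜 V]
  [NormedAddCommGroup H] [InnerProductSpace 𝕜 H]
  [NormedAddCommGroup M] [InnerProductSpace 𝕜 M]

/-- The standing assumptions, with `A := Astar` restricted to `ker B`, an operator in `H`.
Over `𝕜 = ℝ` the real part `RCLike.re` is the identity, and the resolvent is only required for
real `z > 0`. -/
structure Admissible (P : WaveSystem 𝕜 V H M) : Prop where
  /-- `B` has a bounded right inverse `L` with `A⋆ L = L`. -/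
  lifting : ∃ L : M →L[𝕜] V, ∀ x : M, P.B (L x) = x ∧ P.Astar (L x) = P.incl (L x)
  /-- `Re (A v, v)_H = 0` on `ker B`. -/
  dissipative : ∀ v : V, P.B v = 0 → RCLike.re (inner 𝕜 (P.Astar v) (P.incl v)) = 0
  /-- `(A - z)⁻¹ : H → H` exists and has norm at most `K / Re z` for `Re z > 0`. -/
  resolvent : ∃ K : ℝ, 0 < K ∧ ∀ z : 𝕜, 0 < RCLike.re z → ∀ f : H,
    (∃! v : V, P.B v = 0 ∧ P.Astar v - z • P.incl v = f) ∧
    ∀ v : V, P.B v = 0 → P.Astar v - z • P.incl v = f →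
      ‖P.incl v‖ ≤ K / RCLike.re z * ‖f‖

/-- `u` solves `u' = A⋆ u` (derivative in `H`), `B u = ξ`, `u(0) = 0` up to time `T`. -/
structure IsExactSolution [NormedSpace ℝ H] (P : WaveSystem 𝕜 V H M) (T : ℝ) (ξ : ℝ → M)
    (u : ℝ → V) : Prop where
  initial : u 0 = 0
  continuousOn : ContinuousOn (fun t => P.incl (u t)) (Icc 0 T)
  evolution : ∀ t ∈ Ioo 0 T, HasDerivAt (fun s => P.incl (u s)) (P.Astar (u t)) t
  boundary : ∀ t ∈ Ioc 0 T, P.B (u t) = ξ t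

/-- `uh` is the discontinuous Galerkin timestepping approximation of degree `p` with step `h`
for the boundary data `ξ`. The derivative is taken on the open cells (the nodes form a null set);
the integral and the sum only have contributions from finitely many cells, on which the integrand
is a polynomial, since `vh` has bounded support. -/
structure IsDGSolution [NormedSpace ℝ V] [NormedSpace ℝ H] [NormedSpace ℝ M]
    (P : WaveSystem 𝕜 V H M) (h : ℝ) (p : ℕ) (ξ : ℝ → M) (uh : ℝ → V) : Prop where
  piecewisePoly : IsPiecewisePoly h (p + 1) uh
  galerkin : ∀ vh : ℝ → H, IsPiecewisePoly h (p + 1) vh → HasBoundedTimeSupport vh →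
    (∫ t in Ioi (0 : ℝ), inner 𝕜 (vh t) (deriv (fun s => P.incl (uh s)) t - P.Astar (uh t)))
      + ∑' n : ℕ, inner 𝕜 (limRight vh ((n : ℝ) * h)) (timeJump h (fun s => P.incl (uh s)) n) = 0
  boundary : IsDGProjection h p ξ (fun t => P.B (uh t))

end WaveSystem

/-!
# Discontinuous Galerkin timestepping for an abstract wave problem

Let `n = p + 1`. On each cell, in the local variable `τ ∈ [0, 1]`, testing with Legendre polynomials
turns the Galerkin equation into the ordinary differential equation
`ι U' = h A⋆ U - kerL p • J`, in which the jump `J` at the beginning of the cell acts through the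
polynomial `kerL p` that reproduces the value at `0` (`hasDerivAt_cell`).

*Error equation.* Let `w` be the interpolant of the exact solution `F` with the moments of order
`< p` and the value at `1` of `F` (`interp`). It commutes with differentiation up to a multiple of
`kerL p`, so `θ = U - w` solves the same equation with a residual `h L_p A⋆ d`, where
`d = F(1) - (π_p F)(1)` is the end point defect of the `L²`-projection. By the definition of the
projection of the boundary data, `θ` has values in `ker B`. Subtracting `L_p z`, where `z ∈ ker B`
solves `A z - z = -A⋆ d`, removes the factor `h A⋆` from the residual and leads to the cell equation
`CellEq` with data `z`.

*Stability.* The energy balance (`CellEq.energy`) controls the values at the nodes by the data and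
the highest Legendre moment of the solution, and testing with `(1 - τ) η` controls the `L²`-norm.
A crude bound for that moment would lose powers of `p`. Differences of the moment equations give a
three-term recursion in which every moment is, up to a factor and data, `h A` applied to the
difference of its neighbours; pairing each relation with the moment itself and using the skew
symmetry of `A` yields quadratic inequalities, which are iterated over the six highest moments
(`chain_bound`, `CellEq.top_moments_le`) and show that the top moment is much smaller than a general
one. Bernstein's inequality for Legendre polynomials gives `L¹` and `L²` bounds for `kerL p`, and
these turn the `L²`-bound into a pointwise one (`CellEq.norm_le`, `norm_le_of_cells`). The result is
a bound linear in the number of cells, with a factor `h + n`. It holds for the graph norm, which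
dominates the norm of `V`, because the cell equation is inherited by `x (A - 1) (x - A)⁻¹ η`,
uniformly in `x` (`SkewGenerator.norm_graph_le`).

*Approximation.* Since `s` derivatives gain a factor `(n - s)! / n!` in the Legendre expansion, the
total error is at most a multiple of
`t⋆ ((n - s)! / n!) (h γ) ^ s (s !) ^ ω (γ (s + 1) ^ ω + 1 + n / h)` for every `s ≤ n`
(`CellProblem.exists_norm_sub_le`). With `y = (n / h) ^ (1 / ω) / (e² γ) ^ (1 / ω)`, the choice
`s = min ⌊y⌋ n` gives the asserted rate (`exists_rate`): for `y` of size at most `n` both sides are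
exponentially small in `y`, and for larger `y` both are governed by the powers of `y / n`.
-/

/-! ### Shifted Legendre polynomials -/

namespace DGWave

open Polynomial in
/-- The Legendre polynomials shifted to `[0, 1]`, normalised by the value `1` at `1` and given by
the three-term recursion. -/
noncomputable def leg : ℕ → ℝ[X]
  | 0 => 1
  | 1 => 2 * X - 1
  | n + 2 => C (1 / ((n : ℝ) + 2)) *
      (C (2 * (n : ℝ) + 3) * (2 * X - 1) * leg (n + 1) - C ((n : ℝ) + 1) * leg n)

/-- The shifted Legendre polynomial as a function on `ℝ`. -/
noncomputable def legL (n : ℕ) (t : ℝ) : ℝ := (leg n).eval t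

/-- The derivative of the shifted Legendre polynomial, as a function on `ℝ`. -/
noncomputable def legD (n : ℕ) (t : ℝ) : ℝ := (leg n).derivative.eval t

lemma hasDerivAt_legL (n : ℕ) (t : ℝ) : HasDerivAt (legL n) (legD n t) t :=
  (leg n).hasDerivAt t

lemma continuous_legL (n : ℕ) : Continuous (legL n) := (leg n).continuous

lemma continuous_legD (n : ℕ) : Continuous (legD n) := (leg n).derivative.continuous

@[simp] lemma legL_zero (t : ℝ) : legL 0 t = 1 := by simp [legL, leg]

@[simp] lemma legL_one (t : ℝ) : legL 1 t = 2 * t - 1 := by simp [legL, leg]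

@[simp] lemma legD_zero (t : ℝ) : legD 0 t = 0 := by simp [legD, leg]

@[simp] lemma legD_one (t : ℝ) : legD 1 t = 2 := by simp [legD, leg]

lemma legL_rec (n : ℕ) (t : ℝ) :
    ((n : ℝ) + 2) * legL (n + 2) t
      = (2 * n + 3) * (2 * t - 1) * legL (n + 1) t - (n + 1) * legL n t := by
  have h : ((n : ℝ) + 2) ≠ 0 := by positivity
  simp only [legL, leg, Polynomial.eval_mul, Polynomial.eval_sub, Polynomial.eval_C,
    Polynomial.eval_X, Polynomial.eval_one, Polynomial.eval_ofNat]
  field_simp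

lemma legD_rec (n : ℕ) (t : ℝ) :
    ((n : ℝ) + 2) * legD (n + 2) t
      = (2 * n + 3) * (2 * legL (n + 1) t + (2 * t - 1) * legD (n + 1) t)
        - (n + 1) * legD n t := by
  have h : ((n : ℝ) + 2) ≠ 0 := by positivity
  simp only [legL, legD, leg, Polynomial.derivative_mul, Polynomial.derivative_sub,
    Polynomial.derivative_C, Polynomial.derivative_X, Polynomial.derivative_one,
    Polynomial.derivative_ofNat, Polynomial.eval_add, Polynomial.eval_mul, Polynomial.eval_sub,
    Polynomial.eval_C, Polynomial.eval_X, Polynomial.eval_one, Polynomial.eval_ofNat,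
    Polynomial.eval_zero]
  field_simp
  ring

/-- Two first-order relations between consecutive Legendre polynomials; each of them is needed in
the induction step of the other. -/
lemma legD_pair (n : ℕ) (t : ℝ) :
    legD (n + 1) t = (2 * t - 1) * legD n t + 2 * (n + 1) * legL n t ∧
    (2 * t - 1) * legD (n + 1) t = legD n t + 2 * (n + 1) * legL (n + 1) t := by
  induction n with
  | zero => simp; ring
  | succ n ih =>
    obtain ⟨h1, h2⟩ := ih
    have hL := legL_rec n t
    have hD := legD_rec n t
    have hn : ((n : ℝ) + 2) ≠ 0 := by positivity
    have e1 : legD (n + 1 + 1) t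
        = (2 * t - 1) * legD (n + 1) t + 2 * (((n + 1 : ℕ) : ℝ) + 1) * legL (n + 1) t := by
      apply mul_left_cancel₀ hn
      push_cast
      linear_combination hD + (n + 1 : ℝ) * h2
    refine ⟨e1, ?_⟩
    rw [e1]
    push_cast
    have e1' := e1
    push_cast at e1'
    linear_combination (2 * t - 1) * h2 - h1 + (-2) * hL

/-- `L_{n+1}' = s L_n' + 2 (n+1) L_n` with `s = 2t - 1`. -/
lemma legD_succ (n : ℕ) (t : ℝ) :
    legD (n + 1) t = (2 * t - 1) * legD n t + 2 * (n + 1) * legL n t := (legD_pair n t).1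

lemma mul_legD_succ (n : ℕ) (t : ℝ) :
    (2 * t - 1) * legD (n + 1) t = legD n t + 2 * (n + 1) * legL (n + 1) t := (legD_pair n t).2

/-- `L_{n+1}` is, up to a factor, the derivative of `L_{n+2} - L_n`. -/
lemma legD_sub (n : ℕ) (t : ℝ) :
    legD (n + 2) t - legD n t = 2 * (2 * n + 3) * legL (n + 1) t := by
  have h1 := legD_succ (n + 1) t
  have h2 := mul_legD_succ n t
  push_cast at h1
  linear_combination h1 + h2

lemma legL_at_one (n : ℕ) : legL n 1 = 1 := by
  induction n using Nat.twoStepInduction with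
  | zero => simp
  | one => simp; norm_num
  | more n h1 h2 =>
    have h := legL_rec n 1
    rw [h1, h2] at h
    have hn : ((n : ℝ) + 2) ≠ 0 := by positivity
    apply mul_left_cancel₀ hn
    linear_combination h

lemma legL_symm (n : ℕ) (t : ℝ) : legL n (1 - t) = (-1) ^ n * legL n t := by
  induction n using Nat.twoStepInduction with
  | zero => simp
  | one => simp; ring
  | more n h1 h2 =>
    have h := legL_rec n (1 - t)
    have h' := legL_rec n t
    rw [h1, h2] at h
    have hn : ((n : ℝ) + 2) ≠ 0 := by positivity
    apply mul_left_cancel₀ hn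
    rw [pow_succ, pow_succ]
    rw [pow_succ] at h
    linear_combination h - (-1) ^ n * h'

lemma legL_at_zero (n : ℕ) : legL n 0 = (-1) ^ n := by
  have := legL_symm n 1
  rwa [sub_self, legL_at_one, mul_one] at this

lemma natDegree_leg_le (n : ℕ) : (leg n).natDegree ≤ n := by
  induction n using Nat.twoStepInduction with
  | zero => simp [leg]
  | one =>
    rw [leg]
    compute_degree
  | more n h1 h2 =>
    rw [leg]
    have e1 : ((2 : Polynomial ℝ) * Polynomial.X - 1).natDegree ≤ 1 := by compute_degree
    refine (Polynomial.natDegree_C_mul_le _ _).trans ?_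
    refine (Polynomial.natDegree_sub_le _ _).trans (max_le ?_ ?_)
    · rw [mul_assoc]
      refine (Polynomial.natDegree_C_mul_le _ _).trans ?_
      refine Polynomial.natDegree_mul_le.trans ?_
      omega
    · exact (Polynomial.natDegree_C_mul_le _ _).trans (by omega)

/-! ### Orthogonality and expansions in Legendre polynomials -/

section vector

variable {E : Type*} [NormedAddCommGroup E] [NormedSpace ℝ E] [CompleteSpace E]

/-- Integration by parts against a Legendre polynomial of positive degree: its primitive
`(L_{n+2} - L_n) / (2 (2n+3))` vanishes at both end points. -/
lemma integral_legL_succ_smul (n : ℕ) {f f' : ℝ → E} (hf : ContinuousOn f (Icc 0 1))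
    (hd : ∀ t ∈ Ioo (0 : ℝ) 1, HasDerivAt f (f' t) t)
    (hi : IntervalIntegrable f' volume 0 1) :
    ∫ t in (0 : ℝ)..1, legL (n + 1) t • f t
      = -(1 / (2 * (2 * (n : ℝ) + 3))) • ∫ t in (0 : ℝ)..1, (legL (n + 2) t - legL n t) • f' t := by
  have hfc : ContinuousOn f (uIcc 0 1) := by rwa [uIcc_of_le zero_le_one]
  have i1 : IntervalIntegrable (fun t => (legD (n + 2) t - legD n t) • f t) volume 0 1 :=
    ((((continuous_legD _).sub (continuous_legD _)).continuousOn).smul hfc).intervalIntegrable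
  have i2 : IntervalIntegrable (fun t => (legL (n + 2) t - legL n t) • f' t) volume 0 1 :=
    hi.continuousOn_smul ((continuous_legL _).sub (continuous_legL _)).continuousOn
  have key := intervalIntegral.integral_eq_sub_of_hasDerivAt_of_le (a := (0 : ℝ)) (b := 1)
    (f := fun t => (legL (n + 2) t - legL n t) • f t)
    (f' := fun t => (legL (n + 2) t - legL n t) • f' t + (legD (n + 2) t - legD n t) • f t)
    zero_le_one
    ((((continuous_legL _).sub (continuous_legL _)).continuousOn).smul hf)
    (fun t ht => ((hasDerivAt_legL (n + 2) t).sub (hasDerivAt_legL n t)).smul (hd t ht))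
    (i2.add i1)
  rw [intervalIntegral.integral_add i2 i1] at key
  simp only [legD_sub, legL_at_one, legL_at_zero, mul_smul, pow_succ, sub_self, zero_smul,
    mul_neg, mul_one, neg_neg] at key
  rw [intervalIntegral.integral_smul, intervalIntegral.integral_smul] at key
  rw [add_eq_zero_iff_eq_neg.mp key, smul_neg, neg_smul, neg_neg, smul_smul, smul_smul]
  rw [show 1 / (2 * (2 * (n : ℝ) + 3)) * 2 * (2 * (n : ℝ) + 3) = 1 by field_simp, one_smul]

end vector

/-- Legendre polynomials are orthogonal to polynomials of smaller degree. -/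
lemma integral_legL_mul_eval (d : ℕ) : ∀ q : Polynomial ℝ, q.natDegree ≤ d → ∀ n : ℕ, d < n →
    ∫ t in (0 : ℝ)..1, legL n t * q.eval t = 0 := by
  induction d with
  | zero =>
    intro q hq n hn
    obtain ⟨m, rfl⟩ : ∃ m, n = m + 1 := ⟨n - 1, by omega⟩
    have hq' : q.derivative = 0 := by
      rw [Polynomial.eq_C_of_natDegree_le_zero hq]; simp
    have := integral_legL_succ_smul m (f := fun t => q.eval t)
      (f' := fun t => q.derivative.eval t) q.continuous.continuousOn
      (fun t _ => q.hasDerivAt t) (q.derivative.continuous.intervalIntegrable _ _)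
    simpa [hq'] using this
  | succ d ih =>
    intro q hq n hn
    obtain ⟨m, rfl⟩ : ∃ m, n = m + 1 := ⟨n - 1, by omega⟩
    have hq' : q.derivative.natDegree ≤ d := (Polynomial.natDegree_derivative_le q).trans (by omega)
    have := integral_legL_succ_smul m (f := fun t => q.eval t)
      (f' := fun t => q.derivative.eval t) q.continuous.continuousOn
      (fun t _ => q.hasDerivAt t) (q.derivative.continuous.intervalIntegrable _ _)
    simp only [smul_eq_mul, sub_mul] at this
    rw [intervalIntegral.integral_sub, ih _ hq' _ (by omega), ih _ hq' _ (by omega)] at this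
    · simpa using this
    · exact ((continuous_legL _).mul q.derivative.continuous).intervalIntegrable _ _
    · exact ((continuous_legL _).mul q.derivative.continuous).intervalIntegrable _ _

lemma integral_legL_mul_legL_of_ne {m n : ℕ} (h : m ≠ n) :
    ∫ t in (0 : ℝ)..1, legL m t * legL n t = 0 := by
  rcases lt_or_gt_of_ne h with h | h
  · have := integral_legL_mul_eval m (leg m) (natDegree_leg_le m) n h
    simp_rw [mul_comm (legL m _)]
    exact this
  · exact integral_legL_mul_eval n (leg n) (natDegree_leg_le n) m h

lemma integral_legL_mul_legD_succ (n : ℕ) :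
    ∫ t in (0 : ℝ)..1, legL n t * legD (n + 1) t = 2 := by
  have h1 := intervalIntegral.integral_mul_deriv_eq_deriv_mul (a := (0 : ℝ)) (b := 1)
    (u := legL n) (v := legL (n + 1)) (u' := legD n) (v' := legD (n + 1))
    (fun t _ => hasDerivAt_legL n t) (fun t _ => hasDerivAt_legL (n + 1) t)
    ((continuous_legD _).intervalIntegrable _ _) ((continuous_legD _).intervalIntegrable _ _)
  have h2 : ∫ t in (0 : ℝ)..1, legD n t * legL (n + 1) t = 0 := by
    have := integral_legL_mul_eval n (leg n).derivative
      ((Polynomial.natDegree_derivative_le _).trans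
        ((Nat.sub_le _ _).trans (natDegree_leg_le n))) (n + 1) (by omega)
    simp_rw [mul_comm (legD n _)]
    exact this
  rw [h1, h2]
  simp only [legL_at_one, legL_at_zero]
  rw [pow_succ]
  have : ((-1 : ℝ) ^ n) * (-1) ^ n = 1 := by rw [← mul_pow]; simp
  linear_combination this

lemma integral_legL_sq (n : ℕ) :
    ∫ t in (0 : ℝ)..1, legL n t * legL n t = 1 / (2 * n + 1) := by
  cases n with
  | zero => simp
  | succ m =>
    have := integral_legL_succ_smul m (f := legL (m + 1)) (f' := legD (m + 1))
      (continuous_legL _).continuousOn (fun t _ => hasDerivAt_legL _ t)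
      ((continuous_legD _).intervalIntegrable _ _)
    simp only [smul_eq_mul, sub_mul] at this
    rw [this, intervalIntegral.integral_sub, integral_legL_mul_legD_succ]
    · have h0 := integral_legL_mul_eval (m + 1) (leg (m + 1)).derivative
        ((Polynomial.natDegree_derivative_le _).trans
          ((Nat.sub_le _ _).trans (natDegree_leg_le _))) (m + 2) (by omega)
      have h0' : ∫ t in (0 : ℝ)..1, legL (m + 2) t * legD (m + 1) t = 0 := h0
      rw [h0']
      push_cast
      have : (2 * (m : ℝ) + 3) ≠ 0 := by positivity
      field_simp
      ring
    · exact ((continuous_legL _).mul (continuous_legD _)).intervalIntegrable _ _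
    · exact ((continuous_legL _).mul (continuous_legD _)).intervalIntegrable _ _

end DGWave

/-! ### Pointwise bounds for Legendre polynomials -/

namespace DGWave

/-- The second derivative of the shifted Legendre polynomial. -/
noncomputable def legDD (n : ℕ) (t : ℝ) : ℝ := (leg n).derivative.derivative.eval t

lemma hasDerivAt_legD (n : ℕ) (t : ℝ) : HasDerivAt (legD n) (legDD n t) t :=
  (leg n).derivative.hasDerivAt t

lemma weight_mul_legD (n : ℕ) (t : ℝ) :
    4 * t * (1 - t) * legD n t = 2 * (n + 1) * ((2 * t - 1) * legL n t - legL (n + 1) t) := by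
  have h1 := legD_succ n t
  have h2 := mul_legD_succ n t
  linear_combination (2 * t - 1) * h1 - h2

/-- The Legendre differential equation on `[0, 1]`. -/
lemma legendre_ode (n : ℕ) (t : ℝ) :
    4 * t * (1 - t) * legDD n t
      = 4 * (2 * t - 1) * legD n t - 4 * (n * (n + 1)) * legL n t := by
  have h1 : HasDerivAt (fun x : ℝ => 4 * x * (1 - x) * legD n x)
      ((4 * (1 - t) + 4 * t * (-1)) * legD n t + 4 * t * (1 - t) * legDD n t) t := by
    have e1 : HasDerivAt (fun x : ℝ => 4 * x) 4 t := by
      simpa using (hasDerivAt_id t).const_mul (4 : ℝ)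
    have e2 : HasDerivAt (fun x : ℝ => 1 - x) (-1) t := by
      simpa using (hasDerivAt_id t).const_sub (1 : ℝ)
    exact (e1.mul e2).mul (hasDerivAt_legD n t)
  have h2 : HasDerivAt (fun x : ℝ => 2 * ((n : ℝ) + 1) * ((2 * x - 1) * legL n x - legL (n + 1) x))
      (2 * ((n : ℝ) + 1) * ((2 * legL n t + (2 * t - 1) * legD n t) - legD (n + 1) t)) t := by
    have e1 : HasDerivAt (fun x : ℝ => 2 * x - 1) 2 t := by
      simpa using ((hasDerivAt_id t).const_mul (2 : ℝ)).sub_const 1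
    exact ((e1.mul (hasDerivAt_legL n t)).sub (hasDerivAt_legL (n + 1) t)).const_mul _
  have h3 := h1.unique
    (h2.congr_of_eventuallyEq (Eventually.of_forall fun x => weight_mul_legD n x))
  have h4 := legD_succ n t
  linear_combination h3 - 2 * (n + 1 : ℝ) * h4

/-- For `n > 0` the function `4 n (n + 1) L_n² + 4 t (1 - t) (L_n')²` increases on `[1/2, 1]`, by
the differential equation; its value at `1` gives the bound. -/
lemma legL_sq_le_one (n : ℕ) {t : ℝ} (ht : t ∈ Icc (0 : ℝ) 1) : legL n t ^ 2 ≤ 1 := by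
  wlog h : 1 / 2 ≤ t generalizing t with H
  · have := H (t := 1 - t) ⟨by linarith [ht.2], by linarith [ht.1]⟩ (by linarith)
    rw [legL_symm, mul_pow, ← pow_mul, mul_comm n 2, pow_mul] at this
    simpa using this
  rcases Nat.eq_zero_or_pos n with rfl | hn
  · simp
  set N : ℝ := 4 * (n * (n + 1)) with hN
  have hNpos : 0 < N := by positivity
  have hder : ∀ x : ℝ, HasDerivAt (fun x => N * legL n x ^ 2 + 4 * x * (1 - x) * legD n x ^ 2)
      (4 * (2 * x - 1) * legD n x ^ 2) x := by
    intro x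
    have e1 : HasDerivAt (fun x : ℝ => 4 * x) 4 x := by
      simpa using (hasDerivAt_id x).const_mul (4 : ℝ)
    have e2 : HasDerivAt (fun x : ℝ => 1 - x) (-1) x := by
      simpa using (hasDerivAt_id x).const_sub (1 : ℝ)
    have e := (((hasDerivAt_legL n x).pow 2).const_mul N).add
      ((e1.mul e2).mul ((hasDerivAt_legD n x).pow 2))
    refine HasDerivAt.congr_deriv e ?_
    have ode := legendre_ode n x
    rw [← hN] at ode
    dsimp
    linear_combination 2 * legD n x * ode
  have mono : MonotoneOn (fun x => N * legL n x ^ 2 + 4 * x * (1 - x) * legD n x ^ 2)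
      (Icc (1 / 2 : ℝ) 1) := by
    apply monotoneOn_of_hasDerivWithinAt_nonneg (convex_Icc _ _)
      (fun x _ => (hder x).continuousAt.continuousWithinAt)
      (fun x _ => (hder x).hasDerivWithinAt)
    intro x hx
    rw [interior_Icc] at hx
    have : 0 ≤ 2 * x - 1 := by linarith [hx.1]
    positivity
  have := mono (a := t) (b := 1) ⟨h, ht.2⟩ ⟨by norm_num, le_rfl⟩ ht.2
  simp only [legL_at_one] at this
  have h0 : 0 ≤ 4 * t * (1 - t) * legD n t ^ 2 := by
    have := sub_nonneg.2 ht.2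
    have := ht.1
    positivity
  have : N * legL n t ^ 2 ≤ N * 1 := by linarith
  exact le_of_mul_le_mul_left this hNpos

lemma abs_legL_le_one (n : ℕ) {t : ℝ} (ht : t ∈ Icc (0 : ℝ) 1) : |legL n t| ≤ 1 :=
  abs_le_one_iff_mul_self_le_one.2 (by simpa [sq] using legL_sq_le_one n ht)

lemma abs_legD_le (n : ℕ) {t : ℝ} (ht : t ∈ Icc (0 : ℝ) 1) : |legD n t| ≤ n * (n + 1) := by
  induction n using Nat.twoStepInduction with
  | zero => simp
  | one => simp; norm_num
  | more n h1 h2 =>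
    have e : legD (n + 2) t = legD n t + 2 * (2 * n + 3) * legL (n + 1) t := by
      linarith [legD_sub n t]
    rw [e]
    have h3 := abs_legL_le_one (n + 1) ht
    have h4 : |2 * (2 * (n : ℝ) + 3) * legL (n + 1) t| ≤ 2 * (2 * (n : ℝ) + 3) := by
      rw [abs_mul, abs_of_nonneg (by positivity : (0 : ℝ) ≤ 2 * (2 * (n : ℝ) + 3))]
      exact mul_le_of_le_one_right (by positivity) h3
    refine (abs_add_le _ _).trans ?_
    push_cast
    nlinarith

/-- Sonin's function: on `[1/2, 1]` the product of its square and `4 t (1 - t)` decreases, which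
yields Bernstein's inequality for `legL` and its analogue for `legD`. -/
noncomputable def sonin (n : ℕ) (t : ℝ) : ℝ :=
  legL n t ^ 2 + (4 * t * (1 - t) * legD n t - (2 * t - 1) * legL n t) ^ 2 /
    ((4 * (n * (n + 1)) + 1) * (4 * t * (1 - t)) + 1)

lemma sonin_den_pos (n : ℕ) {t : ℝ} (ht : t ∈ Icc (0 : ℝ) 1) :
    0 < (4 * ((n : ℝ) * (n + 1)) + 1) * (4 * t * (1 - t)) + 1 := by
  have h1 := sub_nonneg.2 ht.2
  have h2 := ht.1
  positivity

lemma sonin_nonneg (n : ℕ) {t : ℝ} (ht : t ∈ Icc (0 : ℝ) 1) : 0 ≤ sonin n t := by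
  have := sonin_den_pos n ht
  unfold sonin
  positivity

lemma hasDerivAt_sonin (n : ℕ) {t : ℝ} (ht : t ∈ Icc (0 : ℝ) 1) :
    HasDerivAt (fun x => 4 * x * (1 - x) * sonin n x ^ 2)
      (-8 * (2 * t - 1) * sonin n t *
        (4 * t * (1 - t) * legD n t - (2 * t - 1) * legL n t) ^ 2 /
        ((4 * (n * (n + 1)) + 1) * (4 * t * (1 - t)) + 1) ^ 2) t := by
  have hg := (sonin_den_pos n ht).ne'
  have e1 : HasDerivAt (fun x : ℝ => 4 * x) 4 t := by
    simpa using (hasDerivAt_id t).const_mul (4 : ℝ)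
  have e2 : HasDerivAt (fun x : ℝ => 1 - x) (-1) t := by
    simpa using (hasDerivAt_id t).const_sub (1 : ℝ)
  have e3 : HasDerivAt (fun x : ℝ => 2 * x - 1) 2 t := by
    simpa using ((hasDerivAt_id t).const_mul (2 : ℝ)).sub_const 1
  have hw := e1.mul e2
  have hZ := (hw.mul (hasDerivAt_legD n t)).sub (e3.mul (hasDerivAt_legL n t))
  have hgd := (hw.const_mul (4 * ((n : ℝ) * (n + 1)) + 1)).add_const 1
  have hF := ((hasDerivAt_legL n t).pow 2).add ((hZ.pow 2).div hgd hg)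
  have hall := hw.mul (hF.pow 2)
  have hfun : (fun x => 4 * x * (1 - x) * sonin n x ^ 2)
    = ((fun x : ℝ => 4 * x) * fun x : ℝ => 1 - x) * ((legL n ^ 2 +
      (((((fun x : ℝ => 4 * x) * fun x : ℝ => 1 - x) * legD n)
        - ((fun x : ℝ => 2 * x - 1) * legL n)) ^ 2 /
        fun x => (4 * ((n : ℝ) * (n + 1)) + 1) *
          (((fun x : ℝ => 4 * x) * fun x : ℝ => 1 - x) x) + 1)) ^ 2) := by
    funext x
    simp [sonin]
  rw [hfun]
  refine hall.congr_deriv ?_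
  have ode := legendre_ode n t
  unfold sonin
  dsimp
  simp only [pow_one]
  have hZ' : (4 * (1 - t) + 4 * t * (-1)) * legD n t + 4 * t * (1 - t) * legDD n t
      - (2 * legL n t + (2 * t - 1) * legD n t)
      = -4 * (n * (n + 1)) * legL n t - 2 * legL n t - (2 * t - 1) * legD n t := by
    linear_combination ode
  rw [hZ']
  clear hall hfun hF hgd hZ hw ode hZ' e1 e2 e3
  generalize (n : ℝ) * (n + 1) = N at *
  generalize legL n t = L at *
  generalize legD n t = D at *
  generalize hgg : (4 * N + 1) * (4 * t * (1 - t)) + 1 = g at *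
  have key : ∀ Z, Z = 4 * t * (1 - t) * D - (2 * t - 1) * L →
      (4 * (1 - t) + 4 * t * -1) * (L ^ 2 * g ^ 2 + Z ^ 2 * g) +
        2 * (4 * t * (1 - t)) * (2 * L * D * g ^ 2 +
          (2 * Z * (-4 * N * L - 2 * L - (2 * t - 1) * D) * g -
            Z ^ 2 * ((4 * N + 1) * (4 * (1 - t) + 4 * t * -1)))) = -8 * (2 * t - 1) * Z ^ 2 := by
    rintro Z rfl
    rw [← hgg]
    ring
  generalize hZ : 4 * t * (1 - t) * D - (2 * t - 1) * L = Z at *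
  have key' := key Z rfl
  have e : (4 * (1 - t) + 4 * t * -1) * (L ^ 2 + Z ^ 2 / g) + 2 * (4 * t * (1 - t)) *
      (2 * L * D + (2 * Z * (-4 * N * L - 2 * L - (2 * t - 1) * D) * g -
            Z ^ 2 * ((4 * N + 1) * (4 * (1 - t) + 4 * t * -1))) / g ^ 2)
      = -8 * (2 * t - 1) * Z ^ 2 / g ^ 2 := by
    rw [← key']
    field_simp
  linear_combination (L ^ 2 + Z ^ 2 / g) * e

lemma legL_half_sq (n : ℕ) : legL n (1 / 2) ^ 2 * (n + 1) ≤ 1 := by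
  induction n using Nat.twoStepInduction with
  | zero => simp
  | one => simp
  | more n h1 _ =>
    have h := legL_rec n (1 / 2)
    have e : legL (n + 2) (1 / 2) = -((n + 1) / (n + 2)) * legL n (1 / 2) := by
      have hn : ((n : ℝ) + 2) ≠ 0 := by positivity
      field_simp
      linear_combination h
    rw [e, mul_pow, neg_sq, div_pow]
    push_cast
    have : (((n : ℝ) + 1) ^ 2 / (n + 2) ^ 2 * legL n (1 / 2) ^ 2) * (n + 2 + 1)
        = (legL n (1 / 2) ^ 2 * (n + 1)) * ((n + 1) * (n + 3) / (n + 2) ^ 2) := by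
      field_simp
      ring
    rw [this]
    have h2 : ((n : ℝ) + 1) * (n + 3) / (n + 2) ^ 2 ≤ 1 := by
      rw [div_le_one (by positivity)]
      nlinarith
    exact mul_le_one₀ h1 (by positivity) h2

lemma sonin_half_le (n : ℕ) : sonin n (1 / 2) ≤ 2 / (n + 1) := by
  have h1 : legL n (1 / 2) ^ 2 ≤ 1 / (n + 1) := by
    rw [le_div_iff₀ (by positivity)]; exact legL_half_sq n
  have h2 : legD n (1 / 2) ^ 2 / (4 * ((n : ℝ) * (n + 1)) + 1 + 1) ≤ 1 / (n + 1) := by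
    cases n with
    | zero => simp
    | succ m =>
      have e := legD_succ m (1 / 2)
      have e' : legD (m + 1) (1 / 2) = 2 * (m + 1) * legL m (1 / 2) := by
        rw [e]; ring
      rw [e', div_le_div_iff₀ (by positivity) (by positivity)]
      have := legL_half_sq m
      push_cast
      have hm : (0 : ℝ) ≤ m := by positivity
      have : (2 * ((m : ℝ) + 1) * legL m (1 / 2)) ^ 2 * (m + 1 + 1)
        = 4 * (m + 1) * (m + 2) * (legL m (1 / 2) ^ 2 * (m + 1)) := by ring
      rw [this]
      have : 4 * ((m : ℝ) + 1) * (m + 2) * (legL m (1 / 2) ^ 2 * (m + 1))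
        ≤ 4 * ((m : ℝ) + 1) * (m + 2) * 1 := by gcongr
      linarith
  have e : sonin n (1 / 2) = legL n (1 / 2) ^ 2
      + legD n (1 / 2) ^ 2 / (4 * ((n : ℝ) * (n + 1)) + 1 + 1) := by
    unfold sonin; norm_num
  rw [e]
  calc _ ≤ 1 / ((n : ℝ) + 1) + 1 / (n + 1) := add_le_add h1 h2
    _ = _ := by ring

/-- Bernstein's inequality in terms of Sonin's function. -/
lemma sqrt_mul_sonin_le (n : ℕ) {t : ℝ} (h : 1 / 2 ≤ t) (ht : t ≤ 1) :
    √(4 * t * (1 - t)) * sonin n t ≤ 2 / (n + 1) := by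
  have hsub : ∀ x ∈ Icc (1 / 2 : ℝ) 1, x ∈ Icc (0 : ℝ) 1 := fun x hx => ⟨by linarith [hx.1], hx.2⟩
  have anti : AntitoneOn (fun x => 4 * x * (1 - x) * sonin n x ^ 2) (Icc (1 / 2 : ℝ) 1) := by
    apply antitoneOn_of_hasDerivWithinAt_nonpos (convex_Icc _ _)
      (fun x hx => (hasDerivAt_sonin n (hsub x hx)).continuousAt.continuousWithinAt)
      (fun x hx => (hasDerivAt_sonin n (hsub x (interior_subset hx))).hasDerivWithinAt)
    intro x hx
    rw [interior_Icc] at hx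
    have h1 : 0 ≤ 2 * x - 1 := by linarith [hx.1]
    have h2 := sonin_nonneg n (hsub x ⟨hx.1.le, hx.2.le⟩)
    rw [div_le_iff₀ (by have := sonin_den_pos n (hsub x ⟨hx.1.le, hx.2.le⟩); positivity), zero_mul]
    have : 0 ≤ (2 * x - 1) * sonin n x *
        (4 * x * (1 - x) * legD n x - (2 * x - 1) * legL n x) ^ 2 := by positivity
    linarith
  have h1 := anti (a := 1 / 2) (b := t) ⟨le_rfl, by norm_num⟩ ⟨h, ht⟩ h
  have hw : 0 ≤ 4 * t * (1 - t) := mul_nonneg (by linarith) (by linarith)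
  have h2 : (√(4 * t * (1 - t)) * sonin n t) ^ 2 ≤ sonin n (1 / 2) ^ 2 := by
    rw [mul_pow, Real.sq_sqrt hw]
    simp only at h1
    linarith
  exact (abs_le_of_sq_le_sq' h2 (sonin_nonneg n ⟨by norm_num, by norm_num⟩)).2.trans
    (sonin_half_le n)

/-- Bernstein's inequality. -/
lemma bernstein_legL (n : ℕ) {t : ℝ} (ht : t ∈ Icc (0 : ℝ) 1) :
    √(4 * t * (1 - t)) * legL n t ^ 2 ≤ 2 / (n + 1) := by
  wlog h : 1 / 2 ≤ t generalizing t with H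
  · have := H (t := 1 - t) ⟨by linarith [ht.2], by linarith [ht.1]⟩ (by linarith)
    rw [legL_symm, mul_pow, ← pow_mul, mul_comm n 2, pow_mul] at this
    rw [show 4 * (1 - t) * (1 - (1 - t)) = 4 * t * (1 - t) by ring] at this
    simpa using this
  refine le_trans ?_ (sqrt_mul_sonin_le n h ht.2)
  gcongr
  have := sonin_den_pos n ht
  unfold sonin
  have : 0 ≤ (4 * t * (1 - t) * legD n t - (2 * t - 1) * legL n t) ^ 2 /
    ((4 * (n * (n + 1)) + 1) * (4 * t * (1 - t)) + 1) := by positivity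
  linarith

/-- The analogue of Bernstein's inequality for the derivative. In the layer
`4 t (1 - t) < (n + 1)⁻²` next to the end point the bound `|legD n| ≤ n (n + 1)` is used. -/
lemma bernstein_legD (n : ℕ) {t : ℝ} (h : 1 / 2 ≤ t) (ht : t ≤ 1) :
    (4 * t * (1 - t)) * √(4 * t * (1 - t)) * legD n t ^ 2 ≤ 24 * (n + 1) := by
  have hI : t ∈ Icc (0 : ℝ) 1 := ⟨by linarith, ht⟩
  have hw : 0 ≤ 4 * t * (1 - t) := mul_nonneg (by linarith) (by linarith)
  set w := 4 * t * (1 - t) with hwdef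
  set r := √w with hr
  have hrr : r * r = w := Real.mul_self_sqrt hw
  have hr0 : 0 ≤ r := Real.sqrt_nonneg _
  have hn1 : (0 : ℝ) < n + 1 := by positivity
  rcases lt_or_ge (r * (n + 1)) 1 with hc | hc
  · have hD := abs_legD_le n hI
    have hD2 : legD n t ^ 2 ≤ ((n : ℝ) + 1) ^ 4 := by
      rw [← sq_abs]
      calc |legD n t| ^ 2 ≤ ((n : ℝ) * (n + 1)) ^ 2 := by gcongr
        _ ≤ (((n : ℝ) + 1) * (n + 1)) ^ 2 := by gcongr; linarith
        _ = _ := by ring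
    calc w * r * legD n t ^ 2 ≤ w * r * ((n : ℝ) + 1) ^ 4 := by gcongr
      _ = (r * (n + 1)) ^ 3 * (n + 1) := by rw [← hrr]; ring
      _ ≤ 1 ^ 3 * (n + 1) := by gcongr
      _ ≤ _ := by linarith
  · have hS := sqrt_mul_sonin_le n h ht
    rw [← hwdef, ← hr] at hS
    have hg := sonin_den_pos n hI
    rw [← hwdef] at hg
    set g := (4 * ((n : ℝ) * (n + 1)) + 1) * w + 1 with hgdef
    set Z := w * legD n t - (2 * t - 1) * legL n t with hZ
    have hF : sonin n t = legL n t ^ 2 + Z ^ 2 / g := rfl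
    have hL : legL n t ^ 2 ≤ sonin n t := by
      rw [hF]; have : 0 ≤ Z ^ 2 / g := by positivity
      linarith
    have hZ2 : Z ^ 2 ≤ g * sonin n t := by
      rw [hF, mul_add, mul_div_cancel₀ _ hg.ne']
      have : 0 ≤ g * legL n t ^ 2 := by positivity
      linarith
    have hwD : (w * legD n t) ^ 2 ≤ 2 * (g + 1) * sonin n t := by
      have e : w * legD n t = Z + (2 * t - 1) * legL n t := by rw [hZ]; ring
      have hs : ((2 * t - 1) * legL n t) ^ 2 ≤ legL n t ^ 2 := by
        rw [mul_pow]
        exact mul_le_of_le_one_left (sq_nonneg _) (by nlinarith)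
      rw [e]
      nlinarith [sq_nonneg (Z - (2 * t - 1) * legL n t)]
    have hw1 : 1 ≤ w * (n + 1) ^ 2 := by
      have : 1 ≤ (r * (n + 1)) ^ 2 := one_le_pow₀ hc
      calc (1 : ℝ) ≤ (r * (n + 1)) ^ 2 := this
        _ = _ := by rw [← hrr]; ring
    have hwpos : 0 < w := by
      by_contra hneg
      have : w = 0 := le_antisymm (not_lt.1 hneg) hw
      rw [this] at hw1; simp at hw1; linarith
    have hg1 : g + 1 ≤ 6 * (n + 1) ^ 2 * w := by
      rw [hgdef]
      have : 0 ≤ (n : ℝ) * w := by positivity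
      nlinarith
    have : w * (w * r * legD n t ^ 2) ≤ w * (24 * (n + 1)) := by
      calc w * (w * r * legD n t ^ 2) = r * (w * legD n t) ^ 2 := by ring
        _ ≤ r * (2 * (g + 1) * sonin n t) := by gcongr
        _ = 2 * (g + 1) * (r * sonin n t) := by ring
        _ ≤ 2 * (6 * (n + 1) ^ 2 * w) * (2 / (n + 1)) := by
            have := sonin_nonneg n hI
            gcongr
        _ = _ := by field_simp; ring
    exact le_of_mul_le_mul_left this hwpos

end DGWave

/-! ### The reproducing kernels of the end points -/

namespace DGWave

/-- The kernel on `[0, 1]` that reproduces the value at `1` of polynomials of degree `≤ p`. -/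
noncomputable def kerR (p : ℕ) (t : ℝ) : ℝ :=
  ∑ j ∈ Finset.range (p + 1), (2 * (j : ℝ) + 1) * legL j t

/-- The kernel on `[0, 1]` that reproduces the value at `0` of polynomials of degree `≤ p`. -/
noncomputable def kerL (p : ℕ) (t : ℝ) : ℝ :=
  ∑ j ∈ Finset.range (p + 1), (2 * (j : ℝ) + 1) * ((-1) ^ j * legL j t)

lemma continuous_kerR (p : ℕ) : Continuous (kerR p) :=
  continuous_finsetSum _ fun _ _ => (continuous_legL _).const_mul _

lemma continuous_kerL (p : ℕ) : Continuous (kerL p) :=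
  continuous_finsetSum _ fun _ _ => ((continuous_legL _).const_mul _).const_mul _

lemma kerL_eq (p : ℕ) (t : ℝ) : kerL p t = kerR p (1 - t) := by
  simp only [kerL, kerR, legL_symm]

lemma kerR_eq_legD (p : ℕ) (t : ℝ) : 2 * kerR p t = legD (p + 1) t + legD p t := by
  induction p with
  | zero => simp [kerR]
  | succ p ih =>
    rw [kerR, Finset.sum_range_succ, mul_add, ← kerR, ih]
    have := legD_sub p t
    push_cast
    linear_combination -this

/-- The Christoffel–Darboux formula at the end point `1`. -/
lemma christoffel_darboux (p : ℕ) (t : ℝ) :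
    2 * (1 - t) * kerR p t = (p + 1) * (legL p t - legL (p + 1) t) := by
  induction p with
  | zero => simp [kerR]; ring
  | succ p ih =>
    rw [kerR, Finset.sum_range_succ, mul_add, ← kerR, ih]
    have := legL_rec p t
    push_cast
    linear_combination this

/-- Pointwise decay of the kernel away from `1`: near `1` the Bernstein bounds for the derivatives
of the Legendre polynomials are used, and away from it the Christoffel–Darboux formula. -/
lemma kerR_sq_mul_le (p : ℕ) {t : ℝ} (ht : t ∈ Icc (0 : ℝ) 1) :
    kerR p t ^ 2 * ((1 - t) * √(t * (1 - t))) ≤ 9 * (p + 1) := by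
  have h0 := ht.1
  have h1 := sub_nonneg.2 ht.2
  have hv : √(4 * t * (1 - t)) = 2 * √(t * (1 - t)) := by
    rw [show 4 * t * (1 - t) = 2 ^ 2 * (t * (1 - t)) by ring,
      Real.sqrt_mul (by norm_num), Real.sqrt_sq (by norm_num)]
  set r := √(t * (1 - t)) with hr
  have hr0 : 0 ≤ r := Real.sqrt_nonneg _
  rcases le_total (1 / 2) t with h | h
  · have b1 := bernstein_legD p h ht.2
    have b2 := bernstein_legD (p + 1) h ht.2
    rw [hv] at b1 b2
    push_cast at b2
    have e : kerR p t = (legD (p + 1) t + legD p t) / 2 := by linarith [kerR_eq_legD p t]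
    have e2 : kerR p t ^ 2 ≤ (legD (p + 1) t ^ 2 + legD p t ^ 2) / 2 := by
      rw [e]; nlinarith [sq_nonneg (legD (p + 1) t - legD p t)]
    have hc : 0 ≤ (1 - t) * r := mul_nonneg h1 hr0
    have hA : ∀ x : ℝ, 4 * ((1 - t) * r * x ^ 2) ≤ 4 * t * (1 - t) * (2 * r) * x ^ 2 := by
      intro x
      have : 0 ≤ (1 - t) * r * x ^ 2 := by positivity
      nlinarith
    have hB := hA (legD (p + 1) t)
    have hC := hA (legD p t)
    have := mul_le_mul_of_nonneg_right e2 hc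
    have hp : (0 : ℝ) ≤ p := by positivity
    nlinarith
  · have b1 := bernstein_legL p ht
    have b2 := bernstein_legL (p + 1) ht
    rw [hv] at b1 b2
    rw [mul_comm, mul_comm (2 : ℝ)] at b1 b2
    have hp : (0 : ℝ) < p + 1 := by positivity
    have b2' : legL (p + 1) t ^ 2 * (r * 2) ≤ 2 / (p + 1) := by
      refine b2.trans ?_
      push_cast
      gcongr
      linarith
    have cd := christoffel_darboux p t
    have e1 : (2 * (1 - t) * kerR p t) ^ 2 * r ≤ 4 * (p + 1) := by
      rw [cd]
      have e3 : (legL p t - legL (p + 1) t) ^ 2 * (r * 2) ≤ 8 / (p + 1) := by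
        have : (legL p t - legL (p + 1) t) ^ 2 * (r * 2)
            ≤ 2 * (legL p t ^ 2 * (r * 2)) + 2 * (legL (p + 1) t ^ 2 * (r * 2)) := by
          nlinarith [mul_nonneg (sq_nonneg (legL p t + legL (p + 1) t)) hr0]
        have b1' : legL p t ^ 2 * (r * 2) ≤ 2 / (p + 1) := by linarith
        calc _ ≤ _ := this
          _ ≤ 2 * (2 / (p + 1)) + 2 * (2 / (p + 1)) := by gcongr
          _ = _ := by ring
      have : (((p : ℝ) + 1) * (legL p t - legL (p + 1) t)) ^ 2 * r
          = (p + 1) ^ 2 / 2 * ((legL p t - legL (p + 1) t) ^ 2 * (r * 2)) := by ring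
      rw [this]
      calc _ ≤ ((p : ℝ) + 1) ^ 2 / 2 * (8 / (p + 1)) := by gcongr
        _ = _ := by field_simp; ring
    have : 0 ≤ (1 - t) * kerR p t ^ 2 * r := by positivity
    nlinarith

lemma kerL_sq_mul_le (p : ℕ) {t : ℝ} (ht : t ∈ Icc (0 : ℝ) 1) :
    kerL p t ^ 2 * (t * √(t * (1 - t))) ≤ 9 * (p + 1) := by
  have := kerR_sq_mul_le p (t := 1 - t) ⟨by linarith [ht.2], by linarith [ht.1]⟩
  rw [← kerL_eq, show 1 - (1 - t) = t by ring, mul_comm (1 - t) t] at this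
  exact this

/-- The `L²`-norm of the kernel away from its singular end point. -/
lemma integral_kerL_sq_le (p : ℕ) {δ : ℝ} (h0 : 0 < δ) (h1 : δ ≤ 1) :
    ∫ t in δ..1, kerL p t ^ 2 ≤ 18 * (p + 1) / √δ := by
  have hcont : ContinuousOn (fun t : ℝ => -(18 * (p + 1)) * √((1 - t) / t)) (Icc δ 1) := by
    apply ContinuousOn.mul continuousOn_const
    apply ContinuousOn.sqrt
    exact (continuousOn_const.sub continuousOn_id).div continuousOn_id
      fun t ht => (h0.trans_le ht.1).ne'
  have key := intervalIntegral.integral_le_sub_of_hasDeriv_right_of_le h1 hcont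
    (g' := fun t => 9 * (p + 1) / (t * √(t * (1 - t)))) (φ := fun t => kerL p t ^ 2) ?_
    (((continuous_kerL p).pow 2).continuousOn.integrableOn_Icc) ?_
  · refine key.trans ?_
    rw [sub_self, zero_div, Real.sqrt_zero, mul_zero, zero_sub, neg_mul, neg_neg,
      Real.sqrt_div (by linarith), ← mul_div_assoc]
    refine div_le_div_of_nonneg_right ?_ (Real.sqrt_nonneg _)
    exact mul_le_of_le_one_right (by positivity) (Real.sqrt_le_one.2 (by linarith))
  · intro t ht
    have htpos : 0 < t := h0.trans ht.1
    have ht1 : 0 < 1 - t := sub_pos.2 ht.2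
    apply HasDerivAt.hasDerivWithinAt
    have d1 : HasDerivAt (fun t : ℝ => (1 - t) / t) ((-1 * t - (1 - t) * 1) / t ^ 2) t := by
      have e2 : HasDerivAt (fun x : ℝ => 1 - x) (-1) t := by
        simpa using (hasDerivAt_id t).const_sub (1 : ℝ)
      exact e2.div (hasDerivAt_id t) htpos.ne'
    have d2 := (d1.sqrt (div_pos ht1 htpos).ne').const_mul (-(18 * ((p : ℝ) + 1)))
    refine d2.congr_deriv ?_
    have e3 : √(t * (1 - t)) = t * √((1 - t) / t) := by
      rw [show t * (1 - t) = t ^ 2 * ((1 - t) / t) by field_simp, Real.sqrt_mul (by positivity),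
        Real.sqrt_sq htpos.le]
    rw [e3]
    have : 0 < √((1 - t) / t) := Real.sqrt_pos.2 (div_pos ht1 htpos)
    field_simp
    ring
  · intro t ht
    have htpos : 0 < t := h0.trans ht.1
    have ht1 : 0 < 1 - t := sub_pos.2 ht.2
    have : 0 < √(t * (1 - t)) := Real.sqrt_pos.2 (mul_pos htpos ht1)
    rw [le_div_iff₀ (by positivity)]
    exact kerL_sq_mul_le p ⟨htpos.le, ht.2.le⟩

/-- The `L¹`-norm of the kernel near its singular end point. -/
lemma integral_abs_kerL_le (p : ℕ) {δ : ℝ} (h0 : 0 ≤ δ) (h1 : δ ≤ 1 / 2) :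
    ∫ t in (0 : ℝ)..δ, |kerL p t| ≤ 20 * √(p + 1) * √√δ := by
  have hcont : ContinuousOn (fun t : ℝ => 20 * √((p : ℝ) + 1) * √√t) (Icc 0 δ) := by
    fun_prop
  have key := intervalIntegral.integral_le_sub_of_hasDeriv_right_of_le h0 hcont
    (g' := fun t => 20 * √((p : ℝ) + 1) * (1 / (2 * √t) / (2 * √√t))) (φ := fun t => |kerL p t|) ?_
    ((continuous_kerL p).abs.continuousOn.integrableOn_Icc) ?_
  · refine key.trans ?_
    simp
  · intro t ht
    apply HasDerivAt.hasDerivWithinAt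
    have d := ((Real.hasDerivAt_sqrt ht.1.ne').sqrt (Real.sqrt_pos.2 ht.1).ne').const_mul
      (20 * √((p : ℝ) + 1))
    exact d
  · intro t ht
    have ht0 := ht.1
    have ht1 : 1 / 2 ≤ 1 - t := by linarith [ht.2]
    have hr : 0 < √t := Real.sqrt_pos.2 ht0
    have hq : 0 < √√t := Real.sqrt_pos.2 hr
    have e1 := kerL_sq_mul_le p (t := t) ⟨ht0.le, by linarith⟩
    have e2 : √t / 2 ≤ √(t * (1 - t)) := by
      rw [Real.sqrt_mul ht0.le]
      have : 1 / 2 ≤ √(1 - t) := by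
        apply Real.le_sqrt_of_sq_le; linarith
      nlinarith
    have e3 : kerL p t ^ 2 * (t * (√t / 2)) ≤ 9 * (p + 1) := by
      refine le_trans ?_ e1
      gcongr
    have hq2 : √√t ^ 2 = √t := Real.sq_sqrt hr.le
    have hr2 : √t ^ 2 = t := Real.sq_sqrt ht0.le
    have e4 : |kerL p t| * (√t * √√t) ≤ 5 * √((p : ℝ) + 1) := by
      refine le_of_pow_le_pow_left₀ two_ne_zero (by positivity) ?_
      rw [mul_pow, sq_abs, mul_pow, hr2, hq2, mul_pow, Real.sq_sqrt (by positivity)]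
      nlinarith [(by positivity : (0 : ℝ) ≤ p)]
    have : 1 / (2 * √t) / (2 * √√t) = 1 / 4 / (√t * √√t) := by field_simp; ring
    rw [this, ← mul_div_assoc, le_div_iff₀ (by positivity)]
    linarith

lemma integral_abs_kerL_total_le (p : ℕ) : ∫ t in (0 : ℝ)..1, |kerL p t| ≤ 44 * √(p + 1) := by
  have hi : ∀ a b : ℝ, IntervalIntegrable (fun t => |kerL p t|) volume a b :=
    fun a b => (continuous_kerL p).abs.intervalIntegrable _ _
  rw [← intervalIntegral.integral_add_adjacent_intervals (hi 0 (1 / 2)) (hi (1 / 2) 1)]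
  have h1 := integral_abs_kerL_le p (δ := 1 / 2) (by norm_num) le_rfl
  have h1' : ∫ t in (0 : ℝ)..(1 / 2), |kerL p t| ≤ 20 * √(p + 1) := by
    refine h1.trans (mul_le_of_le_one_right (by positivity) ?_)
    exact Real.sqrt_le_one.2 (Real.sqrt_le_one.2 (by norm_num))
  have hcont : ContinuousOn (fun t : ℝ => -(24 * √((p : ℝ) + 1)) * √(1 - t)) (Icc (1 / 2) 1) := by
    fun_prop
  have key := intervalIntegral.integral_le_sub_of_hasDeriv_right_of_le
    (by norm_num : (1 / 2 : ℝ) ≤ 1) hcont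
    (g' := fun t => 12 * √((p : ℝ) + 1) / √(1 - t)) (φ := fun t => |kerL p t|) ?_
    ((continuous_kerL p).abs.continuousOn.integrableOn_Icc) ?_
  · have : √(1 - 1 / 2 : ℝ) ≤ 1 := Real.sqrt_le_one.2 (by norm_num)
    rw [sub_self, Real.sqrt_zero, mul_zero, zero_sub, neg_mul, neg_neg] at key
    have h2 : 24 * √((p : ℝ) + 1) * √(1 - 1 / 2) ≤ 24 * √((p : ℝ) + 1) * 1 := by gcongr
    linarith
  · intro t ht
    have ht1 : 0 < 1 - t := sub_pos.2 ht.2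
    apply HasDerivAt.hasDerivWithinAt
    have e2 : HasDerivAt (fun x : ℝ => 1 - x) (-1) t := by
      simpa using (hasDerivAt_id t).const_sub (1 : ℝ)
    refine ((e2.sqrt ht1.ne').const_mul _).congr_deriv ?_
    have : 0 < √(1 - t) := Real.sqrt_pos.2 ht1
    field_simp
    ring
  · intro t ht
    have ht0 : 1 / 2 ≤ t := ht.1.le
    have ht1 : 0 < 1 - t := sub_pos.2 ht.2
    have hr : 0 < √(1 - t) := Real.sqrt_pos.2 ht1
    have e1 := kerL_sq_mul_le p (t := t) ⟨by linarith, ht.2.le⟩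
    have e2 : √(1 - t) / 2 ≤ √(t * (1 - t)) := by
      rw [Real.sqrt_mul (by linarith)]
      have : 1 / 2 ≤ √t := by apply Real.le_sqrt_of_sq_le; linarith
      nlinarith
    have e3 : kerL p t ^ 2 * (1 / 2 * (√(1 - t) / 2)) ≤ 9 * (p + 1) := by
      refine le_trans ?_ e1
      gcongr
    rw [le_div_iff₀ hr]
    refine le_of_pow_le_pow_left₀ two_ne_zero (by positivity) ?_
    have hr2 : √(1 - t) ^ 2 = 1 - t := Real.sq_sqrt ht1.le
    have hr1 : √(1 - t) ≤ 1 := Real.sqrt_le_one.2 (by linarith)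
    have hp2 : √((p : ℝ) + 1) ^ 2 = p + 1 := Real.sq_sqrt (by positivity)
    rw [mul_pow, sq_abs, mul_pow, hp2]
    have : kerL p t ^ 2 * √(1 - t) ^ 2 ≤ kerL p t ^ 2 * √(1 - t) := by
      gcongr
      nlinarith
    have e3' : kerL p t ^ 2 * √(1 - t) ≤ 36 * (p + 1) := by linarith
    have hp : (0 : ℝ) ≤ p := by positivity
    linarith

lemma integral_abs_kerR_total_le (p : ℕ) : ∫ t in (0 : ℝ)..1, |kerR p t| ≤ 44 * √(p + 1) := by
  have h := integral_abs_kerL_total_le p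
  simp only [kerL_eq] at h
  rw [intervalIntegral.integral_comp_sub_left (fun t => |kerR p t|) 1] at h
  simpa using h

end DGWave

/-! ### Legendre coefficients and vector-valued polynomials -/

namespace DGWave

lemma intervalIntegrable_of_continuousOn {E : Type*} [NormedAddCommGroup E] {f : ℝ → E} {a b : ℝ}
    (hab : a ≤ b) (hf : ContinuousOn f (Icc a b)) : IntervalIntegrable f volume a b :=
  ContinuousOn.intervalIntegrable (by rwa [uIcc_of_le hab])

/-- The Cauchy–Schwarz inequality for continuous functions on an interval. -/
lemma sq_integral_mul_le {a b : ℝ} (hab : a ≤ b) {f g : ℝ → ℝ} (hf : ContinuousOn f (Icc a b))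
    (hg : ContinuousOn g (Icc a b)) :
    (∫ t in a..b, f t * g t) ^ 2 ≤ (∫ t in a..b, f t ^ 2) * ∫ t in a..b, g t ^ 2 := by
  have i1 : IntervalIntegrable (fun t => f t ^ 2) volume a b :=
    intervalIntegrable_of_continuousOn hab (hf.pow 2)
  have i2 : IntervalIntegrable (fun t => g t ^ 2) volume a b :=
    intervalIntegrable_of_continuousOn hab (hg.pow 2)
  have i3 : IntervalIntegrable (fun t => f t * g t) volume a b :=
    intervalIntegrable_of_continuousOn hab (hf.mul hg)
  have key : ∀ x : ℝ, 0 ≤ (∫ t in a..b, g t ^ 2) * (x * x) + (-2 * ∫ t in a..b, f t * g t) * x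
      + ∫ t in a..b, f t ^ 2 := by
    intro x
    have h0 : 0 ≤ ∫ t in a..b, (f t - x * g t) ^ 2 :=
      intervalIntegral.integral_nonneg hab fun t _ => sq_nonneg _
    have h1 : ∫ t in a..b, (f t - x * g t) ^ 2 = (∫ t in a..b, f t ^ 2)
        - 2 * x * (∫ t in a..b, f t * g t) + x ^ 2 * ∫ t in a..b, g t ^ 2 := by
      rw [← intervalIntegral.integral_const_mul, ← intervalIntegral.integral_const_mul,
        ← intervalIntegral.integral_sub i1 (i3.const_mul _),
        ← intervalIntegral.integral_add (i1.sub (i3.const_mul _)) (i2.const_mul _)]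
      exact intervalIntegral.integral_congr fun t _ => by ring
    rw [h1] at h0
    linarith
  have := discrim_le_zero key
  rw [discrim] at this
  linarith

lemma abs_integral_mul_le {a b : ℝ} (hab : a ≤ b) {f g : ℝ → ℝ} (hf : ContinuousOn f (Icc a b))
    (hg : ContinuousOn g (Icc a b)) :
    |∫ t in a..b, f t * g t| ≤ √(∫ t in a..b, f t ^ 2) * √(∫ t in a..b, g t ^ 2) := by
  rw [← Real.sqrt_mul (intervalIntegral.integral_nonneg hab fun t _ => sq_nonneg _)]
  exact Real.abs_le_sqrt (sq_integral_mul_le hab hf hg)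

variable {E : Type*} [NormedAddCommGroup E] [NormedSpace ℝ E]

lemma norm_integral_smul_le {a b : ℝ} (hab : a ≤ b) {f : ℝ → ℝ} {g : ℝ → E}
    (hf : ContinuousOn f (Icc a b)) (hg : ContinuousOn g (Icc a b)) :
    ‖∫ t in a..b, f t • g t‖ ≤ √(∫ t in a..b, f t ^ 2) * √(∫ t in a..b, ‖g t‖ ^ 2) := by
  refine (intervalIntegral.norm_integral_le_integral_norm hab).trans ?_
  simp_rw [norm_smul, Real.norm_eq_abs]
  refine (le_abs_self _).trans ((abs_integral_mul_le hab hf.abs hg.norm).trans_eq ?_)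
  simp_rw [sq_abs]

/-- The `j`-th moment of `f` against the shifted Legendre polynomials. -/
noncomputable def legC (j : ℕ) (f : ℝ → E) : E := ∫ t in (0 : ℝ)..1, legL j t • f t

/-- The `L²(0,1)`-orthogonal projection onto polynomials of degree `< m`. -/
noncomputable def legProj (m : ℕ) (f : ℝ → E) (t : ℝ) : E :=
  ∑ j ∈ Finset.range m, ((2 * (j : ℝ) + 1) * legL j t) • legC j f

/-- Polynomial functions of degree `< m`, written in the Legendre basis. -/
def IsPoly (m : ℕ) (f : ℝ → E) : Prop :=
  ∃ a : ℕ → E, ∀ t, f t = ∑ j ∈ Finset.range m, legL j t • a j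

lemma IsPoly.continuous {m : ℕ} {f : ℝ → E} (h : IsPoly m f) : Continuous f := by
  obtain ⟨a, ha⟩ := h
  rw [funext ha]
  exact continuous_finsetSum _ fun j _ => (continuous_legL j).smul continuous_const

lemma IsPoly.mono {m n : ℕ} (hmn : m ≤ n) {f : ℝ → E} (h : IsPoly m f) : IsPoly n f := by
  obtain ⟨a, ha⟩ := h
  refine ⟨fun j => if j < m then a j else 0, fun t => ?_⟩
  rw [ha, ← Finset.sum_subset (Finset.range_mono hmn)]
  · exact Finset.sum_congr rfl fun j hj => by simp [Finset.mem_range.1 hj]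
  · intro j _ hj
    simp [Finset.mem_range.not.1 hj]

lemma IsPoly.add {m : ℕ} {f g : ℝ → E} (hf : IsPoly m f) (hg : IsPoly m g) :
    IsPoly m fun t => f t + g t := by
  obtain ⟨a, ha⟩ := hf
  obtain ⟨b, hb⟩ := hg
  exact ⟨fun j => a j + b j, fun t => by simp [ha, hb, smul_add, Finset.sum_add_distrib]⟩

lemma IsPoly.clm {F : Type*} [NormedAddCommGroup F] [NormedSpace ℝ F] {m : ℕ} {f : ℝ → E}
    (hf : IsPoly m f) (L : E →L[ℝ] F) : IsPoly m fun t => L (f t) := by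
  obtain ⟨a, ha⟩ := hf
  exact ⟨fun j => L (a j), fun t => by simp [ha]⟩

lemma IsPoly.const_smul {m : ℕ} {f : ℝ → E} (hf : IsPoly m f) (c : ℝ) :
    IsPoly m fun t => c • f t :=
  hf.clm (c • ContinuousLinearMap.id ℝ E)

lemma IsPoly.sub {m : ℕ} {f g : ℝ → E} (hf : IsPoly m f) (hg : IsPoly m g) :
    IsPoly m fun t => f t - g t := by
  simpa [sub_eq_add_neg] using hf.add (hg.const_smul (-1))

lemma isPoly_legL_smul {j m : ℕ} (h : j < m) (x : E) : IsPoly m fun t => legL j t • x :=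
  ⟨fun i => if i = j then x else 0, fun t => by simp [h]⟩

lemma isPoly_sum {m : ℕ} {ι : Type*} (s : Finset ι) {f : ι → ℝ → E}
    (h : ∀ i ∈ s, IsPoly m (f i)) : IsPoly m fun t => ∑ i ∈ s, f i t := by
  classical
  induction s using Finset.induction_on with
  | empty => exact ⟨0, fun t => by simp⟩
  | insert a s ha ih =>
    simp_rw [Finset.sum_insert ha]
    exact (h a (by simp)).add (ih fun i hi => h i (by simp [hi]))

lemma IsPoly.smul_const {m : ℕ} {f : ℝ → ℝ} (hf : IsPoly m f) (x : E) :
    IsPoly m fun t => f t • x :=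
  hf.clm (ContinuousLinearMap.toSpanSingleton ℝ x)

lemma IsPoly.mul_id {m : ℕ} {f : ℝ → ℝ} (hf : IsPoly m f) : IsPoly (m + 1) fun t => t * f t := by
  obtain ⟨a, ha⟩ := hf
  have : ∀ j, IsPoly (j + 2) fun t : ℝ => t * legL j t := by
    intro j
    cases j with
    | zero =>
      have := ((isPoly_legL_smul (m := 2) zero_lt_two (1 / 2 : ℝ)).add
        (isPoly_legL_smul (m := 2) one_lt_two (1 / 2 : ℝ)))
      refine cast (congrArg _ (funext fun t => ?_)) this
      simp; ring
    | succ i =>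
      have := ((isPoly_legL_smul (m := i + 3) (j := i + 2) (by omega)
        (((i : ℝ) + 2) / (2 * (2 * i + 3)))).add
        ((isPoly_legL_smul (m := i + 3) (j := i + 1) (by omega) (1 / 2 : ℝ)).add
        (isPoly_legL_smul (m := i + 3) (j := i) (by omega)
          (((i : ℝ) + 1) / (2 * (2 * i + 3))))))
      refine cast (congrArg _ (funext fun t => ?_)) this
      have h := legL_rec i t
      have h0 : (2 * (i : ℝ) + 3) ≠ 0 := by positivity
      simp only [smul_eq_mul]
      field_simp
      linarith
  have h2 : IsPoly (m + 1) fun t => ∑ j ∈ Finset.range m, (a j) • (t * legL j t) :=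
    isPoly_sum _ fun j hj => ((this j).mono (by have := Finset.mem_range.1 hj; omega)).const_smul _
  refine cast (congrArg _ (funext fun t => ?_)) h2
  rw [ha, Finset.mul_sum]
  exact Finset.sum_congr rfl fun j _ => by simp; ring

lemma isPoly_pow (i : ℕ) : IsPoly (i + 1) fun t : ℝ => t ^ i := by
  induction i with
  | zero => exact ⟨fun _ => 1, fun t => by simp⟩
  | succ i ih => simpa [pow_succ'] using ih.mul_id

/-- Every real polynomial of degree `< m` is a combination of the first `m` Legendre
polynomials. -/
lemma isPoly_eval (q : Polynomial ℝ) {m : ℕ} (h : q.natDegree < m) :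
    IsPoly m fun t => q.eval t := by
  simp_rw [Polynomial.eval_eq_sum_range]
  refine isPoly_sum _ fun i hi => ((isPoly_pow i).mono ?_).const_smul (q.coeff i)
  have := Finset.mem_range.1 hi
  omega

lemma isPoly_legD (j : ℕ) : IsPoly j (legD j) := by
  cases j with
  | zero => exact ⟨0, fun t => by simp⟩
  | succ j =>
    refine isPoly_eval _ ?_
    have h1 := Polynomial.natDegree_derivative_le (leg (j + 1))
    have h2 := natDegree_leg_le (j + 1)
    omega

lemma legL_smul_integral [CompleteSpace E] (i j : ℕ) (x : E) :
    legC i (fun t => legL j t • x) = if i = j then (1 / (2 * (i : ℝ) + 1)) • x else 0 := by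
  simp_rw [legC, smul_smul]
  rw [intervalIntegral.integral_smul_const]
  split_ifs with h
  · rw [h, integral_legL_sq]
  · rw [integral_legL_mul_legL_of_ne h, zero_smul]

lemma intervalIntegrable_legL_smul (i : ℕ) {f : ℝ → E} (hf : ContinuousOn f (Icc 0 1)) :
    IntervalIntegrable (fun t => legL i t • f t) volume 0 1 :=
  intervalIntegrable_of_continuousOn zero_le_one ((continuous_legL i).continuousOn.smul hf)

lemma legC_add (i : ℕ) {f g : ℝ → E} (hf : ContinuousOn f (Icc 0 1))
    (hg : ContinuousOn g (Icc 0 1)) : legC i (fun t => f t + g t) = legC i f + legC i g := by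
  simp_rw [legC, smul_add]
  exact intervalIntegral.integral_add (intervalIntegrable_legL_smul i hf)
    (intervalIntegrable_legL_smul i hg)

lemma legC_sub (i : ℕ) {f g : ℝ → E} (hf : ContinuousOn f (Icc 0 1))
    (hg : ContinuousOn g (Icc 0 1)) : legC i (fun t => f t - g t) = legC i f - legC i g := by
  simp_rw [legC, smul_sub]
  exact intervalIntegral.integral_sub (intervalIntegrable_legL_smul i hf)
    (intervalIntegrable_legL_smul i hg)

lemma legC_clm {F : Type*} [NormedAddCommGroup F] [NormedSpace ℝ F] [CompleteSpace E]
    [CompleteSpace F] (i : ℕ) {f : ℝ → E} (hf : ContinuousOn f (Icc 0 1)) (L : E →L[ℝ] F) :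
    legC i (fun t => L (f t)) = L (legC i f) := by
  rw [legC, legC, ← L.intervalIntegral_comp_comm (intervalIntegrable_legL_smul i hf)]
  simp

lemma legC_const_smul (i : ℕ) (c : ℝ) (f : ℝ → E) :
    legC i (fun t => c • f t) = c • legC i f := by
  simp_rw [legC, smul_comm _ c]
  exact intervalIntegral.integral_smul _ _

lemma legC_sum_legL [CompleteSpace E] (i m : ℕ) (a : ℕ → E) :
    legC i (fun t => ∑ j ∈ Finset.range m, legL j t • a j)
      = if i < m then (1 / (2 * (i : ℝ) + 1)) • a i else 0 := by
  have : legC i (fun t => ∑ j ∈ Finset.range m, legL j t • a j)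
      = ∑ j ∈ Finset.range m, legC i (fun t => legL j t • a j) := by
    simp_rw [legC, Finset.smul_sum]
    exact intervalIntegral.integral_finsetSum fun j _ => intervalIntegrable_legL_smul i
      ((continuous_legL j).smul continuous_const).continuousOn
  rw [this]
  simp_rw [legL_smul_integral]
  simp

/-- A polynomial of degree `< m` is reproduced by the projection. -/
lemma IsPoly.legProj_eq [CompleteSpace E] {m : ℕ} {f : ℝ → E} (hf : IsPoly m f) (t : ℝ) :
    legProj m f t = f t := by
  obtain ⟨a, ha⟩ := hf
  rw [ha, legProj, funext ha]
  refine Finset.sum_congr rfl fun j hj => ?_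
  have h0 : (2 * (j : ℝ) + 1) ≠ 0 := by positivity
  rw [legC_sum_legL, if_pos (Finset.mem_range.1 hj), smul_smul]
  congr 1
  field_simp

lemma isPoly_legProj (m : ℕ) (f : ℝ → E) : IsPoly m (legProj m f) :=
  ⟨fun j => (2 * (j : ℝ) + 1) • legC j f, fun t => by simp_rw [legProj, smul_smul, mul_comm]⟩

lemma legC_legProj [CompleteSpace E] {i m : ℕ} (h : i < m) (f : ℝ → E) :
    legC i (legProj m f) = legC i f := by
  have : legProj m f = fun t => ∑ j ∈ Finset.range m, legL j t • (2 * (j : ℝ) + 1) • legC j f := by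
    funext t; simp_rw [legProj, smul_smul, mul_comm]
  have h0 : (2 * (i : ℝ) + 1) ≠ 0 := by positivity
  rw [this, legC_sum_legL, if_pos h, smul_smul, one_div, inv_mul_cancel₀ h0, one_smul]

lemma IsPoly.legC_eq_zero [CompleteSpace E] {i m : ℕ} (h : m ≤ i) {f : ℝ → E} (hf : IsPoly m f) :
    legC i f = 0 := by
  obtain ⟨a, ha⟩ := hf
  rw [funext ha, legC_sum_legL, if_neg (by omega)]

/-- Two polynomials of degree `< m` with the same first `m` moments agree. -/
lemma IsPoly.eq_of_legC [CompleteSpace E] {m : ℕ} {f g : ℝ → E} (hf : IsPoly m f)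
    (hg : IsPoly m g) (h : ∀ j < m, legC j f = legC j g) (t : ℝ) : f t = g t := by
  rw [← hf.legProj_eq, ← hg.legProj_eq, legProj, legProj]
  exact Finset.sum_congr rfl fun j hj => by rw [h j (Finset.mem_range.1 hj)]

/-- A polynomial is orthogonal to `f` as soon as `f` has vanishing moments. -/
lemma IsPoly.integral_smul_eq_zero {m : ℕ} {q : ℝ → ℝ} (hq : IsPoly m q) {f : ℝ → E}
    (hf : ContinuousOn f (Icc 0 1)) (h : ∀ j < m, legC j f = 0) :
    ∫ t in (0 : ℝ)..1, q t • f t = 0 := by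
  obtain ⟨a, ha⟩ := hq
  simp_rw [ha, Finset.sum_smul, smul_eq_mul, mul_comm (legL _ _), ← smul_smul]
  have hi : ∀ j ∈ Finset.range m,
      IntervalIntegrable (fun t => a j • legL j t • f t) volume 0 1 :=
    fun j _ => (intervalIntegrable_legL_smul j hf).smul (a j)
  rw [intervalIntegral.integral_finsetSum hi]
  refine Finset.sum_eq_zero fun j hj => ?_
  rw [intervalIntegral.integral_smul]
  have := h j (Finset.mem_range.1 hj)
  rw [legC] at this
  rw [this, smul_zero]

lemma IsPoly.exists_deriv {m : ℕ} {f : ℝ → E} (hf : IsPoly (m + 1) f) :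
    ∃ f' : ℝ → E, IsPoly m f' ∧ ∀ t, HasDerivAt f (f' t) t := by
  obtain ⟨a, ha⟩ := hf
  refine ⟨fun t => ∑ j ∈ Finset.range (m + 1), legD j t • a j, isPoly_sum _ fun j hj => ?_,
    fun t => ?_⟩
  · exact ((isPoly_legD j).mono (Nat.lt_succ_iff.1 (Finset.mem_range.1 hj))).smul_const (a j)
  · rw [funext ha]
    exact HasDerivAt.fun_sum fun j _ => (hasDerivAt_legL j t).smul_const (a j)

end DGWave

/-! ### Decay of Legendre moments and approximation of smooth functions -/

namespace DGWave

/-- The squared `L²`-norm of the part of the Legendre expansion with indices in `[m, M)`. -/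
noncomputable def legTail (m M : ℕ) (f : ℝ → ℝ) : ℝ :=
  ∑ j ∈ Finset.Ico m M, (2 * (j : ℝ) + 1) * legC j f ^ 2

lemma integral_mul_isPoly {m : ℕ} (a : ℕ → ℝ) {f : ℝ → ℝ} (hf : ContinuousOn f (Icc 0 1)) :
    ∫ t in (0 : ℝ)..1, (∑ j ∈ Finset.range m, a j * legL j t) * f t
      = ∑ j ∈ Finset.range m, a j * legC j f := by
  have hi : ∀ j ∈ Finset.range m,
      IntervalIntegrable (fun t => a j * (legL j t * f t)) volume 0 1 :=
    fun j _ => (intervalIntegrable_legL_smul j hf).const_mul (a j)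
  simp_rw [Finset.sum_mul, mul_assoc]
  rw [intervalIntegral.integral_finsetSum hi]
  simp_rw [intervalIntegral.integral_const_mul]
  rfl

lemma integral_legComb_sq (m M : ℕ) (f : ℝ → ℝ) :
    ∫ t in (0 : ℝ)..1, (∑ j ∈ Finset.Ico m M, (2 * (j : ℝ) + 1) * legC j f * legL j t) ^ 2
      = legTail m M f := by
  set a : ℕ → ℝ := fun j => if m ≤ j then (2 * (j : ℝ) + 1) * legC j f else 0 with ha
  have e : ∀ t, ∑ j ∈ Finset.Ico m M, (2 * (j : ℝ) + 1) * legC j f * legL j t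
      = ∑ j ∈ Finset.range M, a j * legL j t := by
    intro t
    rw [Finset.range_eq_Ico]
    simp only [ha, ite_mul, zero_mul]
    rw [← Finset.sum_filter, Finset.Ico_filter_le, max_eq_right (Nat.zero_le m)]
  have hc : ContinuousOn (fun t => ∑ j ∈ Finset.range M, a j * legL j t) (Icc 0 1) :=
    (continuous_finsetSum _ fun j _ => continuous_const.mul (continuous_legL j)).continuousOn
  simp_rw [e, sq, integral_mul_isPoly a hc]
  have e2 : ∀ j ∈ Finset.range M, a j * legC j (fun t => ∑ j ∈ Finset.range M, a j * legL j t)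
      = if m ≤ j then (2 * (j : ℝ) + 1) * legC j f ^ 2 else 0 := by
    intro j hj
    have := legC_sum_legL (E := ℝ) j M a
    simp only [smul_eq_mul] at this
    simp_rw [mul_comm (a _)] at this ⊢
    rw [this, if_pos (Finset.mem_range.1 hj)]
    simp only [ha]
    have h0 : (2 * (j : ℝ) + 1) ≠ 0 := by positivity
    split_ifs
    · field_simp
    · simp
  rw [Finset.sum_congr rfl e2, ← Finset.sum_filter, Finset.range_eq_Ico, Finset.Ico_filter_le,
    max_eq_right (Nat.zero_le m), legTail]

/-- Bessel's inequality. -/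
lemma legTail_le_integral_sq (m M : ℕ) {f : ℝ → ℝ} (hf : ContinuousOn f (Icc 0 1)) :
    legTail m M f ≤ ∫ t in (0 : ℝ)..1, f t ^ 2 := by
  have h1 : legTail m M f ≤ legTail 0 M f :=
    Finset.sum_le_sum_of_subset_of_nonneg (Finset.Ico_subset_Ico_left (Nat.zero_le m))
      fun _ _ _ => by positivity
  refine h1.trans ?_
  set g : ℝ → ℝ := fun t => ∑ j ∈ Finset.range M, (2 * (j : ℝ) + 1) * legC j f * legL j t with hg
  have hgc : Continuous g :=
    continuous_finsetSum _ fun j _ => continuous_const.mul (continuous_legL j)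
  have e1 : ∫ t in (0 : ℝ)..1, g t ^ 2 = legTail 0 M f := by
    rw [← integral_legComb_sq, ← Finset.range_eq_Ico]
  have e2 : ∫ t in (0 : ℝ)..1, g t * f t = legTail 0 M f := by
    rw [hg, integral_mul_isPoly (fun j => (2 * (j : ℝ) + 1) * legC j f) hf, legTail,
      ← Finset.range_eq_Ico]
    exact Finset.sum_congr rfl fun j _ => by ring
  have i1 : IntervalIntegrable (fun t => f t ^ 2) volume 0 1 :=
    intervalIntegrable_of_continuousOn zero_le_one (hf.pow 2)
  have i2 : IntervalIntegrable (fun t => g t ^ 2) volume 0 1 := (hgc.pow 2).intervalIntegrable _ _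
  have i3 : IntervalIntegrable (fun t => g t * f t) volume 0 1 :=
    intervalIntegrable_of_continuousOn zero_le_one (hgc.continuousOn.mul hf)
  have h0 : 0 ≤ ∫ t in (0 : ℝ)..1, (f t - g t) ^ 2 :=
    intervalIntegral.integral_nonneg zero_le_one fun t _ => sq_nonneg _
  have h2 : ∫ t in (0 : ℝ)..1, (f t - g t) ^ 2 = (∫ t in (0 : ℝ)..1, f t ^ 2)
      - 2 * (∫ t in (0 : ℝ)..1, g t * f t) + ∫ t in (0 : ℝ)..1, g t ^ 2 := by
    rw [← intervalIntegral.integral_const_mul, ← intervalIntegral.integral_sub i1 (i3.const_mul _),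
      ← intervalIntegral.integral_add (i1.sub (i3.const_mul _)) i2]
    exact intervalIntegral.integral_congr fun t _ => by ring
  rw [e1, e2] at h2
  linarith

lemma legTail_le_of_abs_le (m M : ℕ) {f : ℝ → ℝ} (hf : ContinuousOn f (Icc 0 1)) {b : ℝ}
    (hb : ∀ t ∈ Icc (0 : ℝ) 1, |f t| ≤ b) : legTail m M f ≤ b ^ 2 := by
  refine (legTail_le_integral_sq m M hf).trans ?_
  have h1 : ∫ t in (0 : ℝ)..1, f t ^ 2 ≤ ∫ _t in (0 : ℝ)..1, b ^ 2 := by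
    refine intervalIntegral.integral_mono_on zero_le_one
      (intervalIntegrable_of_continuousOn zero_le_one (hf.pow 2)) (by simp) fun t ht => ?_
    rw [← sq_abs]
    exact pow_le_pow_left₀ (abs_nonneg _) (hb t ht) 2
  simpa using h1

/-- One derivative gains a factor of order `1 / m` in the Legendre tail. -/
lemma legTail_succ_le (m M : ℕ) {f f' : ℝ → ℝ} (hf : ContinuousOn f (Icc 0 1))
    (hd : ∀ t ∈ Ioo (0 : ℝ) 1, HasDerivAt f (f' t) t) (hf' : ContinuousOn f' (Icc 0 1)) :
    legTail (m + 1) (M + 1) f ≤ (1 / ((m : ℝ) + 1)) ^ 2 * legTail m (M + 2) f' := by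
  set w : ℕ → ℝ := fun j => (2 * (j : ℝ) + 1) * legC j f' ^ 2 with hw
  have hw0 : ∀ j, 0 ≤ w j := fun j => by positivity
  have hstep : ∀ i ∈ Finset.Ico m M, (2 * ((i + 1 : ℕ) : ℝ) + 1) * legC (i + 1) f ^ 2
      ≤ (1 / ((m : ℝ) + 1)) ^ 2 * (1 / 2 * (w (i + 2) + w i)) := by
    intro i hi
    have hmi : (m : ℝ) ≤ i := by exact_mod_cast (Finset.mem_Ico.1 hi).1
    have hm0 : (0 : ℝ) ≤ m := by positivity
    have e : legC (i + 1) f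
        = -(1 / (2 * (2 * (i : ℝ) + 3))) * (legC (i + 2) f' - legC i f') := by
      have := integral_legL_succ_smul i hf hd (intervalIntegrable_of_continuousOn zero_le_one hf')
      simp only [smul_eq_mul] at this
      simp only [legC, smul_eq_mul]
      rw [this, ← intervalIntegral.integral_sub]
      · simp_rw [sub_mul]
      · exact intervalIntegrable_legL_smul _ hf'
      · exact intervalIntegrable_legL_smul _ hf'
    rw [e]
    simp only [hw]
    push_cast
    set x := legC (i + 2) f'
    set y := legC i f'
    have h1 : (x - y) ^ 2 ≤ 2 * (x ^ 2 + y ^ 2) := by nlinarith [sq_nonneg (x + y)]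
    have e2 : (2 * ((i : ℝ) + 1) + 1) * (-(1 / (2 * (2 * (i : ℝ) + 3))) * (x - y)) ^ 2
        = (x - y) ^ 2 / (4 * (2 * i + 3)) := by
      field_simp
      ring
    rw [e2, div_pow, one_pow, one_div, ← div_eq_inv_mul, div_le_div_iff₀ (by positivity)
      (by positivity)]
    have h3 : ((m : ℝ) + 1) ^ 2 ≤ (2 * i + 3) * (2 * i + 1) := by nlinarith
    have h4 : (2 * (i : ℝ) + 1) * (x ^ 2 + y ^ 2)
        ≤ (2 * ((i : ℝ) + 2) + 1) * x ^ 2 + (2 * i + 1) * y ^ 2 := by nlinarith [sq_nonneg x]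
    calc (x - y) ^ 2 * ((m : ℝ) + 1) ^ 2
        ≤ 2 * (x ^ 2 + y ^ 2) * ((2 * i + 3) * (2 * i + 1)) := by gcongr
      _ = 2 * (2 * i + 3) * ((2 * (i : ℝ) + 1) * (x ^ 2 + y ^ 2)) := by ring
      _ ≤ 2 * (2 * i + 3) * ((2 * ((i : ℝ) + 2) + 1) * x ^ 2 + (2 * i + 1) * y ^ 2) := by
          gcongr
      _ = _ := by ring
  have e1 : legTail (m + 1) (M + 1) f
      = ∑ i ∈ Finset.Ico m M, (2 * ((i + 1 : ℕ) : ℝ) + 1) * legC (i + 1) f ^ 2 := by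
    rw [legTail, ← Finset.sum_Ico_add' (fun j : ℕ => (2 * (j : ℝ) + 1) * legC j f ^ 2)]
  rw [e1]
  refine (Finset.sum_le_sum hstep).trans ?_
  rw [← Finset.mul_sum, ← Finset.mul_sum, Finset.sum_add_distrib,
    Finset.sum_Ico_add' w m M 2]
  have h2 : ∑ x ∈ Finset.Ico (m + 2) (M + 2), w x ≤ legTail m (M + 2) f' :=
    Finset.sum_le_sum_of_subset_of_nonneg (Finset.Ico_subset_Ico_left (by omega))
      fun j _ _ => hw0 j
  have h3 : ∑ x ∈ Finset.Ico m M, w x ≤ legTail m (M + 2) f' :=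
    Finset.sum_le_sum_of_subset_of_nonneg (Finset.Ico_subset_Ico_right (by omega))
      fun j _ _ => hw0 j
  gcongr
  linarith

/-- A function on `[0, 1]` with all its derivatives: `F i` is continuous on `[0, 1]` and
`F (i + 1)` is the derivative of `F i` on `(0, 1)`. -/
structure SmoothChain {E : Type*} [NormedAddCommGroup E] [NormedSpace ℝ E] (F : ℕ → ℝ → E) :
    Prop where
  cont : ∀ i, ContinuousOn (F i) (Icc 0 1)
  deriv : ∀ i, ∀ t ∈ Ioo (0 : ℝ) 1, HasDerivAt (F i) (F (i + 1) t) t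

/-- `r` derivatives gain a factor `(m - r)! / m!` in the Legendre tail. -/
lemma legTail_le_chain {F : ℕ → ℝ → ℝ} (hF : SmoothChain F) (r : ℕ) : ∀ i m M : ℕ, r ≤ m → m ≤ M →
    legTail m M (F i)
      ≤ (((m - r).factorial : ℝ) / m.factorial) ^ 2 * legTail (m - r) (M + r) (F (i + r)) := by
  induction r with
  | zero =>
    intro i m M _ _
    have : ((m.factorial : ℝ) / m.factorial) = 1 := div_self (by positivity)
    simp [this]
  | succ r ih =>
    intro i m M hm hM
    obtain ⟨m, rfl⟩ : ∃ k, m = k + 1 := ⟨m - 1, by omega⟩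
    obtain ⟨M, rfl⟩ : ∃ k, M = k + 1 := ⟨M - 1, by omega⟩
    refine (legTail_succ_le m M (hF.cont i) (hF.deriv i) (hF.cont _)).trans ?_
    have h2 := ih (i + 1) m (M + 2) (by omega) (by omega)
    rw [show m + 1 - (r + 1) = m - r by omega, show M + 1 + (r + 1) = M + 2 + r by omega,
      show i + (r + 1) = i + 1 + r by omega]
    refine (mul_le_mul_of_nonneg_left h2 (by positivity)).trans_eq ?_
    rw [← mul_assoc, ← mul_pow, Nat.factorial_succ]
    congr 2
    push_cast
    field_simp

lemma SmoothChain.clm {E F : Type*} [NormedAddCommGroup E] [NormedSpace ℝ E]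
    [NormedAddCommGroup F] [NormedSpace ℝ F] {G : ℕ → ℝ → E} (hG : SmoothChain G)
    (L : E →L[ℝ] F) : SmoothChain fun i t => L (G i t) where
  cont i := L.continuous.comp_continuousOn (hG.cont i)
  deriv i t ht := L.hasFDerivAt.comp_hasDerivAt t (hG.deriv i t ht)

lemma SmoothChain.shift {E : Type*} [NormedAddCommGroup E] [NormedSpace ℝ E] {G : ℕ → ℝ → E}
    (hG : SmoothChain G) (k : ℕ) : SmoothChain fun i => G (i + k) where
  cont i := hG.cont _
  deriv i t ht := by rw [show i + 1 + k = i + k + 1 by omega]; exact hG.deriv _ t ht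

lemma legTail_le_of_chain {F : ℕ → ℝ → ℝ} (hF : SmoothChain F) {r m M : ℕ} (hr : r ≤ m)
    (hM : m ≤ M) {b : ℝ} (hb : ∀ t ∈ Icc (0 : ℝ) 1, |F r t| ≤ b) :
    legTail m M (F 0) ≤ (((m - r).factorial : ℝ) / m.factorial * b) ^ 2 := by
  refine (legTail_le_chain hF r 0 m M hr hM).trans ?_
  rw [mul_pow, zero_add]
  gcongr
  exact legTail_le_of_abs_le _ _ (hF.cont r) hb

variable {E : Type*} [NormedAddCommGroup E] [NormedSpace ℝ E] [CompleteSpace E]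

/-- The `m`-th Legendre moment of a smooth function is small. -/
lemma norm_legC_le {F : ℕ → ℝ → E} (hF : SmoothChain F) {r m : ℕ} (hr : r ≤ m) {b : ℝ}
    (hb0 : 0 ≤ b) (hb : ∀ t ∈ Icc (0 : ℝ) 1, ‖F r t‖ ≤ b) :
    ‖legC m (F 0)‖ ≤ 1 / √(2 * m + 1) * (((m - r).factorial : ℝ) / m.factorial * b) := by
  refine NormedSpace.norm_le_dual_bound ℝ _ (by positivity) fun φ => ?_
  rw [← legC_clm m (hF.cont 0) φ, Real.norm_eq_abs]
  have h := legTail_le_of_chain (hF.clm φ) hr (Nat.le_succ m) (b := ‖φ‖ * b) fun t ht =>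
    (φ.le_opNorm _).trans (mul_le_mul_of_nonneg_left (hb t ht) (norm_nonneg _))
  rw [legTail, Nat.Ico_succ_singleton, Finset.sum_singleton] at h
  have h2 : |√(2 * (m : ℝ) + 1) * legC m fun t => φ (F 0 t)|
      ≤ √((((m - r).factorial : ℝ) / m.factorial * (‖φ‖ * b)) ^ 2) := by
    refine Real.abs_le_sqrt ?_
    rw [mul_pow, Real.sq_sqrt (by positivity)]
    exact h
  rw [Real.sqrt_sq (by positivity), abs_mul, abs_of_nonneg (Real.sqrt_nonneg _)] at h2
  have : 0 < √(2 * (m : ℝ) + 1) := by positivity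
  rw [one_div, mul_assoc, inv_mul_eq_div, le_div_iff₀ this]
  linarith

/-- A bound for all finite tails of the Legendre expansion bounds the integral over `[t, 1]` of the
truncation error; the completeness of the Legendre polynomials enters through a uniform polynomial
approximation of `f`. -/
lemma abs_integral_sub_legProj_le {f : ℝ → ℝ} (hf : ContinuousOn f (Icc 0 1)) {m : ℕ} {K : ℝ}
    (hK0 : 0 ≤ K) (hK : ∀ M, m ≤ M → legTail m M f ≤ K ^ 2) {t : ℝ} (ht : t ∈ Icc (0 : ℝ) 1) :
    |∫ s in t..1, (f s - legProj m f s)| ≤ K := by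
  have hsub : Icc t 1 ⊆ Icc 0 1 := Icc_subset_Icc_left ht.1
  have hpc : ∀ M (g : ℝ → ℝ), Continuous (legProj M g) := fun M g => (isPoly_legProj M g).continuous
  -- a function with small `L²(0,1)` norm has small integral over `[t, 1]`
  have hCS : ∀ {g : ℝ → ℝ} (_ : ContinuousOn g (Icc 0 1)) {b : ℝ} (_ : 0 ≤ b)
      (_ : ∫ s in (0 : ℝ)..1, g s ^ 2 ≤ b ^ 2), |∫ s in t..1, g s| ≤ b := by
    intro g hg b hb0 hb
    have h1 := abs_integral_mul_le ht.2 (f := fun _ => (1 : ℝ)) (g := g) continuousOn_const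
      (hg.mono hsub)
    simp only [one_mul, one_pow, intervalIntegral.integral_const, smul_eq_mul, mul_one] at h1
    have h2 : ∫ s in t..1, g s ^ 2 ≤ ∫ s in (0 : ℝ)..1, g s ^ 2 := by
      refine intervalIntegral.integral_mono_interval ht.1 ht.2 le_rfl
        (Eventually.of_forall fun s => sq_nonneg (g s)) ?_
      exact intervalIntegrable_of_continuousOn zero_le_one (hg.pow 2)
    have h3 : √(∫ s in t..1, g s ^ 2) ≤ b := Real.sqrt_le_iff.2 ⟨hb0, h2.trans hb⟩
    have h4 : √(1 - t) ≤ 1 := Real.sqrt_le_one.2 (by linarith [ht.1])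
    calc |∫ s in t..1, g s| ≤ √(1 - t) * √(∫ s in t..1, g s ^ 2) := h1
      _ ≤ 1 * b := by gcongr
      _ = b := one_mul b
  refine le_of_forall_pos_le_add fun ε hε => ?_
  obtain ⟨q, hq⟩ := exists_polynomial_near_of_continuousOn 0 1 f hf (ε / 2) (by positivity)
  set M := max m (q.natDegree + 1) with hM
  have hmM : m ≤ M := le_max_left _ _
  have hqp : IsPoly M fun s => q.eval s := isPoly_eval q (by omega)
  have hqc : Continuous fun s => q.eval s := q.continuous
  have hg : ContinuousOn (fun s => f s - q.eval s) (Icc 0 1) := hf.sub hqc.continuousOn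
  have hgb : ∀ s ∈ Icc (0 : ℝ) 1, |f s - q.eval s| ≤ ε / 2 := fun s hs => by
    rw [abs_sub_comm]; exact (hq s hs).le
  -- `f - π_M f = (f - q) - π_M (f - q)`
  have e1 : ∀ s, f s - legProj M f s
      = (f s - q.eval s) - legProj M (fun s => f s - q.eval s) s := by
    intro s
    have : legProj M (fun s => f s - q.eval s) s = legProj M f s - q.eval s := by
      conv_rhs => rw [← hqp.legProj_eq s]
      simp_rw [legProj, legC_sub _ hf hqc.continuousOn, smul_sub, Finset.sum_sub_distrib]
    rw [this]
    ring
  have hT1 : |∫ s in t..1, (f s - q.eval s)| ≤ ε / 2 :=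
    hCS hg (by positivity) ((intervalIntegral.integral_mono_on zero_le_one
      (intervalIntegrable_of_continuousOn zero_le_one (hg.pow 2)) (by simp : IntervalIntegrable
        (fun _ => (ε / 2) ^ 2) volume 0 1) fun s hs => by
          exact sq_le_sq' (abs_le.1 (hgb s hs)).1 (abs_le.1 (hgb s hs)).2).trans_eq (by simp))
  have hproj : ∀ (a b : ℕ) (g : ℝ → ℝ) (s : ℝ), a ≤ b → legProj b g s - legProj a g s
      = ∑ j ∈ Finset.Ico a b, (2 * (j : ℝ) + 1) * legC j g * legL j s := by
    intro a b g s hab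
    rw [legProj, legProj, Finset.sum_Ico_eq_sub _ hab]
    simp_rw [smul_eq_mul, mul_right_comm]
  have hT2 : |∫ s in t..1, legProj M (fun s => f s - q.eval s) s| ≤ ε / 2 := by
    refine hCS (hpc _ _).continuousOn (by positivity) ?_
    have : ∀ s, legProj M (fun s => f s - q.eval s) s = ∑ j ∈ Finset.Ico 0 M,
        (2 * (j : ℝ) + 1) * legC j (fun s => f s - q.eval s) * legL j s := by
      intro s
      rw [← hproj 0 M _ s (Nat.zero_le _)]
      simp [legProj]
    rw [funext this, integral_legComb_sq]
    exact legTail_le_of_abs_le 0 M hg hgb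
  have hT3 : |∫ s in t..1, (legProj M f s - legProj m f s)| ≤ K := by
    refine hCS (g := fun s => legProj M f s - legProj m f s)
      ((hpc _ _).sub (hpc _ _)).continuousOn hK0 ?_
    simp_rw [hproj m M f _ hmM, integral_legComb_sq]
    exact hK M hmM
  have e2 : ∫ s in t..1, (f s - legProj m f s) = (∫ s in t..1, (f s - q.eval s))
      - (∫ s in t..1, legProj M (fun s => f s - q.eval s) s)
      + ∫ s in t..1, (legProj M f s - legProj m f s) := by
    have i1 := intervalIntegrable_of_continuousOn ht.2 (hg.mono hsub)
    have i2 : IntervalIntegrable (legProj M fun s => f s - q.eval s) volume t 1 :=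
      (hpc M _).intervalIntegrable _ _
    have i3 : IntervalIntegrable (fun s => legProj M f s - legProj m f s) volume t 1 :=
      ((hpc M f).sub (hpc m f)).intervalIntegrable _ _
    rw [← intervalIntegral.integral_sub i1 i2, ← intervalIntegral.integral_add (i1.sub i2) i3]
    refine intervalIntegral.integral_congr fun s _ => ?_
    have := e1 s
    linarith
  rw [e2]
  calc _ ≤ |∫ s in t..1, (f s - q.eval s)|
        + |∫ s in t..1, legProj M (fun s => f s - q.eval s) s|
        + |∫ s in t..1, (legProj M f s - legProj m f s)| :=
        (abs_add_le _ _).trans (add_le_add_left (abs_sub _ _) _)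
    _ ≤ ε / 2 + ε / 2 + K := add_le_add (add_le_add hT1 hT2) hT3
    _ = K + ε := by ring

lemma legProj_clm {F : Type*} [NormedAddCommGroup F] [NormedSpace ℝ F] [CompleteSpace F] (m : ℕ)
    {f : ℝ → E} (hf : ContinuousOn f (Icc 0 1)) (L : E →L[ℝ] F) (t : ℝ) :
    legProj m (fun t => L (f t)) t = L (legProj m f t) := by
  simp [legProj, legC_clm _ hf]

lemma norm_integral_sub_legProj_le {F : ℕ → ℝ → E} (hF : SmoothChain F) {r m : ℕ} (hr : r ≤ m)
    {b : ℝ} (hb0 : 0 ≤ b) (hb : ∀ t ∈ Icc (0 : ℝ) 1, ‖F r t‖ ≤ b) {t : ℝ}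
    (ht : t ∈ Icc (0 : ℝ) 1) :
    ‖∫ s in t..1, (F 0 s - legProj m (F 0) s)‖ ≤ ((m - r).factorial : ℝ) / m.factorial * b := by
  refine NormedSpace.norm_le_dual_bound ℝ _ (by positivity) fun φ => ?_
  have hi : IntervalIntegrable (fun s => F 0 s - legProj m (F 0) s) volume t 1 :=
    intervalIntegrable_of_continuousOn ht.2 (((hF.cont 0).mono (Icc_subset_Icc_left ht.1)).sub
      (isPoly_legProj m _).continuous.continuousOn)
  rw [← φ.intervalIntegral_comp_comm hi, Real.norm_eq_abs]
  simp_rw [map_sub, ← legProj_clm m (hF.cont 0) φ]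
  refine abs_integral_sub_legProj_le ((hF.clm φ).cont 0) (by positivity) (fun M hM => ?_) ht
  refine (legTail_le_of_chain (hF.clm φ) hr hM (b := ‖φ‖ * b) fun t ht =>
    (φ.le_opNorm _).trans (mul_le_mul_of_nonneg_left (hb t ht) (norm_nonneg _))).trans_eq ?_
  ring

end DGWave

/-! ### The interpolating projection on the reference cell -/

namespace DGWave

variable {E : Type*} [NormedAddCommGroup E] [NormedSpace ℝ E]

/-- The defect at the right end point of the `L²`-projection onto polynomials of degree `≤ p`. -/
noncomputable def endDefect (p : ℕ) (f : ℝ → E) : E := f 1 - legProj (p + 1) f 1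

/-- The projection onto polynomials of degree `≤ p` which interpolates at `1` and keeps the first
`p` Legendre moments. -/
noncomputable def interp (p : ℕ) (f : ℝ → E) (t : ℝ) : E :=
  legProj (p + 1) f t + legL p t • endDefect p f

lemma isPoly_interp (p : ℕ) (f : ℝ → E) : IsPoly (p + 1) (interp p f) :=
  (isPoly_legProj _ _).add (isPoly_legL_smul (Nat.lt_succ_self p) _)

lemma interp_one (p : ℕ) (f : ℝ → E) : interp p f 1 = f 1 := by
  simp [interp, legL_at_one, endDefect]

/-- Integration by parts against a Legendre polynomial. -/
lemma legC_deriv [CompleteSpace E] (j : ℕ) {f f' : ℝ → E} (hf : ContinuousOn f (Icc 0 1))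
    (hd : ∀ t ∈ Ioo (0 : ℝ) 1, HasDerivAt f (f' t) t) (hf' : ContinuousOn f' (Icc 0 1)) :
    legC j f' = f 1 - (-1 : ℝ) ^ j • f 0 - ∫ t in (0 : ℝ)..1, legD j t • f t := by
  have i1 : IntervalIntegrable (fun t => legD j t • f t) volume 0 1 :=
    intervalIntegrable_of_continuousOn zero_le_one ((continuous_legD j).continuousOn.smul hf)
  have i2 := intervalIntegrable_legL_smul j hf'
  have h := intervalIntegral.integral_eq_sub_of_hasDerivAt_of_le zero_le_one
    (f := fun t => legL j t • f t) (f' := fun t => legL j t • f' t + legD j t • f t)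
    ((continuous_legL j).continuousOn.smul hf)
    (fun t ht => (hasDerivAt_legL j t).smul (hd t ht)) (i2.add i1)
  rw [intervalIntegral.integral_add i2 i1, legL_at_one, legL_at_zero, one_smul] at h
  rw [legC, ← h, add_sub_cancel_right]

lemma isPoly_kerL_smul (p : ℕ) (x : E) : IsPoly (p + 1) fun t => kerL p t • x := by
  refine IsPoly.smul_const (f := kerL p) ?_ x
  exact ⟨fun j => (2 * (j : ℝ) + 1) * (-1) ^ j, fun t => by
    rw [kerL]; exact Finset.sum_congr rfl fun j _ => by simp; ring⟩

lemma isPoly_kerR_smul (p : ℕ) (x : E) : IsPoly (p + 1) fun t => kerR p t • x := by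
  refine IsPoly.smul_const (f := kerR p) ?_ x
  exact ⟨fun j => (2 * (j : ℝ) + 1), fun t => by
    rw [kerR]; exact Finset.sum_congr rfl fun j _ => by simp; ring⟩

lemma legC_kerL_smul [CompleteSpace E] {j p : ℕ} (h : j ≤ p) (x : E) :
    legC j (fun t => kerL p t • x) = (-1 : ℝ) ^ j • x := by
  have e : (fun t => kerL p t • x) = fun t =>
      ∑ j ∈ Finset.range (p + 1), legL j t • ((2 * (j : ℝ) + 1) * (-1) ^ j) • x := by
    funext t
    rw [kerL, Finset.sum_smul]
    exact Finset.sum_congr rfl fun j _ => by rw [smul_smul]; congr 1; ring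
  rw [e, legC_sum_legL, if_pos (by omega), smul_smul]
  congr 1
  have : (2 * (j : ℝ) + 1) ≠ 0 := by positivity
  field_simp

lemma legC_kerR_smul [CompleteSpace E] {j p : ℕ} (h : j ≤ p) (x : E) :
    legC j (fun t => kerR p t • x) = x := by
  have e : (fun t => kerR p t • x) = fun t =>
      ∑ j ∈ Finset.range (p + 1), legL j t • (2 * (j : ℝ) + 1) • x := by
    funext t
    rw [kerR, Finset.sum_smul]
    exact Finset.sum_congr rfl fun j _ => by rw [smul_smul]; congr 1; ring
  have : (2 * (j : ℝ) + 1) ≠ 0 := by positivity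
  rw [e, legC_sum_legL, if_pos (by omega), smul_smul, one_div, inv_mul_cancel₀ this, one_smul]

lemma legProj_one [CompleteSpace E] (p : ℕ) {f : ℝ → E} (hf : ContinuousOn f (Icc 0 1)) :
    legProj (p + 1) f 1 = ∫ t in (0 : ℝ)..1, kerR p t • f t := by
  simp_rw [kerR, Finset.sum_smul, ← smul_smul]
  have hi : ∀ j ∈ Finset.range (p + 1),
      IntervalIntegrable (fun t => (2 * (j : ℝ) + 1) • legL j t • f t) volume 0 1 :=
    fun j _ => (intervalIntegrable_legL_smul j hf).smul (2 * (j : ℝ) + 1)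
  rw [intervalIntegral.integral_finsetSum hi]
  simp_rw [intervalIntegral.integral_smul, legProj, legL_at_one, mul_one]
  rfl

lemma integral_legD_smul [CompleteSpace E] (j : ℕ) {f f' : ℝ → E} (hf : ContinuousOn f (Icc 0 1))
    (hd : ∀ t ∈ Ioo (0 : ℝ) 1, HasDerivAt f (f' t) t) (hf' : ContinuousOn f' (Icc 0 1)) :
    ∫ t in (0 : ℝ)..1, legD j t • f t = f 1 - (-1 : ℝ) ^ j • f 0 - legC j f' := by
  rw [legC_deriv j hf hd hf']
  abel

/-- The end point defect only involves the two moments of order `p` and `p + 1` of the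
derivative. -/
lemma endDefect_eq [CompleteSpace E] (p : ℕ) {f f' : ℝ → E} (hf : ContinuousOn f (Icc 0 1))
    (hd : ∀ t ∈ Ioo (0 : ℝ) 1, HasDerivAt f (f' t) t) (hf' : ContinuousOn f' (Icc 0 1)) :
    endDefect p f = (1 / 2 : ℝ) • (legC p f' + legC (p + 1) f') := by
  have i1 : ∀ j, IntervalIntegrable (fun t => legD j t • f t) volume 0 1 := fun j =>
    intervalIntegrable_of_continuousOn zero_le_one ((continuous_legD j).continuousOn.smul hf)
  have e : ∀ t, kerR p t • f t = (1 / 2 : ℝ) • (legD (p + 1) t • f t + legD p t • f t) := by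
    intro t
    rw [← add_smul, ← kerR_eq_legD, smul_smul]
    congr 1; ring
  rw [endDefect, legProj_one p hf]
  simp_rw [e]
  rw [intervalIntegral.integral_smul, intervalIntegral.integral_add (i1 _) (i1 _),
    integral_legD_smul _ hf hd hf', integral_legD_smul _ hf hd hf', pow_succ]
  module

lemma factorial_ratio_bound {p s : ℕ} (hs : s + 1 ≤ p + 1) :
    1 / √(2 * (p : ℝ) + 1) * (((p - s).factorial : ℝ) / p.factorial)
      ≤ √((p : ℝ) + 1) * (((p + 1 - (s + 1)).factorial : ℝ) / (p + 1).factorial) := by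
  have e : p + 1 - (s + 1) = p - s := by omega
  rw [e, Nat.factorial_succ]
  push_cast
  have h1 : √((p : ℝ) + 1) ≤ √(2 * p + 1) :=
    Real.sqrt_le_sqrt (by linarith [p.cast_nonneg (α := ℝ)])
  have h0 : 0 < √((p : ℝ) + 1) := by positivity
  have h2 : √((p : ℝ) + 1) * √((p : ℝ) + 1) = p + 1 := Real.mul_self_sqrt (by positivity)
  calc 1 / √(2 * (p : ℝ) + 1) * (((p - s).factorial : ℝ) / p.factorial)
      ≤ 1 / √((p : ℝ) + 1) * (((p - s).factorial : ℝ) / p.factorial) := by gcongr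
    _ = _ := by field_simp; rw [sq, h2]

lemma factorial_ratio_bound' {p s : ℕ} (hs : s + 1 ≤ p + 1) :
    1 / √(2 * ((p + 1 : ℕ) : ℝ) + 1) * (((p + 1 - s).factorial : ℝ) / (p + 1).factorial)
      ≤ √((p : ℝ) + 1) * (((p + 1 - (s + 1)).factorial : ℝ) / (p + 1).factorial) := by
  have e : p + 1 - (s + 1) = p - s := by omega
  have e2 : p + 1 - s = (p - s) + 1 := by omega
  rw [e, e2, Nat.factorial_succ (p - s)]
  have h1 : √((p : ℝ) + 1) ≤ √(2 * ((p + 1 : ℕ) : ℝ) + 1) :=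
    Real.sqrt_le_sqrt (by push_cast; linarith [p.cast_nonneg (α := ℝ)])
  have h0 : 0 < √((p : ℝ) + 1) := by positivity
  have h2 : √((p : ℝ) + 1) * √((p : ℝ) + 1) = p + 1 := Real.mul_self_sqrt (by positivity)
  have h3 : ((p - s : ℕ) : ℝ) + 1 ≤ p + 1 := by
    have : ((p - s : ℕ) : ℝ) ≤ p := by exact_mod_cast Nat.sub_le p s
    linarith
  have h4 : 1 / √((p : ℝ) + 1) * (p + 1) = √((p : ℝ) + 1) := by field_simp; rw [sq, h2]
  push_cast at *
  calc _ ≤ 1 / √((p : ℝ) + 1) * (((p + 1) * ((p - s).factorial : ℝ)) / (p + 1).factorial) := by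
        gcongr
    _ = (1 / √((p : ℝ) + 1) * (p + 1)) * (((p - s).factorial : ℝ) / (p + 1).factorial) := by ring
    _ = _ := by rw [h4]

/-- The end point defect loses only a factor `√(p + 1)` over the optimal order. -/
lemma norm_endDefect_le [CompleteSpace E] {F : ℕ → ℝ → E} (hF : SmoothChain F) {p s : ℕ}
    (hs : s ≤ p + 1) {b : ℝ} (hb0 : 0 ≤ b) (hb : ∀ t ∈ Icc (0 : ℝ) 1, ‖F s t‖ ≤ b) :
    ‖endDefect p (F 0)‖
      ≤ 45 * √((p : ℝ) + 1) * (((p + 1 - s).factorial : ℝ) / (p + 1).factorial * b) := by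
  have hn : 1 ≤ √((p : ℝ) + 1) := Real.one_le_sqrt.2 (by linarith [p.cast_nonneg (α := ℝ)])
  rcases s with _ | s
  · have e : (((p + 1 - 0).factorial : ℝ) / (p + 1).factorial) = 1 := div_self (by positivity)
    rw [e, one_mul, endDefect, legProj_one p (hF.cont 0)]
    have h1 : ‖∫ t in (0 : ℝ)..1, kerR p t • F 0 t‖ ≤ 44 * √((p : ℝ) + 1) * b := by
      refine (intervalIntegral.norm_integral_le_integral_norm zero_le_one).trans ?_
      have : ∫ t in (0 : ℝ)..1, ‖kerR p t • F 0 t‖ ≤ ∫ t in (0 : ℝ)..1, |kerR p t| * b := by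
        refine intervalIntegral.integral_mono_on zero_le_one ?_ ?_ fun t ht => ?_
        · exact intervalIntegrable_of_continuousOn zero_le_one
            ((continuous_kerR p).continuousOn.smul (hF.cont 0)).norm
        · exact ((continuous_kerR p).abs.mul continuous_const).intervalIntegrable _ _
        · rw [norm_smul, Real.norm_eq_abs]
          exact mul_le_mul_of_nonneg_left (hb t ht) (abs_nonneg _)
      refine this.trans ?_
      rw [intervalIntegral.integral_mul_const]
      exact mul_le_mul_of_nonneg_right (integral_abs_kerR_total_le p) hb0
    have h2 := hb 1 (by simp)
    calc _ ≤ ‖F 0 1‖ + ‖∫ t in (0 : ℝ)..1, kerR p t • F 0 t‖ := norm_sub_le _ _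
      _ ≤ b + 44 * √((p : ℝ) + 1) * b := add_le_add h2 h1
      _ ≤ 45 * √((p : ℝ) + 1) * b := by nlinarith
  · set β := (((p + 1 - (s + 1)).factorial : ℝ) / (p + 1).factorial) with hβ
    have hβ0 : 0 ≤ β := by positivity
    rw [endDefect_eq p (hF.cont 0) (hF.deriv 0) (hF.cont 1), norm_smul]
    have hF1 := hF.shift 1
    have h1 := norm_legC_le hF1 (r := s) (m := p) (by omega) hb0 hb
    have h2 := norm_legC_le hF1 (r := s) (m := p + 1) (by omega) hb0 hb
    have h3 := mul_le_mul_of_nonneg_right (factorial_ratio_bound hs) hb0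
    have h4 := mul_le_mul_of_nonneg_right (factorial_ratio_bound' hs) hb0
    rw [← hβ] at h3 h4
    have h5 : 0 ≤ √((p : ℝ) + 1) * (β * b) := by positivity
    have h6 : ‖(1 / 2 : ℝ)‖ = 1 / 2 := by norm_num
    rw [h6]
    have h7 := norm_add_le (legC p (F 1)) (legC (p + 1) (F 1))
    simp only [zero_add] at h1 h2
    linarith

/-- Time reversal turns statements about the right end point into statements about the left one. -/
lemma SmoothChain.reflect {F : ℕ → ℝ → E} (hF : SmoothChain F) :
    SmoothChain fun i t => (-1 : ℝ) ^ i • F i (1 - t) where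
  cont i := by
    refine ContinuousOn.const_smul (ContinuousOn.comp (hF.cont i)
      (continuous_const.sub continuous_id).continuousOn fun t ht => ?_) _
    exact ⟨by simpa using ht.2, by simpa using ht.1⟩
  deriv i t ht := by
    have e2 : HasDerivAt (fun x : ℝ => 1 - x) (-1) t := by
      simpa using (hasDerivAt_id t).const_sub (1 : ℝ)
    have h1 : HasDerivAt (F i) (F (i + 1) (1 - t)) (1 - t) :=
      hF.deriv i (1 - t) ⟨by linarith [ht.2], by linarith [ht.1]⟩
    refine ((h1.scomp t e2).const_smul _).congr_deriv ?_
    rw [smul_smul, pow_succ]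

lemma legC_reflect (j : ℕ) (f : ℝ → E) :
    legC j (fun t => f (1 - t)) = (-1 : ℝ) ^ j • legC j f := by
  have e : ∀ t, legL j t • f (1 - t) = (-1 : ℝ) ^ j • (legL j (1 - t) • f (1 - t)) := by
    intro t
    rw [legL_symm, smul_smul, ← mul_assoc, ← pow_add, Even.neg_one_pow ⟨j, rfl⟩, one_mul]
  simp_rw [legC, e]
  rw [intervalIntegral.integral_smul,
    intervalIntegral.integral_comp_sub_left (fun t => legL j t • f t) 1]
  simp

lemma norm_startDefect_le [CompleteSpace E] {F : ℕ → ℝ → E} (hF : SmoothChain F) {p s : ℕ}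
    (hs : s ≤ p + 1) {b : ℝ} (hb0 : 0 ≤ b) (hb : ∀ t ∈ Icc (0 : ℝ) 1, ‖F s t‖ ≤ b) :
    ‖F 0 0 - legProj (p + 1) (F 0) 0‖
      ≤ 45 * √((p : ℝ) + 1) * (((p + 1 - s).factorial : ℝ) / (p + 1).factorial * b) := by
  have h := norm_endDefect_le hF.reflect (p := p) hs hb0 (fun t ht => by
    rw [norm_smul, norm_pow, norm_neg, norm_one, one_pow, one_mul]
    exact hb _ ⟨by linarith [ht.2], by linarith [ht.1]⟩)
  have e : endDefect p (fun t => (-1 : ℝ) ^ 0 • F 0 (1 - t))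
      = F 0 0 - legProj (p + 1) (F 0) 0 := by
    simp only [pow_zero, one_smul, endDefect, legProj, sub_self]
    simp_rw [legC_reflect, legL_at_one, legL_at_zero, smul_smul, mul_one]
  rwa [e] at h

lemma legC_interp [CompleteSpace E] {j p : ℕ} (hj : j < p) (f : ℝ → E) :
    legC j (interp p f) = legC j f := by
  unfold interp
  rw [legC_add (g := fun t => legL p t • endDefect p f) j
    (isPoly_legProj _ _).continuous.continuousOn
    ((continuous_legL p).smul continuous_const).continuousOn, legC_legProj (by omega),
    legL_smul_integral, if_neg (by omega), add_zero]

/-- The interpolating projection almost commutes with differentiation; the correction is the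
error at the left end point times the kernel reproducing the value at `0`. -/
lemma hasDerivAt_interp [CompleteSpace E] (p : ℕ) {f f' : ℝ → E} (hf : ContinuousOn f (Icc 0 1))
    (hd : ∀ t ∈ Ioo (0 : ℝ) 1, HasDerivAt f (f' t) t) (hf' : ContinuousOn f' (Icc 0 1)) (t : ℝ) :
    HasDerivAt (interp p f)
      (legProj (p + 1) f' t + kerL p t • (f 0 - interp p f 0)) t := by
  obtain ⟨w', hw', hd'⟩ := (isPoly_interp p f).exists_deriv
  refine (hd' t).congr_deriv ?_
  have hcont : ContinuousOn (interp p f) (Icc 0 1) := (isPoly_interp p f).continuous.continuousOn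
  refine (hw'.mono (Nat.le_succ p)).eq_of_legC
    ((isPoly_legProj _ _).add (isPoly_kerL_smul p _)) (fun j hj => ?_) t
  rw [legC_add j (isPoly_legProj _ _).continuous.continuousOn
    (isPoly_kerL_smul p _).continuous.continuousOn, legC_legProj hj,
    legC_kerL_smul (by omega), legC_deriv j hf hd hf',
    legC_deriv j hcont (fun t _ => hd' t) hw'.continuous.continuousOn, interp_one]
  have h0 : ∫ t in (0 : ℝ)..1, legD j t • (interp p f t - f t) = 0 := by
    refine (isPoly_legD j).integral_smul_eq_zero (hcont.sub hf) fun i hi => ?_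
    rw [legC_sub i hcont hf, legC_interp (by omega), sub_self]
  simp_rw [smul_sub] at h0
  rw [intervalIntegral.integral_sub, sub_eq_zero] at h0
  · rw [h0, smul_sub]
    abel
  · exact intervalIntegrable_of_continuousOn zero_le_one
      ((continuous_legD j).continuousOn.smul hcont)
  · exact intervalIntegrable_of_continuousOn zero_le_one ((continuous_legD j).continuousOn.smul hf)

lemma norm_integral_kerL_smul_le (p : ℕ) (x : E) {t : ℝ} (ht : t ∈ Icc (0 : ℝ) 1) :
    ‖∫ s in t..1, kerL p s • x‖ ≤ 44 * √((p : ℝ) + 1) * ‖x‖ := by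
  refine (intervalIntegral.norm_integral_le_integral_norm ht.2).trans ?_
  simp_rw [norm_smul, Real.norm_eq_abs]
  rw [intervalIntegral.integral_mul_const]
  refine mul_le_mul_of_nonneg_right ((?_ : _ ≤ _).trans (integral_abs_kerL_total_le p))
    (norm_nonneg x)
  exact intervalIntegral.integral_mono_interval ht.1 ht.2 le_rfl
    (Eventually.of_forall fun s => abs_nonneg _) ((continuous_kerL p).abs.intervalIntegrable _ _)

/-- Uniform approximation by the interpolating projection. -/
lemma norm_sub_interp_le [CompleteSpace E] {F : ℕ → ℝ → E} (hF : SmoothChain F) {p s : ℕ}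
    (hs : s ≤ p + 1) {b b' : ℝ} (hb0 : 0 ≤ b) (hb : ∀ t ∈ Icc (0 : ℝ) 1, ‖F s t‖ ≤ b)
    (hb0' : 0 ≤ b') (hb' : ∀ t ∈ Icc (0 : ℝ) 1, ‖F (s + 1) t‖ ≤ b') {t : ℝ}
    (ht : t ∈ Icc (0 : ℝ) 1) :
    ‖F 0 t - interp p (F 0) t‖
      ≤ ((p + 1 - s).factorial : ℝ) / (p + 1).factorial * (b' + 3960 * ((p : ℝ) + 1) * b) := by
  set β := ((p + 1 - s).factorial : ℝ) / (p + 1).factorial with hβ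
  set x := F 0 0 - interp p (F 0) 0 with hx
  have hx1 : ‖x‖ ≤ 90 * √((p : ℝ) + 1) * (β * b) := by
    have e : x = (F 0 0 - legProj (p + 1) (F 0) 0) - (-1 : ℝ) ^ p • endDefect p (F 0) := by
      rw [hx, interp, legL_at_zero]; abel
    have h1 := norm_startDefect_le hF (p := p) hs hb0 hb
    have h2 := norm_endDefect_le hF (p := p) hs hb0 hb
    rw [e]
    refine (norm_sub_le _ _).trans ?_
    rw [norm_smul, norm_pow, norm_neg, norm_one, one_pow, one_mul]
    linarith
  have hsub : Icc t 1 ⊆ Icc 0 1 := Icc_subset_Icc_left ht.1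
  have i1 : IntervalIntegrable (fun s => F 1 s - legProj (p + 1) (F 1) s) volume t 1 :=
    intervalIntegrable_of_continuousOn ht.2 (((hF.cont 1).mono hsub).sub
      (isPoly_legProj _ _).continuous.continuousOn)
  have i2 : IntervalIntegrable (fun s => kerL p s • x) volume t 1 :=
    ((continuous_kerL p).smul continuous_const).intervalIntegrable _ _
  have h := intervalIntegral.integral_eq_sub_of_hasDerivAt_of_le ht.2
    (f := fun t => F 0 t - interp p (F 0) t)
    (f' := fun t => (F 1 t - legProj (p + 1) (F 1) t) - kerL p t • x)
    (((hF.cont 0).mono hsub).sub (isPoly_interp p _).continuous.continuousOn)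
    (fun s hs => ((hF.deriv 0 s ⟨ht.1.trans_lt hs.1, hs.2⟩).sub
      (hasDerivAt_interp p (hF.cont 0) (hF.deriv 0) (hF.cont 1) s)).congr_deriv (by
        simp only [zero_add, hx]; abel)) (i1.sub i2)
  rw [intervalIntegral.integral_sub i1 i2, interp_one, sub_self, zero_sub] at h
  have h1 := norm_integral_sub_legProj_le (hF.shift 1) (r := s) (m := p + 1) hs hb0' hb' ht
  simp only [zero_add] at h1
  have h2 := norm_integral_kerL_smul_le p x ht
  rw [← norm_neg, ← h]
  have h3 : √((p : ℝ) + 1) * √((p : ℝ) + 1) = p + 1 := Real.mul_self_sqrt (by positivity)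
  have h4 : 44 * √((p : ℝ) + 1) * ‖x‖ ≤ 44 * √((p : ℝ) + 1) * (90 * √((p : ℝ) + 1) * (β * b)) := by
    gcongr
  have h5 : 44 * √((p : ℝ) + 1) * (90 * √((p : ℝ) + 1) * (β * b))
      = β * (3960 * ((p : ℝ) + 1) * b) := by
    calc _ = 3960 * (√((p : ℝ) + 1) * √((p : ℝ) + 1)) * (β * b) := by ring
      _ = _ := by rw [h3]; ring
  have h6 := norm_sub_le (∫ s in t..1, (F 1 s - legProj (p + 1) (F 1) s))
    (∫ s in t..1, kerL p s • x)
  rw [← hβ] at h1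
  linarith

end DGWave

/-! ### The discrete equation on one cell: moment relations and energy identities -/

namespace DGWave

set_option linter.unusedSectionVars false

variable {W H : Type*} [NormedAddCommGroup W] [NormedSpace ℝ W]
  [NormedAddCommGroup H] [InnerProductSpace ℝ H]

local notation "⟪" x ", " y "⟫" => inner ℝ x y

/-- The strong form of the discontinuous Galerkin equation on the reference cell, for a polynomial
`η` of degree `≤ p` and a skew operator `A` (where `ι` is the embedding of its domain). The value
at the end of the preceding cell is `e`; `zm` and `z` are the data of the preceding and of the
present cell. -/
structure CellEq (ι A : W →L[ℝ] H) (h : ℝ) (p : ℕ) (η : ℝ → W) (e zm z : H) : Prop where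
  poly : IsPoly (p + 1) η
  skew : ∀ w, ⟪A w, ι w⟫ = 0
  eq : ∀ t, HasDerivAt (fun t => ι (η t)) (h • A (η t) - kerL p t • (ι (η 0) - e - zm)
    + ((h * legL p t) • z - kerR p t • z)) t

namespace CellEq

variable {ι A : W →L[ℝ] H} {h : ℝ} {p : ℕ} {η : ℝ → W} {e zm z : H}

lemma skew' (c : CellEq ι A h p η e zm z) (v w : W) : ⟪A v, ι w⟫ = -⟪A w, ι v⟫ := by
  have h1 := c.skew (v + w)
  simp only [map_add, inner_add_left, inner_add_right, c.skew] at h1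
  linarith

lemma polyι (c : CellEq ι A h p η e zm z) : IsPoly (p + 1) fun t => ι (η t) := c.poly.clm ι

lemma polyA (c : CellEq ι A h p η e zm z) : IsPoly (p + 1) fun t => A (η t) := c.poly.clm A

lemma poly_rhs (c : CellEq ι A h p η e zm z) :
    IsPoly p (fun t => h • A (η t) - kerL p t • (ι (η 0) - e - zm)
      + ((h * legL p t) • z - kerR p t • z)) := by
  obtain ⟨f', hf', hd⟩ := c.polyι.exists_deriv
  refine cast (congrArg _ (funext fun t => ?_)) hf'
  exact (hd t).unique (c.eq t)

lemma contι (c : CellEq ι A h p η e zm z) : ContinuousOn (fun t => ι (η t)) (Icc 0 1) :=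
  c.polyι.continuous.continuousOn

/-- Local energy identity: the skew term drops out. -/
lemma hasDerivAt_sq (c : CellEq ι A h p η e zm z) (t : ℝ) :
    HasDerivAt (fun t => ‖ι (η t)‖ ^ 2) (2 * (-⟪ι (η 0) - e - zm, kerL p t • ι (η t)⟫
      + (h * ⟪z, legL p t • ι (η t)⟫ - ⟪z, kerR p t • ι (η t)⟫))) t := by
  refine (c.eq t).norm_sq.congr_deriv ?_
  rw [real_inner_comm]
  simp only [inner_add_left, inner_sub_left, inner_smul_left, inner_smul_right, c.skew,
    RCLike.conj_to_real]
  ring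

variable [CompleteSpace W] [CompleteSpace H]

/-- The `j`-th moment of the cell equation. -/
lemma moment (c : CellEq ι A h p η e zm z) {j : ℕ} (hj : j ≤ p) :
    ι (η 1) - (-1 : ℝ) ^ j • ι (η 0) - ∫ t in (0 : ℝ)..1, legD j t • ι (η t)
      = h • A (legC j η) - (-1 : ℝ) ^ j • (ι (η 0) - e - zm)
        + ((if j = p then (h / (2 * p + 1)) • z else 0) - z) := by
  rw [← legC_deriv j c.contι (fun t _ => c.eq t) c.poly_rhs.continuous.continuousOn]
  have h1 : IsPoly (p + 1) fun t => (h * legL p t) • z := by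
    simpa only [smul_smul] using (isPoly_legL_smul (Nat.lt_succ_self p) z).const_smul h
  have h2 := isPoly_kerL_smul p (ι (η 0) - e - zm)
  have h3 := isPoly_kerR_smul p z
  rw [legC_add j ((c.polyA.const_smul h).sub h2).continuous.continuousOn
    (h1.sub h3).continuous.continuousOn,
    legC_sub j (c.polyA.const_smul h).continuous.continuousOn h2.continuous.continuousOn,
    legC_sub j h1.continuous.continuousOn h3.continuous.continuousOn,
    legC_const_smul, legC_clm j c.poly.continuous.continuousOn A, legC_kerL_smul hj,
    legC_kerR_smul hj]
  congr 2
  have e1 : (fun t => (h * legL p t) • z) = fun t => h • legL p t • z := by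
    funext t; rw [smul_smul]
  rw [e1, legC_const_smul, legL_smul_integral]
  split_ifs with hjp
  · rw [hjp, smul_smul]
    congr 1; ring
  · rw [smul_zero]

lemma moment_top (c : CellEq ι A h p η e zm z) {j : ℕ} (hj : p ≤ j) :
    ι (η 1) - (-1 : ℝ) ^ j • ι (η 0) - ∫ t in (0 : ℝ)..1, legD j t • ι (η t) = 0 := by
  rw [← legC_deriv j c.contι (fun t _ => c.eq t) c.poly_rhs.continuous.continuousOn]
  exact c.poly_rhs.legC_eq_zero hj

lemma integral_legD_diff (c : CellEq ι A h p η e zm z) (j : ℕ) :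
    (∫ t in (0 : ℝ)..1, legD (j + 2) t • ι (η t)) - (∫ t in (0 : ℝ)..1, legD j t • ι (η t))
      = (2 * (2 * (j : ℝ) + 3)) • ι (legC (j + 1) η) := by
  have hi : ∀ j, IntervalIntegrable (fun t => legD j t • ι (η t)) volume 0 1 := fun j =>
    ((continuous_legD j).smul c.polyι.continuous).intervalIntegrable _ _
  rw [← intervalIntegral.integral_sub (hi _) (hi _), ← legC_clm _ c.poly.continuous.continuousOn ι,
    legC, ← intervalIntegral.integral_smul]
  refine intervalIntegral.integral_congr fun t _ => ?_
  rw [← sub_smul, legD_sub, smul_smul]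

/-- The jump, corrected by the data, in terms of the highest moment. -/
lemma jump_eq (c : CellEq ι A h p η e zm z) :
    (-1 : ℝ) ^ p • (ι (η 0) - e - zm) = h • A (legC p η) + ((h / (2 * p + 1)) • z - z) := by
  have h1 := c.moment le_rfl
  rw [c.moment_top le_rfl, if_pos rfl] at h1
  rw [eq_comm, ← sub_eq_zero, h1]
  abel

/-- The difference of two moment equations with the jump eliminated, at the highest order. -/
lemma moment_rec_top (c : CellEq ι A h (p + 1) η e zm z) :
    (2 * (2 * (p : ℝ) + 3)) • ι (legC (p + 1) η)
      = h • A (legC p η) + h • A (legC (p + 1) η)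
        + ((h / (2 * (p + 1 : ℕ) + 1)) • z - (2 : ℝ) • z) := by
  have h1 := c.moment (j := p) (Nat.le_succ p)
  have h2 := c.moment_top (j := p + 2) (by omega)
  have h3 := c.jump_eq
  have h4 := c.integral_legD_diff p
  rw [if_neg (by omega)] at h1
  rw [pow_succ] at h3
  rw [pow_add, neg_one_sq, mul_one] at h2
  have h5 : (-1 : ℝ) ^ p • (ι (η 0) - e - zm)
      = -(h • A (legC (p + 1) η) + ((h / (2 * (p + 1 : ℕ) + 1)) • z - z)) := by
    rw [← h3]; module
  rw [h5] at h1
  rw [← h4]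
  generalize (∫ t in (0 : ℝ)..1, legD (p + 2) t • ι (η t)) = a at *
  generalize (∫ t in (0 : ℝ)..1, legD p t • ι (η t)) = b at *
  have ha : a = ι (η 1) - (-1 : ℝ) ^ p • ι (η 0) := (sub_eq_zero.1 h2).symm
  rw [ha, h1]
  module

/-- A three-term recursion for the moments, without the jump: each moment is a difference of `A`
applied to its two neighbours. -/
lemma moment_rec (c : CellEq ι A h p η e zm z) {j : ℕ} (hj : j + 2 ≤ p) :
    (2 * (2 * (j : ℝ) + 3)) • ι (legC (j + 1) η)
      = h • A (legC j η) - h • A (legC (j + 2) η)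
        - (if j + 2 = p then (h / (2 * p + 1)) • z else 0) := by
  have h1 := c.moment (j := j) (by omega)
  have h2 := c.moment hj
  have h4 := c.integral_legD_diff j
  rw [if_neg (by omega)] at h1
  rw [pow_add, neg_one_sq, mul_one] at h2
  rw [← h4]
  generalize (∫ t in (0 : ℝ)..1, legD (j + 2) t • ι (η t)) = a at *
  generalize (∫ t in (0 : ℝ)..1, legD j t • ι (η t)) = b at *
  generalize (if j + 2 = p then (h / (2 * p + 1)) • z else 0) = g at *
  have e1 : a - b = (ι (η 1) - (-1 : ℝ) ^ j • ι (η 0) - b)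
    - (ι (η 1) - (-1 : ℝ) ^ j • ι (η 0) - a) := by abel
  rw [e1, h1, h2]
  module

lemma integral_kerL_smul (c : CellEq ι A h p η e zm z) :
    ∫ t in (0 : ℝ)..1, kerL p t • ι (η t) = ι (η 0) := by
  rw [← c.polyι.legProj_eq 0, legProj]
  simp_rw [kerL, Finset.sum_smul]
  have hi : ∀ j ∈ Finset.range (p + 1), IntervalIntegrable
      (fun t => ((2 * (j : ℝ) + 1) * ((-1) ^ j * legL j t)) • ι (η t)) volume 0 1 := fun j _ =>
    ((continuous_const.mul (continuous_const.mul (continuous_legL j))).smul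
      c.polyι.continuous).intervalIntegrable _ _
  rw [intervalIntegral.integral_finsetSum hi]
  refine Finset.sum_congr rfl fun j _ => ?_
  simp_rw [← mul_assoc, ← smul_smul _ (legL j _), legL_at_zero]
  rw [intervalIntegral.integral_smul, smul_smul]
  rfl

lemma integral_kerR_smul (c : CellEq ι A h p η e zm z) :
    ∫ t in (0 : ℝ)..1, kerR p t • ι (η t) = ι (η 1) := by
  rw [← legProj_one p c.contι, c.polyι.legProj_eq]

lemma integral_legL_smul (c : CellEq ι A h p η e zm z) (j : ℕ) :
    ∫ t in (0 : ℝ)..1, legL j t • ι (η t) = ι (legC j η) := by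
  rw [← legC_clm _ c.poly.continuous.continuousOn ι, legC]

lemma legC_top (c : CellEq ι A h p η e zm z) : legC (p + 1) η = 0 :=
  c.poly.legC_eq_zero le_rfl

lemma integral_kerR_weight (c : CellEq ι A h p η e zm z) :
    ∫ t in (0 : ℝ)..1, ((1 - t) * kerR p t) • ι (η t) = (((p : ℝ) + 1) / 2) • ι (legC p η) := by
  have e : ∀ t, ((1 - t) * kerR p t) • ι (η t) = (((p : ℝ) + 1) / 2) •
      (legL p t • ι (η t) - legL (p + 1) t • ι (η t)) := by
    intro t
    rw [← sub_smul, smul_smul]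
    congr 1
    linarith [christoffel_darboux p t]
  simp_rw [e]
  rw [intervalIntegral.integral_smul, intervalIntegral.integral_sub
    (intervalIntegrable_legL_smul _ c.contι) (intervalIntegrable_legL_smul _ c.contι),
    c.integral_legL_smul, c.integral_legL_smul, c.legC_top, map_zero, sub_zero]

lemma integral_kerL_weight (c : CellEq ι A h p η e zm z) :
    ∫ t in (0 : ℝ)..1, ((1 - t) * kerL p t) • ι (η t)
      = ι (η 0) - (((p : ℝ) + 1) / 2) • (-1 : ℝ) ^ p • ι (legC p η) := by
  have e : ∀ t, ((1 - t) * kerL p t) • ι (η t) = kerL p t • ι (η t) -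
      (((p : ℝ) + 1) / 2) • (-1 : ℝ) ^ p •
      (legL p t • ι (η t) + legL (p + 1) t • ι (η t)) := by
    intro t
    rw [← add_smul, smul_smul, smul_smul, ← sub_smul]
    congr 1
    have h := christoffel_darboux p (1 - t)
    rw [← kerL_eq, legL_symm, legL_symm, pow_succ] at h
    linarith
  have i1 : IntervalIntegrable (fun t => kerL p t • ι (η t)) volume 0 1 :=
    ((continuous_kerL p).smul c.polyι.continuous).intervalIntegrable _ _
  have i2 := fun j => intervalIntegrable_legL_smul j c.contι
  have i3 : IntervalIntegrable (fun t => (((p : ℝ) + 1) / 2) • (-1 : ℝ) ^ p •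
      (legL p t • ι (η t) + legL (p + 1) t • ι (η t))) volume 0 1 :=
    (((i2 p).add (i2 (p + 1))).smul _).smul _
  simp_rw [e]
  rw [intervalIntegral.integral_sub i1 i3,
    intervalIntegral.integral_smul, intervalIntegral.integral_smul,
    intervalIntegral.integral_add (i2 p) (i2 (p + 1)),
    c.integral_legL_smul, c.integral_legL_smul, c.legC_top, map_zero, add_zero,
    c.integral_kerL_smul]

lemma integral_legL_weight (c : CellEq ι A h p η e zm z) :
    ∫ t in (0 : ℝ)..1, ((1 - t) * legL p t) • ι (η t)
      = (1 / 2 : ℝ) • (ι (legC p η) - ((p : ℝ) / (2 * p + 1)) • ι (legC (p - 1) η)) := by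
  have hrec : ∀ t, (1 - t) * legL p t = 1 / 2 * (legL p t - (((p : ℝ) + 1) / (2 * p + 1)) *
      legL (p + 1) t - ((p : ℝ) / (2 * p + 1)) * legL (p - 1) t) := by
    intro t
    cases p with
    | zero => simp; ring
    | succ q =>
      have h := legL_rec q t
      have h0 : (2 * (q : ℝ) + 3) ≠ 0 := by positivity
      have h1 : (2 * ((q + 1 : ℕ) : ℝ) + 1) = 2 * q + 3 := by push_cast; ring
      rw [h1, Nat.add_sub_cancel]
      push_cast
      field_simp
      linarith
  have e : ∀ t, ((1 - t) * legL p t) • ι (η t) = (1 / 2 : ℝ) • (legL p t • ι (η t)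
      - (((p : ℝ) + 1) / (2 * p + 1)) • legL (p + 1) t • ι (η t)
      - ((p : ℝ) / (2 * p + 1)) • legL (p - 1) t • ι (η t)) := by
    intro t
    rw [hrec]
    module
  have i2 := fun j => intervalIntegrable_legL_smul j c.contι
  have i3 : ∀ (a : ℝ) (j : ℕ), IntervalIntegrable (fun t => a • legL j t • ι (η t)) volume 0 1 :=
    fun a j => (i2 j).smul a
  simp_rw [e]
  rw [intervalIntegral.integral_smul, intervalIntegral.integral_sub
    ((i2 p).sub (i3 _ _)) (i3 _ _), intervalIntegral.integral_sub (i2 p) (i3 _ _),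
    intervalIntegral.integral_smul, intervalIntegral.integral_smul,
    c.integral_legL_smul, c.integral_legL_smul, c.integral_legL_smul, c.legC_top, map_zero,
    smul_zero, sub_zero]

lemma integral_comb {f g k : ℝ → ℝ} (hf : Continuous f) (hg : Continuous g) (hk : Continuous k)
    (r a b : ℝ) : ∫ t in a..b, (-f t + (r * g t - k t))
      = -(∫ t in a..b, f t) + (r * (∫ t in a..b, g t) - ∫ t in a..b, k t) := by
  have i1 : IntervalIntegrable (fun t => -f t) volume a b := hf.neg.intervalIntegrable _ _
  have i2 : IntervalIntegrable (fun t => r * g t) volume a b :=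
    (continuous_const.mul hg).intervalIntegrable _ _
  have i3 := hk.intervalIntegrable (μ := volume) a b
  rw [intervalIntegral.integral_add i1 (i2.sub i3), intervalIntegral.integral_sub i2 i3,
    intervalIntegral.integral_neg, intervalIntegral.integral_const_mul]

lemma integral_inner_left {f : ℝ → H} (hf : Continuous f) (x : H) (a b : ℝ) :
    ∫ t in a..b, ⟪x, f t⟫ = ⟪x, ∫ t in a..b, f t⟫ :=
  (innerSL ℝ x).intervalIntegral_comp_comm (hf.intervalIntegrable a b)

/-- The energy identity between two times. -/
lemma sq_sub_sq (c : CellEq ι A h p η e zm z) (a b : ℝ) :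
    ‖ι (η b)‖ ^ 2 - ‖ι (η a)‖ ^ 2
      = 2 * (-⟪ι (η 0) - e - zm, ∫ t in a..b, kerL p t • ι (η t)⟫
        + (h * ⟪z, ∫ t in a..b, legL p t • ι (η t)⟫ - ⟪z, ∫ t in a..b, kerR p t • ι (η t)⟫)) := by
  have hy := c.polyι.continuous
  have c1 : Continuous fun t => kerL p t • ι (η t) := (continuous_kerL p).smul hy
  have c2 : Continuous fun t => legL p t • ι (η t) := (continuous_legL p).smul hy
  have c3 : Continuous fun t => kerR p t • ι (η t) := (continuous_kerR p).smul hy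
  have d1 : Continuous fun t => ⟪ι (η 0) - e - zm, kerL p t • ι (η t)⟫ := continuous_const.inner c1
  have d2 : Continuous fun t => ⟪z, legL p t • ι (η t)⟫ := continuous_const.inner c2
  have d3 : Continuous fun t => ⟪z, kerR p t • ι (η t)⟫ := continuous_const.inner c3
  have key := intervalIntegral.integral_eq_sub_of_hasDerivAt (a := a) (b := b)
    (fun t _ => c.hasDerivAt_sq t)
    ((continuous_const.mul (d1.neg.add ((continuous_const.mul d2).sub d3))).intervalIntegrable _ _)
  rw [← key, intervalIntegral.integral_const_mul, integral_comb d1 d2 d3, integral_inner_left c1,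
    integral_inner_left c2, integral_inner_left c3]

/-- The energy balance over the cell. -/
lemma energy (c : CellEq ι A h p η e zm z) :
    ‖ι (η 1)‖ ^ 2 + 2 * ⟪z, ι (η 1)⟫ + ‖ι (η 0) - e‖ ^ 2
      = ‖e‖ ^ 2 + 2 * ⟪zm, e⟫ + 2 * ⟪zm, ι (η 0) - e⟫ + 2 * h * ⟪z, ι (legC p η)⟫ := by
  have h1 := c.sq_sub_sq 0 1
  rw [c.integral_kerL_smul, c.integral_kerR_smul, c.integral_legL_smul] at h1
  obtain ⟨J, hJ⟩ : ∃ J, ι (η 0) = e + J := ⟨ι (η 0) - e, by abel⟩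
  rw [hJ] at h1 ⊢
  rw [add_sub_cancel_left] at h1 ⊢
  have h2 : ‖e + J‖ ^ 2 = ‖e‖ ^ 2 + 2 * ⟪e, J⟫ + ‖J‖ ^ 2 := norm_add_sq_real e J
  rw [h2, inner_sub_left, inner_add_right, inner_add_right, real_inner_self_eq_norm_sq,
    real_inner_comm] at h1
  linarith

/-- The `L²`-balance over the cell, obtained by testing with `(1 - t) η`. -/
lemma integral_sq (c : CellEq ι A h p η e zm z) :
    (∫ t in (0 : ℝ)..1, ‖ι (η t)‖ ^ 2) + ‖ι (η 0) - e‖ ^ 2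
      = ‖e‖ ^ 2 + 2 * ⟪zm, e⟫ + 2 * ⟪zm, ι (η 0) - e⟫
        + ((p : ℝ) + 1) * ⟪(h / (2 * p + 1)) • z - (2 : ℝ) • z, ι (legC p η)⟫
        + h * ⟪z, ι (legC p η) - ((p : ℝ) / (2 * p + 1)) • ι (legC (p - 1) η)⟫ := by
  have hy := c.polyι.continuous
  have c0 : Continuous fun t : ℝ => 1 - t := continuous_const.sub continuous_id
  have c1 : Continuous fun t => ((1 - t) * kerL p t) • ι (η t) :=
    (c0.mul (continuous_kerL p)).smul hy
  have c2 : Continuous fun t => ((1 - t) * legL p t) • ι (η t) :=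
    (c0.mul (continuous_legL p)).smul hy
  have c3 : Continuous fun t => ((1 - t) * kerR p t) • ι (η t) :=
    (c0.mul (continuous_kerR p)).smul hy
  have d0 : Continuous fun t => ‖ι (η t)‖ ^ 2 := hy.norm.pow 2
  have d1 : Continuous fun t => ⟪ι (η 0) - e - zm, ((1 - t) * kerL p t) • ι (η t)⟫ :=
    continuous_const.inner c1
  have d2 : Continuous fun t => ⟪z, ((1 - t) * legL p t) • ι (η t)⟫ := continuous_const.inner c2
  have d3 : Continuous fun t => ⟪z, ((1 - t) * kerR p t) • ι (η t)⟫ := continuous_const.inner c3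
  have hd : ∀ t : ℝ, HasDerivAt (fun t : ℝ => (1 - t) * ‖ι (η t)‖ ^ 2) (-‖ι (η t)‖ ^ 2
      + 2 * (-⟪ι (η 0) - e - zm, ((1 - t) * kerL p t) • ι (η t)⟫
      + (h * ⟪z, ((1 - t) * legL p t) • ι (η t)⟫ - ⟪z, ((1 - t) * kerR p t) • ι (η t)⟫))) t := by
    intro t
    have e2 : HasDerivAt (fun x : ℝ => 1 - x) (-1) t := by
      simpa using (hasDerivAt_id t).const_sub (1 : ℝ)
    refine (e2.mul (c.hasDerivAt_sq t)).congr_deriv ?_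
    simp only [inner_smul_right]
    ring
  have key := intervalIntegral.integral_eq_sub_of_hasDerivAt (a := 0) (b := 1) (fun t _ => hd t)
    ((d0.neg.add (continuous_const.mul (d1.neg.add ((continuous_const.mul d2).sub
      d3)))).intervalIntegrable _ _)
  have i1 : IntervalIntegrable (fun t => -‖ι (η t)‖ ^ 2) volume 0 1 :=
    d0.neg.intervalIntegrable _ _
  have i2 : IntervalIntegrable (fun t =>
      2 * (-⟪ι (η 0) - e - zm, ((1 - t) * kerL p t) • ι (η t)⟫
      + (h * ⟪z, ((1 - t) * legL p t) • ι (η t)⟫ - ⟪z, ((1 - t) * kerR p t) • ι (η t)⟫)))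
      volume 0 1 :=
    (continuous_const.mul (d1.neg.add ((continuous_const.mul d2).sub d3))).intervalIntegrable _ _
  rw [intervalIntegral.integral_add i1 i2, intervalIntegral.integral_neg,
    intervalIntegral.integral_const_mul, integral_comb d1 d2 d3, integral_inner_left c1,
    integral_inner_left c2, integral_inner_left c3, c.integral_kerL_weight, c.integral_kerR_weight,
    c.integral_legL_weight] at key
  -- the top moment of the equation turns the jump into data, as `⟪A w, ι w⟫ = 0`
  have hj : (-1 : ℝ) ^ p * ⟪ι (η 0) - e - zm, ι (legC p η)⟫
      = ⟪(h / (2 * p + 1)) • z - z, ι (legC p η)⟫ := by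
    have := congrArg (fun x => ⟪x, ι (legC p η)⟫) c.jump_eq
    simpa only [inner_smul_left, RCLike.conj_to_real, inner_add_left, c.skew, mul_zero,
      zero_add] using this
  simp only [inner_sub_right, inner_smul_right, sub_self, zero_mul, zero_sub, sub_zero,
    one_mul] at key
  rw [mul_left_comm] at key
  obtain ⟨J, hJ⟩ : ∃ J, ι (η 0) = e + J := ⟨ι (η 0) - e, by abel⟩
  rw [hJ] at key hj ⊢
  rw [add_sub_cancel_left] at key hj ⊢
  have h2 : ‖e + J‖ ^ 2 = ‖e‖ ^ 2 + 2 * ⟪e, J⟫ + ‖J‖ ^ 2 := norm_add_sq_real e J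
  have h3 : ⟪J - zm, e + J⟫ = ⟪e, J⟫ + ‖J‖ ^ 2 - ⟪zm, e⟫ - ⟪zm, J⟫ := by
    rw [inner_sub_left, inner_add_right, inner_add_right, real_inner_self_eq_norm_sq,
      real_inner_comm]
    ring
  simp only [inner_sub_left, inner_sub_right, inner_smul_left, inner_smul_right,
    RCLike.conj_to_real] at *
  nlinarith

end CellEq

end DGWave

/-! ### Smallness of the highest moments -/

namespace DGWave

set_option linter.unusedSectionVars false

lemma max_sq_le {a q c : ℝ} (ha : 0 ≤ a) (hc : a ≤ c) (hq : q ^ 2 ≤ 30 * c * a) :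
    max a q * max a q ≤ 30 * c * a := by
  rcases max_choice a q with h | h
  · rw [h]
    have := mul_le_mul_of_nonneg_right hc ha
    have : 0 ≤ c * a := mul_nonneg (ha.trans hc) ha
    linarith
  · rw [h, ← sq]; exact hq

/-- The nonlinear three-term inequalities satisfied by the rescaled highest moments force the
first two of them to be bounded: `r i = max 1 (q 0) … (q i)` satisfies
`r i ^ 2 ≤ 30 * r (i + 1) * r (i - 1)`. Either `r 5 = q 5` is bounded, or the last ratio
`r 5 / r 4` is `1`, and then all preceding ratios are bounded in turn. -/
lemma chain_bound {q0 q1 q2 q3 q4 q5 : ℝ} (h0' : 0 ≤ q0) (h1' : 0 ≤ q1) (h2' : 0 ≤ q2)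
    (h3' : 0 ≤ q3)
    (h0 : q0 ^ 2 ≤ (q1 + q0) * 4 + 3 * q0) (h1 : q1 ^ 2 ≤ (q2 + q0) * (4 * q0 + 7) + q1)
    (h2 : q2 ^ 2 ≤ (q3 + q1) * (4 * q1 + 5)) (h3 : q3 ^ 2 ≤ (q4 + q2) * (4 * q2 + 4 * q0 + 7))
    (h4 : q4 ^ 2 ≤ (q5 + q3) * (4 * q3 + 4 * q1 + 5)) (h5 : q5 ≤ 3) :
    q0 ≤ 2 * 10 ^ 13 ∧ q1 ≤ 2 * 10 ^ 13 := by
  set r0 := max 1 q0 with hr0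
  set r1 := max r0 q1 with hr1
  set r2 := max r1 q2 with hr2
  set r3 := max r2 q3 with hr3
  set r4 := max r3 q4 with hr4
  set r5 := max r4 q5 with hr5
  have a0 : 1 ≤ r0 := le_max_left _ _
  have a1 : r0 ≤ r1 := le_max_left _ _
  have a2 : r1 ≤ r2 := le_max_left _ _
  have a3 : r2 ≤ r3 := le_max_left _ _
  have a4 : r3 ≤ r4 := le_max_left _ _
  have a5 : r4 ≤ r5 := le_max_left _ _
  have b0 : q0 ≤ r0 := le_max_right _ _
  have b1 : q1 ≤ r1 := le_max_right _ _
  have b2 : q2 ≤ r2 := le_max_right _ _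
  have b3 : q3 ≤ r3 := le_max_right _ _
  have b4 : q4 ≤ r4 := le_max_right _ _
  have b5 : q5 ≤ r5 := le_max_right _ _
  have c0 : r0 * r0 ≤ 30 * r1 * 1 := max_sq_le zero_le_one (a0.trans a1) (by nlinarith)
  have c1 : r1 * r1 ≤ 30 * r2 * r0 := by
    refine max_sq_le (by linarith) (a1.trans a2) ?_
    have : (q2 + q0) * (4 * q0 + 7) ≤ (2 * r2) * (11 * r0) :=
      mul_le_mul (by linarith) (by linarith) (by linarith) (by linarith)
    have : q1 ≤ r2 * r0 := b1.trans (a2.trans (le_mul_of_one_le_right (by linarith) a0))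
    linarith
  have c2 : r2 * r2 ≤ 30 * r3 * r1 := by
    refine max_sq_le (by linarith) (a2.trans a3) ?_
    have : (q3 + q1) * (4 * q1 + 5) ≤ (2 * r3) * (9 * r1) :=
      mul_le_mul (by linarith) (by linarith) (by linarith) (by linarith)
    have : 0 ≤ r3 * r1 := mul_nonneg (by linarith) (by linarith)
    linarith
  have c3 : r3 * r3 ≤ 30 * r4 * r2 := by
    refine max_sq_le (by linarith) (a3.trans a4) ?_
    have : (q4 + q2) * (4 * q2 + 4 * q0 + 7) ≤ (2 * r4) * (15 * r2) :=
      mul_le_mul (by linarith) (by linarith) (by linarith) (by linarith)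
    linarith
  have c4 : r4 * r4 ≤ 30 * r5 * r3 := by
    refine max_sq_le (by linarith) (a4.trans a5) ?_
    have : (q5 + q3) * (4 * q3 + 4 * q1 + 5) ≤ (2 * r5) * (13 * r3) :=
      mul_le_mul (by linarith) (by linarith) (by linarith) (by linarith)
    have : 0 ≤ r5 * r3 := mul_nonneg (by linarith) (by linarith)
    linarith
  rcases max_choice r4 q5 with h | h
  · rw [← hr5] at h
    rw [h] at c4
    have d4 : r4 ≤ 30 * r3 := le_of_mul_le_mul_right (by linarith) (by linarith : 0 < r4)
    have d3 : r3 ≤ 900 * r2 := by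
      have := mul_le_mul_of_nonneg_right d4 (by linarith : 0 ≤ r2)
      exact le_of_mul_le_mul_right (by linarith) (by linarith : 0 < r3)
    have d2 : r2 ≤ 27000 * r1 := by
      have := mul_le_mul_of_nonneg_right d3 (by linarith : 0 ≤ r1)
      exact le_of_mul_le_mul_right (by linarith) (by linarith : 0 < r2)
    have d1 : r1 ≤ 810000 * r0 := by
      have := mul_le_mul_of_nonneg_right d2 (by linarith : 0 ≤ r0)
      exact le_of_mul_le_mul_right (by linarith) (by linarith : 0 < r1)
    have d0 : r0 ≤ 24300000 := le_of_mul_le_mul_right (by linarith) (by linarith : 0 < r0)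
    constructor <;> linarith
  · rw [← hr5] at h
    constructor <;> linarith

/-- Scaling a quadratic recursion: `Q` is the bound after division by `Λ² s ^ (2 k)`. -/
lemma scale_le {n s Λ z q Q R : ℝ} {k : ℕ} (hs : 0 < s) (hΛ : 0 < Λ) (hns : n * s ^ 12 = 1)
    (hz : z = q * Λ * s ^ k) (hR : n * z ^ 2 ≤ R) (hQ : R * s ^ 12 ≤ Q * (Λ ^ 2 * s ^ (2 * k))) :
    q ^ 2 ≤ Q := by
  have h1 : q ^ 2 * (Λ ^ 2 * s ^ (2 * k)) ≤ Q * (Λ ^ 2 * s ^ (2 * k)) := by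
    refine le_trans (le_of_eq ?_) ((mul_le_mul_of_nonneg_right hR (by positivity)).trans hQ)
    rw [hz, mul_right_comm, hns]
    ring
  exact le_of_mul_le_mul_right h1 (by positivity)

lemma scale_mul_le {s Λ X Y x y : ℝ} {i j k : ℕ} (hx : 0 ≤ x) (hs : 0 < s) (hΛ : 0 < Λ)
    (hY0 : 0 ≤ Y) (hX : X ≤ x * Λ * s ^ i) (hY : Y * s ^ 12 ≤ y * Λ * s ^ j)
    (hk : i + j = 2 * k) : X * Y * s ^ 12 ≤ x * y * (Λ ^ 2 * s ^ (2 * k)) := by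
  rw [← hk, pow_add, mul_assoc]
  calc X * (Y * s ^ 12) ≤ (x * Λ * s ^ i) * (y * Λ * s ^ j) :=
        mul_le_mul hX hY (by positivity) (by positivity)
    _ = _ := by ring

/-- The scaling `x i = q i * Λ * s ^ (…)` under which the moment inequalities become those of
`chain_bound`, with `s = n ^ (-1 / 12)`. -/
lemma top_moments_aux {n s Λ x0 x1 x2 x3 x4 x5 : ℝ} (hs : 0 < s) (hs1 : s ≤ 1) (hΛ : 0 < Λ)
    (hns : n * s ^ 12 = 1) (p0 : 0 ≤ x0) (p1 : 0 ≤ x1) (p2 : 0 ≤ x2) (p3 : 0 ≤ x3) (p4 : 0 ≤ x4)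
    (v0 : n * x0 ^ 2 ≤ (x1 + x0) * (4 * Λ) + 3 * Λ * s * x0)
    (v1 : n * x1 ^ 2 ≤ (x2 + x0) * (4 * n * x0 + 7 * Λ) + Λ * s ^ 2 * x1)
    (v2 : n * x2 ^ 2 ≤ (x3 + x1) * (4 * n * x1 + 5 * Λ))
    (v3 : n * x3 ^ 2 ≤ (x4 + x2) * (4 * n * x2 + 4 * n * x0 + 7 * Λ))
    (v4 : n * x4 ^ 2 ≤ (x5 + x3) * (4 * n * x3 + 4 * n * x1 + 5 * Λ))
    (v5 : n * x5 ^ 2 ≤ 6 * Λ ^ 2) :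
    x0 ≤ 2 * 10 ^ 13 * Λ * s ^ 11 ∧ x1 ≤ 2 * 10 ^ 13 * Λ * s ^ 10 := by
  have hn0 : 0 < n := pos_of_mul_pos_left (hns ▸ one_pos) (by positivity)
  have hpw : ∀ {i j : ℕ}, i ≤ j → s ^ j ≤ s ^ i := fun h => pow_le_pow_of_le_one hs.le hs1 h
  have hq : ∀ (x : ℝ) (j : ℕ), 0 ≤ x → ∃ q, 0 ≤ q ∧ x = q * Λ * s ^ j := fun x j hx =>
    ⟨x / (Λ * s ^ j), by positivity, by field_simp⟩
  obtain ⟨q0, f0, e0⟩ := hq x0 11 p0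
  obtain ⟨q1, f1, e1⟩ := hq x1 10 p1
  obtain ⟨q2, f2, e2⟩ := hq x2 9 p2
  obtain ⟨q3, f3, e3⟩ := hq x3 8 p3
  obtain ⟨q4, f4, e4⟩ := hq x4 7 p4
  obtain ⟨q5, e5⟩ : ∃ q, x5 = q * Λ * s ^ 6 := ⟨x5 / (Λ * s ^ 6), by field_simp⟩
  -- comparison of powers of `s`
  have up : ∀ {q : ℝ} {i j : ℕ}, 0 ≤ q → i ≤ j → q * Λ * s ^ j ≤ q * Λ * s ^ i := fun hq h =>
    mul_le_mul_of_nonneg_left (hpw h) (by positivity)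
  have un : ∀ {x q : ℝ} {j : ℕ}, x = q * Λ * s ^ j → 4 * n * x * s ^ 12 = 4 * q * Λ * s ^ j := by
    intro x q j h
    rw [h]
    linear_combination (4 * q * Λ * s ^ j) * hns
  have hq5 : q5 ≤ 3 := by
    have h1 : q5 ^ 2 ≤ 6 := by
      refine scale_le hs hΛ hns e5 v5 (le_of_eq (by ring))
    nlinarith
  have k0 : q0 ^ 2 ≤ (q1 + q0) * 4 + 3 * q0 := by
    refine scale_le hs hΛ hns e0 v0 ?_
    have t1 : (x1 + x0) * (4 * Λ) * s ^ 12 ≤ (q1 + q0) * 4 * (Λ ^ 2 * s ^ (2 * 11)) :=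
      scale_mul_le (i := 10) (j := 12) (by positivity) hs hΛ (by positivity)
        (by rw [e0, e1]; linarith [up f0 (show 10 ≤ 11 by norm_num)]) le_rfl (by norm_num)
    have t2 : 3 * Λ * s * x0 * s ^ 12 ≤ 3 * q0 * (Λ ^ 2 * s ^ (2 * 11)) := by
      rw [e0]
      calc _ = 3 * q0 * (Λ ^ 2 * s ^ 24) := by ring
        _ ≤ _ := by gcongr 3 * q0 * (Λ ^ 2 * ?_); exact hpw (by norm_num)
    linarith
  have k1 : q1 ^ 2 ≤ (q2 + q0) * (4 * q0 + 7) + q1 := by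
    refine scale_le hs hΛ hns e1 v1 ?_
    have t1 : (x2 + x0) * (4 * n * x0 + 7 * Λ) * s ^ 12
        ≤ (q2 + q0) * (4 * q0 + 7) * (Λ ^ 2 * s ^ (2 * 10)) := by
      refine scale_mul_le (i := 9) (j := 11) (by positivity) hs hΛ (by positivity) ?_ ?_
        (by norm_num)
      · rw [e0, e2]; linarith [up f0 (show 9 ≤ 11 by norm_num)]
      · rw [add_mul, un e0]; linarith [up (show (0 : ℝ) ≤ 7 by norm_num) (show 11 ≤ 12 by norm_num)]
    have t2 : Λ * s ^ 2 * x1 * s ^ 12 ≤ q1 * (Λ ^ 2 * s ^ (2 * 10)) := by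
      rw [e1]
      calc _ = q1 * (Λ ^ 2 * s ^ 24) := by ring
        _ ≤ _ := by gcongr q1 * (Λ ^ 2 * ?_); exact hpw (by norm_num)
    linarith
  have k2 : q2 ^ 2 ≤ (q3 + q1) * (4 * q1 + 5) := by
    refine scale_le hs hΛ hns e2 v2 ?_
    refine scale_mul_le (i := 8) (j := 10) (by positivity) hs hΛ (by positivity) ?_ ?_ (by norm_num)
    · rw [e1, e3]; linarith [up f1 (show 8 ≤ 10 by norm_num)]
    · rw [add_mul, un e1]; linarith [up (show (0 : ℝ) ≤ 5 by norm_num) (show 10 ≤ 12 by norm_num)]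
  have k3 : q3 ^ 2 ≤ (q4 + q2) * (4 * q2 + 4 * q0 + 7) := by
    refine scale_le hs hΛ hns e3 v3 ?_
    refine scale_mul_le (i := 7) (j := 9) (by positivity) hs hΛ (by positivity) ?_ ?_ (by norm_num)
    · rw [e2, e4]; linarith [up f2 (show 7 ≤ 9 by norm_num)]
    · rw [add_mul, add_mul, un e2, un e0]
      linarith [up (show (0 : ℝ) ≤ 7 by norm_num) (show 9 ≤ 12 by norm_num),
        up f0 (show 9 ≤ 11 by norm_num)]
  have k4 : q4 ^ 2 ≤ (q5 + q3) * (4 * q3 + 4 * q1 + 5) := by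
    have hx : 0 ≤ q5 + q3 ∨ q5 + q3 < 0 := le_or_gt 0 _
    rcases hx with hx | hx
    · refine scale_le hs hΛ hns e4 v4 ?_
      refine scale_mul_le (i := 6) (j := 8) hx hs hΛ (by positivity) ?_ ?_ (by norm_num)
      · rw [e3, e5]; linarith [up f3 (show 6 ≤ 8 by norm_num)]
      · rw [add_mul, add_mul, un e3, un e1]
        linarith [up (show (0 : ℝ) ≤ 5 by norm_num) (show 8 ≤ 12 by norm_num),
          up f1 (show 8 ≤ 10 by norm_num)]
    · exfalso
      have h1 : x5 + x3 < 0 := by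
        rw [e3, e5]
        have := up f3 (show 6 ≤ 8 by norm_num)
        have h2 : (q5 + q3) * (Λ * s ^ 6) < 0 := mul_neg_of_neg_of_pos hx (by positivity)
        linarith
      have h2 : (x5 + x3) * (4 * n * x3 + 4 * n * x1 + 5 * Λ) < 0 :=
        mul_neg_of_neg_of_pos h1 (by positivity)
      have h3 : 0 ≤ n * x4 ^ 2 := by positivity
      linarith
  obtain ⟨g0, g1⟩ := chain_bound f0 f1 f2 f3 k0 k1 k2 k3 k4 hq5
  rw [e0, e1]
  constructor <;> gcongr

variable {W H : Type*} [NormedAddCommGroup W] [NormedSpace ℝ W]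
  [NormedAddCommGroup H] [InnerProductSpace ℝ H]

local notation "⟪" x ", " y "⟫" => inner ℝ x y

namespace CellEq

variable {ι A : W →L[ℝ] H} {h : ℝ} {p : ℕ} {η : ℝ → W} {e zm z : H}

lemma abs_inner_le (c : CellEq ι A h p η e zm z) (v w : W) :
    |⟪h • A v, ι w⟫| ≤ ‖h • A w‖ * ‖ι v‖ := by
  have : ⟪h • A v, ι w⟫ = -⟪h • A w, ι v⟫ := by
    rw [inner_smul_left, inner_smul_left, c.skew' v w, mul_neg]
  rw [this, abs_neg]
  exact abs_real_inner_le_norm _ _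

/-- Pairing a moment relation with the moment itself and moving the skew operator over. -/
lemma sq_le_of_rec (c : CellEq ι A h p η e zm z) {κ : ℝ} {x a b : W} {g : H}
    (hx : κ • ι x = h • A a - h • A b + g) :
    κ * ‖ι x‖ ^ 2 ≤ (‖ι a‖ + ‖ι b‖) * ‖h • A x‖ + ‖g‖ * ‖ι x‖ := by
  have h1 := congrArg (fun v => ⟪v, ι x⟫) hx
  simp only [inner_add_left, inner_sub_left] at h1
  rw [inner_smul_left, RCLike.conj_to_real, real_inner_self_eq_norm_sq] at h1
  have h2 := abs_le.1 (c.abs_inner_le a x)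
  have h3 := abs_le.1 (c.abs_inner_le b x)
  have h4 := real_inner_le_norm g (ι x)
  linarith [h2.2, h3.1]

lemma norm_le_of_rec (h : ℝ) {κ : ℝ} (hκ : 0 ≤ κ) {x a b : W} {g : H}
    (hx : κ • ι x = h • A a - h • A b + g) :
    ‖h • A a‖ ≤ κ * ‖ι x‖ + ‖h • A b‖ + ‖g‖ := by
  have : h • A a = κ • ι x + h • A b - g := by rw [hx]; abel
  rw [this]
  refine (norm_sub_le _ _).trans (add_le_add_left ((norm_add_le _ _).trans_eq ?_) _)
  rw [norm_smul, Real.norm_of_nonneg hκ]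

variable [CompleteSpace W] [CompleteSpace H]

/-- The `L²(0,1)`-norm of the solution of the cell equation. -/
noncomputable def l2 (ι : W →L[ℝ] H) (η : ℝ → W) : ℝ := √(∫ t in (0 : ℝ)..1, ‖ι (η t)‖ ^ 2)

lemma norm_moment_le (c : CellEq ι A h p η e zm z) (j : ℕ) :
    ‖ι (legC j η)‖ * √(2 * j + 1) ≤ l2 ι η := by
  rw [← c.integral_legL_smul]
  have h1 := norm_integral_smul_le zero_le_one (continuous_legL j).continuousOn c.contι
  have h2 : ∫ t in (0 : ℝ)..1, legL j t ^ 2 = 1 / (2 * (j : ℝ) + 1) := by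
    rw [← integral_legL_sq]; simp_rw [sq]
  rw [h2, Real.sqrt_div zero_le_one, Real.sqrt_one, one_div_mul_eq_div, le_div_iff₀
    (by positivity)] at h1
  exact h1

lemma norm_moment_le' (c : CellEq ι A h p η e zm z) (j : ℕ) : ‖ι (legC j η)‖ ≤ l2 ι η := by
  have h1 := c.norm_moment_le j
  have h2 : 1 ≤ √(2 * (j : ℝ) + 1) := Real.one_le_sqrt.2 (by linarith [j.cast_nonneg (α := ℝ)])
  nlinarith [norm_nonneg (ι (legC j η))]

set_option maxHeartbeats 1600000 in
/-- The two highest moments are much smaller than the size `Λ` of the solution: with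
`P = (p + 1) ^ (1 / 12)` they are of order `P ^ (-11)` and `P ^ (-10)`, while general moments are
only of order `P ^ (-6)`. -/
lemma top_moments_le (c : CellEq ι A h p η e zm z) (hh : 0 ≤ h) {P Λ D : ℝ} (hP : 1 ≤ P)
    (hn : P ^ 12 = p + 1) (hΛ : 0 < Λ) (hL : l2 ι η ≤ Λ) (hJ : ‖ι (η 0) - e‖ ≤ Λ) (hz : ‖z‖ ≤ D)
    (hzm : ‖zm‖ ≤ D) (hD : D * P ≤ Λ) (hhD : h * D ≤ Λ * P ^ 10) :
    ‖ι (legC p η)‖ * P ^ 11 ≤ 2 * 10 ^ 13 * Λ ∧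
      ‖ι (legC (p - 1) η)‖ * P ^ 10 ≤ 2 * 10 ^ 13 * Λ := by
  rcases lt_or_ge p 5 with hp | hp
  · have h5 : P ^ 12 ≤ 5 := by
      rw [hn]; have : (p : ℝ) ≤ 4 := by exact_mod_cast Nat.lt_succ_iff.1 hp
      linarith
    have h11 : P ^ 11 ≤ P ^ 12 := pow_le_pow_right₀ hP (by norm_num)
    have h10 : P ^ 10 ≤ P ^ 12 := pow_le_pow_right₀ hP (by norm_num)
    constructor
    · calc _ ≤ Λ * 5 := mul_le_mul ((c.norm_moment_le' p).trans hL) (by linarith)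
            (by positivity) hΛ.le
        _ ≤ _ := by linarith
    · calc _ ≤ Λ * 5 := mul_le_mul ((c.norm_moment_le' _).trans hL) (by linarith)
            (by positivity) hΛ.le
        _ ≤ _ := by linarith
  obtain ⟨k, rfl⟩ : ∃ k, p = k + 5 := ⟨p - 5, by omega⟩
  have hP0 : 0 < P := by linarith
  set s := P⁻¹ with hs
  have hs0 : 0 < s := inv_pos.2 hP0
  have hs1 : s ≤ 1 := inv_le_one_of_one_le₀ hP
  have hPs : P * s = 1 := mul_inv_cancel₀ hP0.ne'
  set n : ℝ := (k : ℝ) + 6 with hn'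
  have hk0 : (0 : ℝ) ≤ k := k.cast_nonneg
  have hns : n * s ^ 12 = 1 := by
    have : n = P ^ 12 := by rw [hn, hn']; push_cast; ring
    rw [this, ← mul_pow, hPs, one_pow]
  have hn0 : 0 < n := by positivity
  have hDs : D ≤ Λ * s := by
    calc D = D * P * s := by rw [mul_assoc, hPs, mul_one]
      _ ≤ Λ * s := by gcongr
  set G : H := (h / (2 * ((k + 5 : ℕ) : ℝ) + 1)) • z with hG
  have hD0 : 0 ≤ D := (norm_nonneg z).trans hz
  have hGs : ‖G‖ ≤ Λ * s ^ 2 := by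
    rw [hG, norm_smul, Real.norm_of_nonneg (by positivity)]
    have e1 : h / (2 * ((k + 5 : ℕ) : ℝ) + 1) * ‖z‖ ≤ h / n * D := by
      gcongr
      push_cast; linarith
    have e2 : h / n * D = h * D * s ^ 12 := by
      field_simp
      linarith [congrArg (fun x => h * D * x) hns]
    rw [e2] at e1
    have e3 : h * D * s ^ 12 ≤ Λ * P ^ 10 * s ^ 12 := by gcongr
    have e4 : Λ * P ^ 10 * s ^ 12 = Λ * s ^ 2 * (P * s) ^ 10 := by ring
    rw [e4, hPs, one_pow, mul_one] at e3
    linarith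
  have hs2 : s ^ 2 ≤ 1 := pow_le_one₀ hs0.le hs1
  have hG1 : ‖G‖ ≤ Λ := hGs.trans (by nlinarith)
  have hG2 : ‖G‖ ≤ Λ * s := hGs.trans (by nlinarith [mul_pos hΛ hs0])
  have hD1 : D ≤ Λ := hDs.trans (by nlinarith)
  -- the moment relations
  have r0 : (2 * (2 * ((k + 4 : ℕ) : ℝ) + 3)) • ι (legC (k + 5) η)
      = h • A (legC (k + 4) η) - h • A (-legC (k + 5) η) + (G - (2 : ℝ) • z) := by
    rw [c.moment_rec_top, map_neg]; module
  have r1 : (2 * (2 * ((k + 3 : ℕ) : ℝ) + 3)) • ι (legC (k + 4) η)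
      = h • A (legC (k + 3) η) - h • A (legC (k + 5) η) + (-G) := by
    rw [c.moment_rec (j := k + 3) (by omega), if_pos rfl, sub_eq_add_neg]
  have r2 : (2 * (2 * ((k + 2 : ℕ) : ℝ) + 3)) • ι (legC (k + 3) η)
      = h • A (legC (k + 2) η) - h • A (legC (k + 4) η) + 0 := by
    rw [c.moment_rec (j := k + 2) (by omega), if_neg (by omega), sub_zero, add_zero]
  have r3 : (2 * (2 * ((k + 1 : ℕ) : ℝ) + 3)) • ι (legC (k + 2) η)
      = h • A (legC (k + 1) η) - h • A (legC (k + 3) η) + 0 := by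
    rw [c.moment_rec (j := k + 1) (by omega), if_neg (by omega), sub_zero, add_zero]
  have r4 : (2 * (2 * (k : ℝ) + 3)) • ι (legC (k + 1) η)
      = h • A (legC k η) - h • A (legC (k + 2) η) + 0 := by
    rw [c.moment_rec (j := k) (by omega), if_neg (by omega), sub_zero, add_zero]
  have y0 : ‖h • A (legC (k + 5) η)‖ ≤ 4 * Λ := by
    have e1 : h • A (legC (k + 5) η) = (-1 : ℝ) ^ (k + 5) • (ι (η 0) - e - zm) - G + z := by
      rw [c.jump_eq]; abel
    rw [e1]
    have e2 := norm_add_le ((-1 : ℝ) ^ (k + 5) • (ι (η 0) - e - zm) - G) z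
    have e3 := norm_sub_le ((-1 : ℝ) ^ (k + 5) • (ι (η 0) - e - zm)) G
    have e4 := norm_sub_le (ι (η 0) - e) zm
    rw [norm_smul, norm_pow, norm_neg, norm_one, one_pow, one_mul] at e3
    linarith
  have hg0 : ‖G - (2 : ℝ) • z‖ ≤ 3 * Λ * s := by
    refine (norm_sub_le _ _).trans ?_
    rw [norm_smul (2 : ℝ) z, Real.norm_ofNat]
    linarith
  have hcast : ∀ j : ℕ, ((k + j : ℕ) : ℝ) = k + j := fun j => by push_cast; rfl
  have y1 := norm_le_of_rec h (by positivity) r0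
  have y2 := norm_le_of_rec h (by positivity) r1
  have y3 := norm_le_of_rec h (by positivity) r2
  have y4 := norm_le_of_rec h (by positivity) r3
  have w0 := c.sq_le_of_rec r0
  have w1 := c.sq_le_of_rec r1
  have w2 := c.sq_le_of_rec r2
  have w3 := c.sq_le_of_rec r3
  have w4 := c.sq_le_of_rec r4
  have w5 := (c.norm_moment_le k).trans hL
  simp only [map_neg, smul_neg, norm_neg, norm_zero, add_zero, zero_mul, hcast] at *
  simp only [Nat.cast_ofNat, Nat.cast_one] at *
  rw [show k + 5 - 1 = k + 4 by omega]
  obtain ⟨x0, hx0⟩ : ∃ x, ‖ι (legC (k + 5) η)‖ = x := ⟨_, rfl⟩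
  obtain ⟨x1, hx1⟩ : ∃ x, ‖ι (legC (k + 4) η)‖ = x := ⟨_, rfl⟩
  obtain ⟨x2, hx2⟩ : ∃ x, ‖ι (legC (k + 3) η)‖ = x := ⟨_, rfl⟩
  obtain ⟨x3, hx3⟩ : ∃ x, ‖ι (legC (k + 2) η)‖ = x := ⟨_, rfl⟩
  obtain ⟨x4, hx4⟩ : ∃ x, ‖ι (legC (k + 1) η)‖ = x := ⟨_, rfl⟩
  obtain ⟨x5, hx5⟩ : ∃ x, ‖ι (legC k η)‖ = x := ⟨_, rfl⟩
  have p0 : 0 ≤ x0 := hx0 ▸ norm_nonneg _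
  have p1 : 0 ≤ x1 := hx1 ▸ norm_nonneg _
  have p2 : 0 ≤ x2 := hx2 ▸ norm_nonneg _
  have p3 : 0 ≤ x3 := hx3 ▸ norm_nonneg _
  have p4 : 0 ≤ x4 := hx4 ▸ norm_nonneg _
  have p5 : 0 ≤ x5 := hx5 ▸ norm_nonneg _
  rw [hx0, hx1] at w0
  rw [hx1, hx2, hx0] at w1
  rw [hx2, hx3, hx1] at w2
  rw [hx3, hx4, hx2] at w3
  rw [hx4, hx5, hx3] at w4
  rw [hx0] at y1
  rw [hx1] at y2
  rw [hx2] at y3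
  rw [hx3] at y4
  rw [hx5] at w5
  rw [hx0, hx1]
  have g0 := hg0.trans (show 3 * Λ * s ≤ 3 * Λ by nlinarith)
  have kk : ∀ (x : ℝ) (_ : 0 ≤ x) (a : ℝ) (_ : a ≤ 11), 2 * (2 * ((k : ℝ)) + a) * x ≤ 4 * n * x :=
    fun x hx a ha => mul_le_mul_of_nonneg_right (by rw [hn']; linarith) hx
  have kk' : ∀ (x : ℝ) (a : ℝ) (_ : 3 ≤ a), n * x ^ 2 ≤ 2 * (2 * ((k : ℝ)) + a) * x ^ 2 :=
    fun x a ha => mul_le_mul_of_nonneg_right (by rw [hn']; linarith) (sq_nonneg x)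
  have y1' : ‖h • A (legC (k + 4) η)‖ ≤ 4 * n * x0 + 7 * Λ := by
    linarith [kk x0 p0 11 (by norm_num)]
  have y2' : ‖h • A (legC (k + 3) η)‖ ≤ 4 * n * x1 + 5 * Λ := by
    linarith [kk x1 p1 9 (by norm_num)]
  have y3' : ‖h • A (legC (k + 2) η)‖ ≤ 4 * n * x2 + 4 * n * x0 + 7 * Λ := by
    linarith [kk x2 p2 7 (by norm_num)]
  have y4' : ‖h • A (legC (k + 1) η)‖ ≤ 4 * n * x3 + 4 * n * x1 + 5 * Λ := by
    linarith [kk x3 p3 5 (by norm_num)]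
  have v0 : n * x0 ^ 2 ≤ (x1 + x0) * (4 * Λ) + 3 * Λ * s * x0 := by
    have := kk' x0 11 (by norm_num)
    have t1 : (x1 + x0) * ‖h • A (legC (k + 5) η)‖ ≤ (x1 + x0) * (4 * Λ) := by gcongr
    have t2 : ‖G - (2 : ℝ) • z‖ * x0 ≤ 3 * Λ * s * x0 := by gcongr
    linarith
  have v1 : n * x1 ^ 2 ≤ (x2 + x0) * (4 * n * x0 + 7 * Λ) + Λ * s ^ 2 * x1 := by
    have := kk' x1 9 (by norm_num)
    have t1 : (x2 + x0) * ‖h • A (legC (k + 4) η)‖ ≤ (x2 + x0) * (4 * n * x0 + 7 * Λ) := by gcongr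
    have t2 : ‖G‖ * x1 ≤ Λ * s ^ 2 * x1 := by gcongr
    linarith
  have v2 : n * x2 ^ 2 ≤ (x3 + x1) * (4 * n * x1 + 5 * Λ) := by
    have := kk' x2 7 (by norm_num)
    have t1 : (x3 + x1) * ‖h • A (legC (k + 3) η)‖ ≤ (x3 + x1) * (4 * n * x1 + 5 * Λ) := by gcongr
    linarith
  have v3 : n * x3 ^ 2 ≤ (x4 + x2) * (4 * n * x2 + 4 * n * x0 + 7 * Λ) := by
    have := kk' x3 5 (by norm_num)
    have t1 : (x4 + x2) * ‖h • A (legC (k + 2) η)‖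
        ≤ (x4 + x2) * (4 * n * x2 + 4 * n * x0 + 7 * Λ) := by gcongr
    linarith
  have v4 : n * x4 ^ 2 ≤ (x5 + x3) * (4 * n * x3 + 4 * n * x1 + 5 * Λ) := by
    have := kk' x4 3 (by norm_num)
    have t1 : (x5 + x3) * ‖h • A (legC (k + 1) η)‖
        ≤ (x5 + x3) * (4 * n * x3 + 4 * n * x1 + 5 * Λ) := by gcongr
    linarith
  have v5 : n * x5 ^ 2 ≤ 6 * Λ ^ 2 := by
    have t1 : (x5 * √(2 * k + 1)) ^ 2 ≤ Λ ^ 2 := pow_le_pow_left₀ (by positivity) w5 2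
    rw [mul_pow, Real.sq_sqrt (by positivity)] at t1
    have : n * x5 ^ 2 ≤ 6 * (2 * k + 1) * x5 ^ 2 :=
      mul_le_mul_of_nonneg_right (by rw [hn']; linarith) (sq_nonneg _)
    linarith
  have hfin := top_moments_aux hs0 hs1 hΛ hns p0 p1 p2 p3 p4 v0 v1 v2 v3 v4 v5
  have hPs' : ∀ j : ℕ, s ^ j * P ^ j = 1 := fun j => by rw [← mul_pow, mul_comm, hPs, one_pow]
  constructor
  · calc x0 * P ^ 11 ≤ 2 * 10 ^ 13 * Λ * s ^ 11 * P ^ 11 := by gcongr; exact hfin.1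
      _ = 2 * 10 ^ 13 * Λ := by rw [mul_assoc, hPs', mul_one]
  · calc x1 * P ^ 10 ≤ 2 * 10 ^ 13 * Λ * s ^ 10 * P ^ 10 := by gcongr; exact hfin.2
      _ = 2 * 10 ^ 13 * Λ := by rw [mul_assoc, hPs', mul_one]

end CellEq

end DGWave

/-! ### Stability on one cell -/

namespace DGWave

set_option linter.unusedSectionVars false

variable {W H : Type*} [NormedAddCommGroup W] [NormedSpace ℝ W] [CompleteSpace W]
  [NormedAddCommGroup H] [InnerProductSpace ℝ H] [CompleteSpace H]

local notation "⟪" x ", " y "⟫" => inner ℝ x y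

namespace CellEq

variable {ι A : W →L[ℝ] H} {h : ℝ} {p : ℕ} {η : ℝ → W} {e zm z : H}

lemma l2_nonneg : 0 ≤ l2 ι η := Real.sqrt_nonneg _

lemma l2_sq : l2 ι η ^ 2 = ∫ t in (0 : ℝ)..1, ‖ι (η t)‖ ^ 2 :=
  Real.sq_sqrt (intervalIntegral.integral_nonneg zero_le_one fun _ _ => sq_nonneg _)

lemma le_of_sq_le {x m c d : ℝ} (hx : 0 ≤ x) (hm : 0 ≤ m) (hc : 0 ≤ c) (hd : 0 ≤ d)
    (h : x ^ 2 ≤ c * m ^ 2 + d * (m * x)) : x ≤ (c + d + 1) * m := by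
  by_contra hlt
  push Not at hlt
  have h1 : m ≤ (c + d + 1) * m := le_mul_of_one_le_left hm (by linarith)
  have h2 : m ^ 2 ≤ m * x := by rw [sq]; exact mul_le_mul_of_nonneg_left (by linarith) hm
  have h3 : c * m ^ 2 ≤ c * (m * x) := mul_le_mul_of_nonneg_left h2 hc
  have h4 : x * ((c + d + 1) * m) ≤ x * x := mul_le_mul_of_nonneg_left hlt.le hx
  have hx0 : 0 < x := lt_of_le_of_lt (mul_nonneg (by linarith) hm) hlt
  have h5 : x * ((c + d + 1) * m) < x * x := mul_lt_mul_of_pos_left hlt hx0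
  have h6 : 0 ≤ m * x := mul_nonneg hm hx
  nlinarith

/-- The `L²`-norm, the jump and the top moment in terms of the incoming value and the data. -/
lemma l2_add_jump_le (c : CellEq ι A h p η e zm z) (hh : 0 ≤ h) {P D : ℝ} (hP : 1 ≤ P)
    (hn : P ^ 12 = p + 1) (hD : 0 < D) (hz : ‖z‖ ≤ D) (hzm : ‖zm‖ ≤ D) :
    l2 ι η + ‖ι (η 0) - e‖ ≤ 5 * 10 ^ 14 * (‖e‖ + (D * P + h * D / P ^ 10)) ∧
      ‖ι (legC p η)‖ * P ^ 11 ≤ 10 ^ 29 * (‖e‖ + (D * P + h * D / P ^ 10)) := by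
  have hP0 : 0 < P := by linarith
  set F := D * P + h * D / P ^ 10 with hF
  set X := l2 ι η + ‖ι (η 0) - e‖ with hX
  set m := ‖e‖ + F with hm
  set Λ := X + m with hΛ
  have hF1 : D * P ≤ F := by rw [hF]; linarith [show 0 ≤ h * D / P ^ 10 by positivity]
  have hF2 : h * D / P ^ 10 ≤ F := by rw [hF]; linarith [show 0 ≤ D * P by positivity]
  have hF0 : 0 < F := lt_of_lt_of_le (by positivity) hF1
  have hDF : D ≤ F := by nlinarith
  have l0 : 0 ≤ l2 ι η := l2_nonneg
  have j0 := norm_nonneg (ι (η 0) - e)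
  have e0 := norm_nonneg e
  have hX0 : 0 ≤ X := by positivity
  have hm0 : 0 < m := by positivity
  have hΛ0 : 0 < Λ := by positivity
  have hFm : F ≤ m := by linarith
  obtain ⟨t1, t2⟩ := c.top_moments_le hh hP hn hΛ0 (by linarith) (by linarith) hz hzm (by linarith)
    (by rw [← div_le_iff₀ (by positivity)]; linarith)
  rw [← le_div_iff₀ (by positivity)] at t1 t2
  have hp0 : (0 : ℝ) ≤ p := p.cast_nonneg
  have id := c.integral_sq
  rw [← l2_sq] at id
  have i1 := real_inner_le_norm zm e
  have i2 := real_inner_le_norm zm (ι (η 0) - e)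
  have i3 := real_inner_le_norm ((h / (2 * (p : ℝ) + 1)) • z - (2 : ℝ) • z) (ι (legC p η))
  have i4 := real_inner_le_norm z (ι (legC p η) - ((p : ℝ) / (2 * p + 1)) • ι (legC (p - 1) η))
  have a1 : ⟪zm, e⟫ ≤ m * F := i1.trans
    (by rw [mul_comm]; exact mul_le_mul (by linarith) (hzm.trans hDF) (norm_nonneg _) hm0.le)
  have a2 : ⟪zm, ι (η 0) - e⟫ ≤ F * X :=
    i2.trans (mul_le_mul (hzm.trans hDF) (by linarith) (norm_nonneg _) hF0.le)
  have a3 : ((p : ℝ) + 1) * ⟪(h / (2 * (p : ℝ) + 1)) • z - (2 : ℝ) • z, ι (legC p η)⟫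
      ≤ 3 * (2 * 10 ^ 13) * Λ * F := by
    have b1 : ((p : ℝ) + 1) * ‖(h / (2 * (p : ℝ) + 1)) • z - (2 : ℝ) • z‖
        ≤ h * D + 2 * P ^ 12 * D := by
      have b2 := norm_sub_le ((h / (2 * (p : ℝ) + 1)) • z) ((2 : ℝ) • z)
      rw [norm_smul, norm_smul (2 : ℝ) z, Real.norm_ofNat,
        Real.norm_of_nonneg (by positivity)] at b2
      have b3 : h / (2 * (p : ℝ) + 1) * ‖z‖ ≤ h / ((p : ℝ) + 1) * D := by
        gcongr; linarith
      calc _ ≤ ((p : ℝ) + 1) * (h / ((p : ℝ) + 1) * D + 2 * D) := by gcongr; linarith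
        _ = h * D + 2 * P ^ 12 * D := by rw [hn]; field_simp
    calc _ ≤ ((p : ℝ) + 1) * (‖(h / (2 * (p : ℝ) + 1)) • z - (2 : ℝ) • z‖ * ‖ι (legC p η)‖) := by
          gcongr
      _ = (((p : ℝ) + 1) * ‖(h / (2 * (p : ℝ) + 1)) • z - (2 : ℝ) • z‖) * ‖ι (legC p η)‖ := by ring
      _ ≤ (h * D + 2 * P ^ 12 * D) * (2 * 10 ^ 13 * Λ / P ^ 11) := by gcongr
      _ = 2 * 10 ^ 13 * Λ * (h * D / P ^ 10 * P⁻¹ + 2 * (D * P)) := by field_simp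
      _ ≤ 2 * 10 ^ 13 * Λ * (F * 1 + 2 * F) := by
          gcongr
          exact inv_le_one_of_one_le₀ hP
      _ = _ := by ring
  have a4 : h * ⟪z, ι (legC p η) - ((p : ℝ) / (2 * p + 1)) • ι (legC (p - 1) η)⟫
      ≤ 2 * (2 * 10 ^ 13) * Λ * F := by
    have b1 : ‖ι (legC p η) - ((p : ℝ) / (2 * p + 1)) • ι (legC (p - 1) η)‖
        ≤ 2 * (2 * 10 ^ 13 * Λ / P ^ 10) := by
      have b2 := norm_sub_le (ι (legC p η)) (((p : ℝ) / (2 * p + 1)) • ι (legC (p - 1) η))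
      rw [norm_smul, Real.norm_of_nonneg (by positivity)] at b2
      have b3 : (p : ℝ) / (2 * p + 1) ≤ 1 := by rw [div_le_one (by positivity)]; linarith
      have b4 : 2 * 10 ^ 13 * Λ / P ^ 11 ≤ 2 * 10 ^ 13 * Λ / P ^ 10 := by
        gcongr
        norm_num
      have b5 : (p : ℝ) / (2 * p + 1) * ‖ι (legC (p - 1) η)‖ ≤ 1 * ‖ι (legC (p - 1) η)‖ := by
        gcongr
      linarith
    calc _ ≤ h * (D * (2 * (2 * 10 ^ 13 * Λ / P ^ 10))) := by
          gcongr
          exact i4.trans (mul_le_mul hz b1 (norm_nonneg _) hD.le)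
      _ = 2 * (2 * 10 ^ 13) * Λ * (h * D / P ^ 10) := by ring
      _ ≤ _ := by gcongr
  have key : X ^ 2 ≤ (6 + 20 * 10 ^ 13) * m ^ 2 + (4 + 20 * 10 ^ 13) * (m * X) := by
    have s1 : X ^ 2 ≤ 2 * (l2 ι η ^ 2 + ‖ι (η 0) - e‖ ^ 2) := by
      rw [hX]; nlinarith [sq_nonneg (l2 ι η - ‖ι (η 0) - e‖)]
    have s2 : ‖e‖ ^ 2 ≤ m ^ 2 := pow_le_pow_left₀ e0 (by linarith) 2
    have s3 : m * F ≤ m ^ 2 := by rw [sq]; gcongr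
    have s4 : F * X ≤ m * X := by gcongr
    have s5 : Λ * F ≤ m * X + m ^ 2 := by
      calc Λ * F ≤ Λ * m := by gcongr
        _ = _ := by rw [hΛ]; ring
    linarith
  have hXm : X ≤ 5 * 10 ^ 14 * m := by
    refine (le_of_sq_le hX0 hm0.le (by norm_num) (by norm_num) key).trans ?_
    exact mul_le_mul_of_nonneg_right (by norm_num) hm0.le
  refine ⟨hXm, ?_⟩
  rw [← le_div_iff₀ (by positivity)]
  refine t1.trans (div_le_div_of_nonneg_right ?_ (by positivity))
  rw [hΛ]
  linarith

lemma norm_integral_kernel_le (hy : Continuous fun t => ι (η t)) {k : ℝ → ℝ} (hk : Continuous k)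
    {a b S : ℝ} (hab : a ≤ b) (hS : ∀ t ∈ Icc a b, ‖ι (η t)‖ ≤ S) :
    ‖∫ t in a..b, k t • ι (η t)‖ ≤ (∫ t in a..b, |k t|) * S := by
  refine (intervalIntegral.norm_integral_le_integral_norm hab).trans ?_
  rw [← intervalIntegral.integral_mul_const]
  refine intervalIntegral.integral_mono_on hab ((hk.smul hy).norm.intervalIntegrable _ _)
    ((hk.abs.mul continuous_const).intervalIntegrable _ _) fun t ht => ?_
  rw [norm_smul, Real.norm_eq_abs]
  exact mul_le_mul_of_nonneg_left (hS t ht) (abs_nonneg _)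

lemma integral_le_unit {f : ℝ → ℝ} (hf : Continuous f) (h0 : ∀ t, 0 ≤ f t) {a b : ℝ} (ha : 0 ≤ a)
    (hab : a ≤ b) (hb : b ≤ 1) : ∫ t in a..b, f t ≤ ∫ t in (0 : ℝ)..1, f t :=
  intervalIntegral.integral_mono_interval ha hab hb (Eventually.of_forall h0)
    (hf.intervalIntegrable _ _)

lemma sqrt_P {P : ℝ} (hP : 1 ≤ P) (hn : P ^ 12 = p + 1) : √((p : ℝ) + 1) = P ^ 6 := by
  rw [← hn, show P ^ 12 = (P ^ 6) ^ 2 by ring, Real.sqrt_sq (by positivity)]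

set_option maxHeartbeats 1600000 in
/-- Pointwise bound. Away from the left end point one integrates the energy balance backwards from
`1` and uses the `L²`-norm of the kernel; near the left end point one integrates forward from `0`
and uses its `L¹`-norm. The splitting point `P ^ (-8) / 2` balances both contributions. -/
lemma norm_le (c : CellEq ι A h p η e zm z) (hh : 0 ≤ h) {P D : ℝ} (hP : 1 ≤ P)
    (hn : P ^ 12 = p + 1) (hD : 0 < D) (hz : ‖z‖ ≤ D) (hzm : ‖zm‖ ≤ D) {t : ℝ}
    (ht : t ∈ Icc (0 : ℝ) 1) :
    ‖ι (η t)‖ ≤ 10 ^ 46 * (P ^ 4 * (‖e‖ + (D * P + h * D / P ^ 10)) + D * P ^ 6) := by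
  have hP0 : 0 < P := by linarith
  obtain ⟨b1, b2⟩ := c.l2_add_jump_le hh hP hn hD hz hzm
  set F := D * P + h * D / P ^ 10 with hF
  set m := ‖e‖ + F with hm
  have hF1 : D * P ≤ F := by rw [hF]; linarith [show 0 ≤ h * D / P ^ 10 by positivity]
  have hF2 : h * D / P ^ 10 ≤ F := by rw [hF]; linarith [show 0 ≤ D * P by positivity]
  have hF0 : 0 < F := lt_of_lt_of_le (by positivity) hF1
  have hDF : D ≤ F := by nlinarith
  have l0 : 0 ≤ l2 ι η := l2_nonneg
  have j0 := norm_nonneg (ι (η 0) - e)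
  have e0 := norm_nonneg e
  have hm0 : 0 < m := by positivity
  obtain ⟨Λ, hΛ⟩ : ∃ Λ, Λ = 5 * 10 ^ 14 * m := ⟨_, rfl⟩
  have hmΛ : m ≤ Λ := by rw [hΛ]; linarith
  have hΛ0 : 0 < Λ := by linarith
  have hDΛ : D ≤ Λ := by linarith
  have hhD : h * D ≤ Λ * P ^ 10 := by rw [← div_le_iff₀ (by positivity)]; linarith
  have hL : l2 ι η ≤ Λ := by linarith
  have hJ : ‖ι (η 0) - e‖ ≤ Λ := by linarith
  have he : ‖e‖ ≤ Λ := by linarith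
  have hy := c.polyι.continuous
  obtain ⟨t0, ht0, hmax⟩ := isCompact_Icc.exists_isMaxOn (nonempty_Icc.2 (zero_le_one (α := ℝ)))
    hy.norm.continuousOn
  set S := ‖ι (η t0)‖ with hS
  have hS' : ∀ t ∈ Icc (0 : ℝ) 1, ‖ι (η t)‖ ≤ S := fun t ht => hmax ht
  have hS0 : 0 ≤ S := norm_nonneg _
  have hsq := sqrt_P hP hn
  have hp0 : (0 : ℝ) ≤ p := p.cast_nonneg
  have hJz : ‖ι (η 0) - e - zm‖ ≤ 2 * Λ := (norm_sub_le _ _).trans (by linarith)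
  have hL2 : ∀ {a b : ℝ}, 0 ≤ a → a ≤ b → b ≤ 1 → √(∫ s in a..b, ‖ι (η s)‖ ^ 2) ≤ Λ := by
    intro a b ha hab hb
    exact (Real.sqrt_le_sqrt (integral_le_unit (hy.norm.pow 2) (fun _ => sq_nonneg _) ha hab
      hb)).trans hL
  -- the contribution of the data on any subinterval
  have hdata : ∀ {a b : ℝ}, 0 ≤ a → a ≤ b → b ≤ 1 →
      |h * ⟪z, ∫ s in a..b, legL p s • ι (η s)⟫ - ⟪z, ∫ s in a..b, kerR p s • ι (η s)⟫|
        ≤ P ^ 8 * Λ ^ 2 + 44 * (D * P ^ 6) * S := by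
    intro a b ha hab hb
    have q1 : ‖∫ s in a..b, legL p s • ι (η s)‖ ≤ Λ / P ^ 6 := by
      refine (norm_integral_smul_le hab (continuous_legL p).continuousOn hy.continuousOn).trans ?_
      have q2 : √(∫ s in a..b, legL p s ^ 2) ≤ 1 / P ^ 6 := by
        have q3 : ∫ s in a..b, legL p s ^ 2 ≤ 1 / (2 * p + 1) := by
          rw [← integral_legL_sq]
          simp_rw [← sq]
          exact integral_le_unit ((continuous_legL p).pow 2) (fun _ => sq_nonneg _) ha hab hb
        rw [← hsq, ← Real.sqrt_one, ← Real.sqrt_div zero_le_one, Real.sqrt_one]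
        refine Real.sqrt_le_sqrt (q3.trans ?_)
        gcongr; linarith
      calc _ ≤ 1 / P ^ 6 * Λ := mul_le_mul q2 (hL2 ha hab hb) (Real.sqrt_nonneg _) (by positivity)
        _ = _ := by ring
    have q4 : ‖∫ s in a..b, kerR p s • ι (η s)‖ ≤ 44 * P ^ 6 * S := by
      refine (norm_integral_kernel_le hy (continuous_kerR p) hab
        fun s hs => hS' s ⟨ha.trans hs.1, hs.2.trans hb⟩).trans ?_
      refine mul_le_mul_of_nonneg_right ?_ hS0
      rw [← hsq]
      exact (integral_le_unit (continuous_kerR p).abs (fun _ => abs_nonneg _) ha hab hb).trans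
        (integral_abs_kerR_total_le p)
    have q5 := abs_real_inner_le_norm z (∫ s in a..b, legL p s • ι (η s))
    have q6 := abs_real_inner_le_norm z (∫ s in a..b, kerR p s • ι (η s))
    have q7 : ‖z‖ * ‖∫ s in a..b, legL p s • ι (η s)‖ ≤ D * (Λ / P ^ 6) :=
      mul_le_mul hz q1 (norm_nonneg _) hD.le
    have q8 : ‖z‖ * ‖∫ s in a..b, kerR p s • ι (η s)‖ ≤ D * (44 * P ^ 6 * S) :=
      mul_le_mul hz q4 (norm_nonneg _) hD.le
    have q9 : h * (D * (Λ / P ^ 6)) ≤ P ^ 8 * Λ ^ 2 := by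
      calc _ = h * D * (Λ / P ^ 6) := by ring
        _ ≤ Λ * P ^ 10 * (Λ / P ^ 6) := by gcongr
        _ = P ^ 4 * Λ ^ 2 := by field_simp
        _ ≤ _ := by gcongr; norm_num
    have q10 : h * |⟪z, ∫ s in a..b, legL p s • ι (η s)⟫| ≤ h * (D * (Λ / P ^ 6)) :=
      mul_le_mul_of_nonneg_left (q5.trans q7) hh
    refine (abs_sub _ _).trans ?_
    rw [abs_mul, abs_of_nonneg hh]
    linarith
  have hP8 : 1 ≤ P ^ 8 := one_le_pow₀ hP
  have hP4 : 1 ≤ P ^ 4 := one_le_pow₀ hP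
  have hΛ2 : Λ ^ 2 ≤ P ^ 8 * Λ ^ 2 := le_mul_of_one_le_left (by positivity) hP8
  have hend : ‖ι (η 1)‖ ^ 2 ≤ (5 + 2 * 10 ^ 29) * (P ^ 8 * Λ ^ 2) + 2 * (P ^ 4 * Λ) * S := by
    have en := c.energy
    have i1 := real_inner_le_norm zm e
    have i2 := real_inner_le_norm zm (ι (η 0) - e)
    have i3 := real_inner_le_norm z (ι (legC p η))
    have i4 := abs_real_inner_le_norm z (ι (η 1))
    have k1 : ‖zm‖ * ‖e‖ ≤ Λ * Λ := mul_le_mul (by linarith) he e0 hΛ0.le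
    have k2 : ‖zm‖ * ‖ι (η 0) - e‖ ≤ Λ * Λ := mul_le_mul (by linarith) hJ j0 hΛ0.le
    have k3 : h * ⟪z, ι (legC p η)⟫ ≤ 10 ^ 29 * Λ ^ 2 := by
      rw [← le_div_iff₀ (by positivity)] at b2
      have k5 : ‖ι (legC p η)‖ ≤ 10 ^ 29 * Λ / P ^ 10 := by
        refine b2.trans ?_
        gcongr
        norm_num
      calc _ ≤ h * (D * (10 ^ 29 * Λ / P ^ 10)) := by
            gcongr
            exact i3.trans (mul_le_mul hz k5 (norm_nonneg _) hD.le)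
        _ = h * D * (10 ^ 29 * Λ / P ^ 10) := by ring
        _ ≤ Λ * P ^ 10 * (10 ^ 29 * Λ / P ^ 10) := by gcongr
        _ = _ := by field_simp
    have k4 : ‖z‖ * ‖ι (η 1)‖ ≤ Λ * S :=
      mul_le_mul (by linarith) (hS' 1 (by simp)) (norm_nonneg _) hΛ0.le
    have k6 : Λ * S ≤ P ^ 4 * Λ * S := by
      gcongr
      exact le_mul_of_one_le_left hΛ0.le hP4
    have k7 : ‖e‖ ^ 2 ≤ Λ ^ 2 := pow_le_pow_left₀ e0 he 2
    have := (abs_le.1 i4).1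
    nlinarith [sq_nonneg ‖ι (η 0) - e‖]
  have hall : ∀ t ∈ Icc (0 : ℝ) 1, ‖ι (η t)‖ ^ 2
      ≤ (100 + 2 * 10 ^ 29) * (P ^ 4 * Λ + D * P ^ 6) ^ 2
        + 100 * ((P ^ 4 * Λ + D * P ^ 6) * S) := by
    intro t ht
    have hQ1 : P ^ 8 * Λ ^ 2 ≤ (P ^ 4 * Λ + D * P ^ 6) ^ 2 := by
      calc P ^ 8 * Λ ^ 2 = (P ^ 4 * Λ) ^ 2 := by ring
        _ ≤ _ := by gcongr; linarith [show 0 ≤ D * P ^ 6 by positivity]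
    have hQ0 : 0 ≤ P ^ 4 * Λ * S := by positivity
    have hQ00 : 0 ≤ D * P ^ 6 * S := by positivity
    have hQ2 : 0 ≤ P ^ 8 * Λ ^ 2 := by positivity
    set δ : ℝ := 1 / 2 * (P⁻¹) ^ 8 with hδ
    have hPi : P⁻¹ ≤ 1 := inv_le_one_of_one_le₀ hP
    have hδ0 : 0 < δ := by positivity
    have hδ1 : δ ≤ 1 / 2 := by
      rw [hδ]; have := pow_le_one₀ (n := 8) (inv_nonneg.2 hP0.le) hPi; linarith
    rcases le_total δ t with hδt | hδt
    · have h1 := c.sq_sub_sq t 1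
      have h2 := (abs_le.1 (hdata ht.1 ht.2 le_rfl)).1
      have h3 := real_inner_le_norm (ι (η 0) - e - zm) (∫ s in t..1, kerL p s • ι (η s))
      have h4 : ‖∫ s in t..1, kerL p s • ι (η s)‖ ≤ 6 * P ^ 8 * Λ := by
        refine (norm_integral_smul_le ht.2 (continuous_kerL p).continuousOn
          hy.continuousOn).trans ?_
        refine mul_le_mul ?_ (hL2 ht.1 ht.2 le_rfl) (Real.sqrt_nonneg _) (by positivity)
        rw [Real.sqrt_le_left (by positivity)]
        calc ∫ s in t..1, kerL p s ^ 2 ≤ ∫ s in δ..1, kerL p s ^ 2 :=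
              intervalIntegral.integral_mono_interval hδt ht.2 le_rfl
                (Eventually.of_forall fun _ => sq_nonneg _)
                (((continuous_kerL p).pow 2).intervalIntegrable _ _)
          _ ≤ 18 * (p + 1) / √δ := integral_kerL_sq_le p hδ0 (by linarith)
          _ ≤ 18 * P ^ 12 / (1 / 2 * (P⁻¹) ^ 4) := by
              rw [hn]
              gcongr
              apply Real.le_sqrt_of_sq_le
              rw [hδ]
              have : 0 ≤ (P⁻¹) ^ 8 := by positivity
              nlinarith
          _ = 36 * P ^ 16 := by field_simp; norm_num
          _ = (6 * P ^ 8) ^ 2 := by ring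
      have h5 : ‖ι (η 0) - e - zm‖ * ‖∫ s in t..1, kerL p s • ι (η s)‖
          ≤ 2 * Λ * (6 * P ^ 8 * Λ) := mul_le_mul hJz h4 (norm_nonneg _) (by positivity)
      linarith
    · have h1 := c.sq_sub_sq 0 t
      have h2 := (abs_le.1 (hdata le_rfl ht.1 ht.2)).2
      have h3 := (abs_le.1 (abs_real_inner_le_norm (ι (η 0) - e - zm)
        (∫ s in (0 : ℝ)..t, kerL p s • ι (η s)))).1
      have h4 : ‖∫ s in (0 : ℝ)..t, kerL p s • ι (η s)‖ ≤ 20 * P ^ 4 * S := by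
        refine (norm_integral_kernel_le hy (continuous_kerL p) ht.1
          fun s hs => hS' s ⟨hs.1, hs.2.trans ht.2⟩).trans ?_
        refine mul_le_mul_of_nonneg_right ?_ hS0
        calc ∫ s in (0 : ℝ)..t, |kerL p s| ≤ ∫ s in (0 : ℝ)..δ, |kerL p s| :=
              intervalIntegral.integral_mono_interval le_rfl ht.1 hδt
                (Eventually.of_forall fun _ => abs_nonneg _)
                ((continuous_kerL p).abs.intervalIntegrable _ _)
          _ ≤ 20 * √((p : ℝ) + 1) * √√δ := integral_abs_kerL_le p hδ0.le hδ1
          _ ≤ 20 * P ^ 6 * (P⁻¹) ^ 2 := by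
              rw [hsq]
              gcongr
              rw [Real.sqrt_le_left (by positivity), Real.sqrt_le_left (by positivity), hδ]
              have : 0 ≤ (P⁻¹) ^ 8 := by positivity
              nlinarith
          _ = 20 * P ^ 4 := by field_simp
      have h5 : ‖ι (η 0) - e - zm‖ * ‖∫ s in (0 : ℝ)..t, kerL p s • ι (η s)‖
          ≤ 2 * Λ * (20 * P ^ 4 * S) := mul_le_mul hJz h4 (norm_nonneg _) (by positivity)
      have h6 : ‖ι (η 0)‖ ^ 2 ≤ 4 * Λ ^ 2 := by
        have : ‖ι (η 0)‖ ≤ 2 * Λ := by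
          calc ‖ι (η 0)‖ = ‖(ι (η 0) - e) + e‖ := by rw [sub_add_cancel]
            _ ≤ _ := (norm_add_le _ _).trans (by linarith)
        calc _ ≤ (2 * Λ) ^ 2 := by gcongr
          _ = _ := by ring
      linarith
  have hfin := le_of_sq_le hS0 (by positivity) (by norm_num) (by norm_num) (hall t0 ht0)
  refine (hS' t ht).trans (hfin.trans ?_)
  rw [hΛ]
  have w1 : 0 ≤ P ^ 4 * m := by positivity
  have w2 : 0 ≤ D * P ^ 6 := by positivity
  linarith

end CellEq

end DGWave

/-! ### Stability over many cells -/

namespace DGWave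

variable {W H : Type*} [NormedAddCommGroup W] [NormedSpace ℝ W] [CompleteSpace W]
  [NormedAddCommGroup H] [InnerProductSpace ℝ H] [CompleteSpace H]

local notation "⟪" x ", " y "⟫" => inner ℝ x y

/-- Summing the energy balances of `N` cells bounds the solution by `N` times the data, with the
factor `h + p + 1`. -/
theorem norm_le_of_cells {ι A : W →L[ℝ] H} {h : ℝ} (hh : 0 ≤ h) {p N : ℕ} {η : ℕ → ℝ → W}
    {e zm z : ℕ → H} (he0 : e 0 = 0) (he : ∀ n, e (n + 1) = ι (η n 1)) (hzm0 : zm 0 = 0)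
    (hzm : ∀ n, zm (n + 1) = z n) (c : ∀ n < N, CellEq ι A h p (η n) (e n) (zm n) (z n))
    {ε : ℝ} (hε : 0 < ε) (hz : ∀ n < N, ‖z n‖ ≤ √((p : ℝ) + 1) * ε) {n : ℕ} (hn : n < N) {t : ℝ}
    (ht : t ∈ Icc (0 : ℝ) 1) : ‖ι (η n t)‖ ≤ 10 ^ 77 * (ε * N * (h + (p + 1))) := by
  obtain ⟨P, hP, hPn⟩ : ∃ P : ℝ, 1 ≤ P ∧ P ^ 12 = p + 1 := by
    refine ⟨((p : ℝ) + 1) ^ (1 / 12 : ℝ), Real.one_le_rpow (by linarith [p.cast_nonneg (α := ℝ)])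
      (by norm_num), ?_⟩
    rw [← Real.rpow_natCast, ← Real.rpow_mul (by positivity)]
    norm_num
  have hP0 : 0 < P := by linarith
  rw [CellEq.sqrt_P hP hPn] at hz
  rw [← hPn]
  obtain ⟨D, hD⟩ : ∃ D, D = P ^ 6 * ε := ⟨_, rfl⟩
  rw [← hD] at hz
  have hD0 : 0 < D := by rw [hD]; positivity
  have hz' : ∀ n < N, ‖zm n‖ ≤ D := by
    intro n hn
    cases n with
    | zero => rw [hzm0, norm_zero]; exact hD0.le
    | succ n => rw [hzm]; exact hz n (by omega)
  have hzN : ‖zm N‖ ≤ D := by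
    cases N with
    | zero => omega
    | succ n => rw [hzm]; exact hz n (by omega)
  set F := D * P + h * D / P ^ 10 with hF
  have hF0 : 0 ≤ F := by positivity
  obtain ⟨m, hm, hmax⟩ := Finset.exists_max_image (Finset.range (N + 1)) (fun n => ‖e n‖)
    ⟨0, by simp⟩
  set M := ‖e m‖ with hM
  have hM0 : 0 ≤ M := norm_nonneg _
  have hmN : m ≤ N := Nat.lt_succ_iff.1 (Finset.mem_range.1 hm)
  have hle : ∀ n ≤ N, ‖e n‖ ≤ M := fun n hn => hmax n (Finset.mem_range.2 (by omega))
  have hstep : ∀ n < N, ‖e (n + 1)‖ ^ 2 + 2 * ⟪zm (n + 1), e (n + 1)⟫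
      ≤ ‖e n‖ ^ 2 + 2 * ⟪zm n, e n⟫ + (D ^ 2 + 2 * (10 ^ 29 * (h * D / P ^ 11 * (M + F)))) := by
    intro n hn
    have h1 := (c n hn).energy
    rw [he, hzm]
    have h2 := real_inner_le_norm (zm n) (ι (η n 0) - e n)
    have h3 := real_inner_le_norm (z n) (ι (legC p (η n)))
    have h4 : 2 * (‖zm n‖ * ‖ι (η n 0) - e n‖) ≤ D ^ 2 + ‖ι (η n 0) - e n‖ ^ 2 := by
      have : ‖zm n‖ * ‖ι (η n 0) - e n‖ ≤ D * ‖ι (η n 0) - e n‖ := by gcongr; exact hz' n hn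
      nlinarith [sq_nonneg (D - ‖ι (η n 0) - e n‖)]
    have h5 := ((c n hn).l2_add_jump_le hh hP hPn hD0 (hz n hn) (hz' n hn)).2
    rw [← hF, ← le_div_iff₀ (by positivity)] at h5
    have h6 : h * (‖z n‖ * ‖ι (legC p (η n))‖) ≤ h * (D * (10 ^ 29 * (M + F) / P ^ 11)) := by
      have h7 : ‖ι (legC p (η n))‖ ≤ 10 ^ 29 * (M + F) / P ^ 11 := by
        refine h5.trans ?_
        gcongr
        exact hle n hn.le
      gcongr
      exact hz n hn
    have h8 : h * (D * (10 ^ 29 * (M + F) / P ^ 11)) = 10 ^ 29 * (h * D / P ^ 11 * (M + F)) := by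
      ring
    have h9 : h * ⟪z n, ι (legC p (η n))⟫ ≤ h * (‖z n‖ * ‖ι (legC p (η n))‖) := by gcongr
    linarith
  have hE : ∀ n ≤ N, ‖e n‖ ^ 2 + 2 * ⟪zm n, e n⟫
      ≤ n * (D ^ 2 + 2 * (10 ^ 29 * (h * D / P ^ 11 * (M + F)))) := by
    intro n
    induction n with
    | zero => intro _; simp [he0]
    | succ n ih =>
      intro hn
      have h1 := ih (by omega)
      have h2 := hstep n (by omega)
      push_cast
      linarith
  have hN1 : (1 : ℝ) ≤ N := by exact_mod_cast (by omega : 1 ≤ N)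
  set R := ε * N * (h + P ^ 12) / P ^ 4 with hR
  have hR0 : 0 ≤ R := by positivity
  have hP4 : 1 ≤ P ^ 4 := one_le_pow₀ hP
  have hDR : D * P ^ 2 ≤ R := by
    rw [hR, hD, le_div_iff₀ (by positivity)]
    calc P ^ 6 * ε * P ^ 2 * P ^ 4 = ε * 1 * (0 + P ^ 12) := by ring
      _ ≤ _ := by gcongr
  have haR : h * D / P ^ 10 ≤ R / N := by
    rw [hR, hD, div_div, div_le_div_iff₀ (by positivity) (by positivity)]
    calc h * (P ^ 6 * ε) * (P ^ 4 * N) = ε * N * (h + 0) * P ^ 10 := by ring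
      _ ≤ _ := by gcongr; positivity
  have haR' : N * (h * D / P ^ 11) ≤ R := by
    have h1 : h * D / P ^ 11 ≤ h * D / P ^ 10 := by gcongr; norm_num
    calc N * (h * D / P ^ 11) ≤ N * (R / N) :=
          mul_le_mul_of_nonneg_left (h1.trans haR) (by positivity)
      _ = R := by field_simp
  have hFR : F ≤ 2 * R := by
    have h1 : D * P ≤ D * P ^ 2 := by gcongr; nlinarith
    have h2 : R / N ≤ R := div_le_self hR0 hN1
    rw [hF]; linarith
  have hND : N * D ^ 2 ≤ R ^ 2 := by
    have h1 : √N * D ≤ R := by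
      refine le_trans ?_ (?_ : N * (D * 1) ≤ R)
      · rw [mul_one]
        gcongr
        exact Real.sqrt_le_left (by positivity) |>.2 (by nlinarith)
      · rw [hR, hD, le_div_iff₀ (by positivity)]
        calc N * (P ^ 6 * ε * 1) * P ^ 4 = ε * N * (0 + P ^ 10) := by ring
          _ ≤ _ := by gcongr; norm_num
    calc N * D ^ 2 = (√N * D) ^ 2 := by rw [mul_pow, Real.sq_sqrt (by positivity)]
      _ ≤ R ^ 2 := by gcongr
  have key : M ^ 2 ≤ (1 + 4 * 10 ^ 29) * R ^ 2 + (2 + 2 * 10 ^ 29) * (R * M) := by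
    have h1 := hE m hmN
    have h2 : ‖zm m‖ ≤ D := by
      rcases hmN.lt_or_eq with h | h
      · exact hz' m h
      · rw [h]; exact hzN
    have h3 := (abs_le.1 (abs_real_inner_le_norm (zm m) (e m))).1
    have h4 : ‖zm m‖ * ‖e m‖ ≤ R * M := by
      refine mul_le_mul_of_nonneg_right (h2.trans (le_trans ?_ hDR)) hM0
      exact le_mul_of_one_le_right hD0.le (one_le_pow₀ hP)
    have h5 : (m : ℝ) ≤ N := by exact_mod_cast hmN
    have h6 : m * (D ^ 2 + 2 * (10 ^ 29 * (h * D / P ^ 11 * (M + F))))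
        ≤ N * (D ^ 2 + 2 * (10 ^ 29 * (h * D / P ^ 11 * (M + F)))) := by gcongr
    have h7 : N * (h * D / P ^ 11) * (M + F) ≤ R * (M + 2 * R) := by gcongr
    linarith
  have hMR := CellEq.le_of_sq_le hM0 hR0 (by norm_num) (by norm_num) key
  have hfin := (c n hn).norm_le hh hP hPn hD0 (hz n hn) (hz' n hn) ht
  rw [← hF] at hfin
  have hRP : R * P ^ 4 = ε * N * (h + P ^ 12) := by rw [hR]; field_simp
  rw [← hRP]
  refine hfin.trans ?_
  have h1 : P ^ 4 * (‖e n‖ + F) ≤ P ^ 4 * (10 ^ 30 * R + 2 * R) := by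
    gcongr
    refine (hle n hn.le).trans (hMR.trans ?_)
    exact mul_le_mul_of_nonneg_right (by norm_num) hR0
  have h2 : D * P ^ 6 ≤ R * P ^ 4 := by
    calc D * P ^ 6 = D * P ^ 2 * P ^ 4 := by ring
      _ ≤ _ := by gcongr
  have h3 : 0 ≤ R * P ^ 4 := by positivity
  linarith

end DGWave

/-! ### Generators of contraction semigroups and stability in the graph norm -/

namespace DGWave

set_option linter.unusedSectionVars false

variable {W H : Type*} [NormedAddCommGroup W] [NormedSpace ℝ W]
  [NormedAddCommGroup H] [InnerProductSpace ℝ H]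

local notation "⟪" x ", " y "⟫" => inner ℝ x y

/-- A skew operator `A` with domain `W` (embedded by `ι`), with surjective `A - x` for `x > 0`. -/
structure SkewGenerator (ι A : W →L[ℝ] H) : Prop where
  inj : Function.Injective ι
  skew : ∀ w, ⟪A w, ι w⟫ = 0
  surj : ∀ x : ℝ, 0 < x → ∀ f : H, ∃ w, A w - x • ι w = f

namespace SkewGenerator

variable {ι A : W →L[ℝ] H}

lemma norm_le (g : SkewGenerator ι A) (x : ℝ) (w : W) :
    x * ‖ι w‖ ≤ ‖x • ι w - A w‖ := by
  have h1 : ⟪x • ι w - A w, ι w⟫ = x * ‖ι w‖ ^ 2 := by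
    rw [inner_sub_left, g.skew, sub_zero, inner_smul_left, real_inner_self_eq_norm_sq]
    rfl
  have h2 := real_inner_le_norm (x • ι w - A w) (ι w)
  rw [h1] at h2
  rcases (norm_nonneg (ι w)).eq_or_lt with h | h
  · rw [← h, mul_zero]; exact norm_nonneg _
  · exact le_of_mul_le_mul_right (by linarith) h

lemma bijective (g : SkewGenerator ι A) {x : ℝ} (hx : 0 < x) :
    Function.Bijective (x • ι - A) := by
  constructor
  · refine (injective_iff_map_eq_zero _).2 fun w hw => g.inj ?_
    have h1 := g.norm_le x w
    rw [show x • ι w - A w = 0 from hw, norm_zero] at h1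
    have : ‖ι w‖ ≤ 0 := le_of_mul_le_mul_left (by linarith) hx
    rw [map_zero]
    exact norm_le_zero_iff.1 this
  · intro f
    obtain ⟨w, hw⟩ := g.surj x hx (-f)
    exact ⟨w, by
      change x • ι w - A w = f
      rw [← neg_sub, hw, neg_neg]⟩

variable [CompleteSpace W] [CompleteSpace H]

/-- The resolvent `(x - A)⁻¹`, with values in the domain. -/
lemma exists_resolvent (g : SkewGenerator ι A) {x : ℝ} (hx : 0 < x) :
    ∃ R : H →L[ℝ] W, (∀ f, x • ι (R f) - A (R f) = f) ∧ ∀ w, R (x • ι w - A w) = w := by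
  have hb := g.bijective hx
  let E := ContinuousLinearEquiv.ofBijective (x • ι - A) (LinearMap.ker_eq_bot.2 hb.1)
    (LinearMap.range_eq_top.2 hb.2)
  refine ⟨E.symm, fun f => ?_, fun w => ?_⟩
  · exact E.apply_symm_apply f
  · exact E.symm_apply_apply w

/-- The graph norm controls the norm of the domain. -/
lemma exists_bound (g : SkewGenerator ι A) : ∃ C : ℝ, 0 < C ∧ ∀ w, ‖w‖ ≤ C * ‖A w - ι w‖ := by
  obtain ⟨R, -, hR⟩ := g.exists_resolvent one_pos
  refine ⟨‖R‖ + 1, by positivity, fun w => ?_⟩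
  have h := R.le_opNorm ((1 : ℝ) • ι w - A w)
  rw [hR, one_smul, norm_sub_rev] at h
  linarith [norm_nonneg (A w - ι w)]

/-- The domain is dense: if `v = A w - ι w` is orthogonal to it, pairing with `ι w` gives
`w = 0`. -/
lemma dense (g : SkewGenerator ι A) (f : H) {δ : ℝ} (hδ : 0 < δ) : ∃ w, ‖f - ι w‖ < δ := by
  have htop : (LinearMap.range (ι : W →ₗ[ℝ] H)).topologicalClosure = ⊤ := by
    rw [Submodule.topologicalClosure_eq_top_iff, Submodule.eq_bot_iff]
    intro v hv
    obtain ⟨w, hw⟩ := g.surj 1 one_pos v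
    have h1 := Submodule.inner_right_of_mem_orthogonal (LinearMap.mem_range_self _ w) hv
    rw [← hw, one_smul, inner_sub_right] at h1
    have h2 : ⟪ι w, A w⟫ = 0 := by rw [real_inner_comm]; exact g.skew w
    have h3 : ⟪ι w, ι w⟫ = 0 := by
      change ⟪ι w, A w⟫ - ⟪ι w, ι w⟫ = 0 at h1
      linarith
    have h4 : w = 0 := g.inj (by rw [inner_self_eq_zero.1 h3, map_zero])
    rw [← hw, h4]; simp
  have hf : f ∈ closure (range ι) := by
    have : f ∈ (LinearMap.range (ι : W →ₗ[ℝ] H)).topologicalClosure := htop ▸ Submodule.mem_top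
    exact this
  obtain ⟨_, ⟨w, rfl⟩, hw⟩ := Metric.mem_closure_iff.1 hf δ hδ
  exact ⟨w, by rwa [← dist_eq_norm]⟩

/-- The cell equation is inherited by `T η` for the bounded operator `T = x (A - 1) (x - A)⁻¹`, and
bounds which are uniform in `x` pass to the limit `A - 1`. -/
theorem norm_graph_le (g : SkewGenerator ι A) {h : ℝ} (hh : 0 ≤ h) {p N : ℕ} {η : ℕ → ℝ → W}
    {e : ℕ → H} {zm z : ℕ → W} (he0 : e 0 = 0) (he : ∀ n, e (n + 1) = ι (η n 1)) (hzm0 : zm 0 = 0)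
    (hzm : ∀ n, zm (n + 1) = z n)
    (c : ∀ n < N, CellEq ι A h p (η n) (e n) (ι (zm n)) (ι (z n)))
    {ε : ℝ} (hε : 0 < ε) (hz : ∀ n < N, ‖A (z n) - ι (z n)‖ ≤ √((p : ℝ) + 1) * ε) {n : ℕ}
    (hn : n < N) {t : ℝ} (ht : t ∈ Icc (0 : ℝ) 1) :
    ‖A (η n t) - ι (η n t)‖ ≤ 10 ^ 77 * (ε * N * (h + (p + 1))) := by
  set f := A (η n t) - ι (η n t) with hf
  refine le_of_forall_pos_le_add fun δ hδ => ?_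
  obtain ⟨w, hw⟩ := g.dense f (δ := δ / 4) (by positivity)
  set x := 2 * (‖A w‖ + 1) / δ with hx
  have hx0 : 0 < x := by positivity
  obtain ⟨R, hR1, hR2⟩ := g.exists_resolvent hx0
  have hcontr : ∀ f, ‖x • ι (R f)‖ ≤ ‖f‖ := fun f => by
    have := g.norm_le x (R f)
    rw [hR1] at this
    rwa [norm_smul, Real.norm_of_nonneg hx0.le]
  have hcomm : ∀ w, A (R (ι w)) = ι (R (A w)) := fun w => by
    have h1 := hR2 w
    rw [map_sub, map_smul, sub_eq_iff_eq_add] at h1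
    have h2 := congrArg ι h1
    rw [map_smul, map_add] at h2
    have h3 := hR1 (ι w)
    rw [h2] at h3
    rw [sub_eq_iff_eq_add, add_right_inj] at h3
    exact h3.symm
  let TH : H →L[ℝ] H := x • (A.comp R - ι.comp R)
  let TW : W →L[ℝ] W := x • (R.comp (A - ι))
  have hTH : ∀ f, TH f = x • (A (R f) - ι (R f)) := fun f => rfl
  have hTW : ∀ w, TW w = x • (R (A w) - R (ι w)) := fun w => by
    simp [TW]
  have h1 : ∀ w, ι (TW w) = TH (ι w) := fun w => by
    rw [hTW, hTH, map_smul, map_sub, hcomm]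
  have h2 : ∀ w, A (TW w) = TH (A w) := fun w => by
    rw [hTW, hTH, map_smul, map_sub, hcomm]
  have hTn : ∀ w, ι (TW w) = x • ι (R (A w - ι w)) := fun w => by
    rw [hTW, map_smul, map_sub, map_sub, map_sub]
  have cT : ∀ n < N, CellEq ι A h p (fun t => TW (η n t)) (TH (e n)) (TH (ι (zm n)))
      (TH (ι (z n))) := fun n hn =>
    { poly := (c n hn).poly.clm TW
      skew := g.skew
      eq := fun t => by
        have := (TH.hasFDerivAt.comp_hasDerivAt t ((c n hn).eq t))
        simp only [map_add, map_sub, map_smul] at this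
        simp_rw [h1, h2]
        exact this }
  have hB := norm_le_of_cells hh (e := fun n => TH (e n)) (zm := fun n => TH (ι (zm n)))
    (z := fun n => TH (ι (z n))) (by simp [he0]) (fun n => by simp only [he, h1])
    (by simp [hzm0]) (fun n => by simp only [hzm]) cT hε
    (fun n hn => by rw [← h1, hTn]; exact (hcontr _).trans (hz n hn)) hn ht
  rw [hTn, ← hf] at hB
  -- `x (x - A)⁻¹` is close to the identity on `f`
  have hw1 : x • ι (R (ι w)) - ι w = ι (R (A w)) := by
    rw [← hcomm, sub_eq_iff_eq_add, add_comm, ← sub_eq_iff_eq_add]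
    exact hR1 _
  have hw2 : ‖ι (R (A w))‖ ≤ δ / 2 := by
    have h3 := g.norm_le x (R (A w))
    rw [hR1, hx, div_mul_eq_mul_div, div_le_iff₀ hδ] at h3
    have h4 := norm_nonneg (A w)
    nlinarith
  have hsplit : f = x • ι (R f) + ((f - ι w) - x • ι (R (f - ι w)) - ι (R (A w))) := by
    rw [← hw1, map_sub R f, map_sub ι (R f), smul_sub]
    abel
  calc ‖f‖ = ‖x • ι (R f) + ((f - ι w) - x • ι (R (f - ι w)) - ι (R (A w)))‖ := by rw [← hsplit]
    _ ≤ ‖x • ι (R f)‖ + (‖f - ι w‖ + ‖x • ι (R (f - ι w))‖ + ‖ι (R (A w))‖) :=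
        (norm_add_le _ _).trans (add_le_add_right ((norm_sub_le _ _).trans
          (add_le_add_left (norm_sub_le _ _) _)) _)
    _ ≤ 10 ^ 77 * (ε * N * (h + (p + 1))) + (δ / 4 + δ / 4 + δ / 2) := by
        have := hcontr (f - ι w)
        gcongr
        linarith
    _ = _ := by ring

end SkewGenerator

end DGWave

/-! ### Piecewise polynomials on cells -/

namespace DGWave

section Cells

variable {X : Type*} [NormedAddCommGroup X] [NormedSpace ℝ X]

/-- On each cell a piecewise polynomial is a polynomial in the local variable. -/
lemma exists_cell_poly {h : ℝ} (hh : 0 < h) {m : ℕ} {w : ℝ → X} (hw : IsPiecewisePoly h m w) :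
    ∃ U : ℕ → ℝ → X, ∀ n, IsPoly m (U n) ∧ ∀ τ ∈ Ioc (0 : ℝ) 1, w (h * (n + τ)) = U n τ := by
  choose c hc using hw
  refine ⟨fun n τ => ∑ i ∈ Finset.range m, (h * (n + τ)) ^ i • c n i, fun n => ⟨?_, ?_⟩⟩
  · refine isPoly_sum _ fun i hi => ?_
    refine IsPoly.smul_const (f := fun τ => (h * (n + τ)) ^ i) ?_ (c n i)
    have h1 : ((Polynomial.C h * (Polynomial.C (n : ℝ) + Polynomial.X)) ^ i).natDegree < m := by
      refine lt_of_le_of_lt (Polynomial.natDegree_pow_le_of_le (m := 1) i ?_)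
        (by simpa using Finset.mem_range.1 hi)
      refine (Polynomial.natDegree_C_mul_le _ _).trans ?_
      exact (Polynomial.natDegree_add_le _ _).trans (by simp)
    refine cast (congrArg _ (funext fun τ => ?_)) (isPoly_eval _ h1)
    simp
  · intro τ hτ
    refine hc n _ ⟨?_, ?_⟩
    · nlinarith [hτ.1]
    · nlinarith [hτ.2]

open Classical in
/-- The `j`-th Legendre polynomial on the `n`-th cell, extended by zero. -/
noncomputable def cellFun (h : ℝ) (n j : ℕ) (t : ℝ) : ℝ :=
  if t ∈ Ioc ((n : ℝ) * h) (((n : ℝ) + 1) * h) then legL j (t / h - n) else 0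

lemma cell_unique {h : ℝ} (hh : 0 < h) {m n : ℕ} {t : ℝ}
    (hm : t ∈ Ioc ((m : ℝ) * h) (((m : ℝ) + 1) * h))
    (hn : t ∈ Ioc ((n : ℝ) * h) (((n : ℝ) + 1) * h)) : m = n := by
  have h1 : (m : ℝ) < n + 1 := lt_of_mul_lt_mul_right (hm.1.trans_le hn.2) hh.le
  have h2 : (n : ℝ) < m + 1 := lt_of_mul_lt_mul_right (hn.1.trans_le hm.2) hh.le
  have h3 : m < n + 1 := by exact_mod_cast h1
  have h4 : n < m + 1 := by exact_mod_cast h2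
  omega

lemma cellFun_of_mem {h : ℝ} {n j : ℕ} {t : ℝ}
    (ht : t ∈ Ioc ((n : ℝ) * h) (((n : ℝ) + 1) * h)) : cellFun h n j t = legL j (t / h - n) := by
  rw [cellFun, if_pos ht]

lemma cellFun_of_ne {h : ℝ} (hh : 0 < h) {m n j : ℕ} (hmn : m ≠ n) {t : ℝ}
    (ht : t ∈ Ioc ((m : ℝ) * h) (((m : ℝ) + 1) * h)) : cellFun h n j t = 0 := by
  rw [cellFun, if_neg fun hn => hmn (cell_unique hh ht hn)]

lemma isPiecewisePoly_cellFun {h : ℝ} (hh : 0 < h) (n : ℕ) {j m : ℕ} (hj : j < m) (x : X) :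
    IsPiecewisePoly h m fun t => cellFun h n j t • x := by
  intro k
  rcases eq_or_ne k n with rfl | hkn
  · set q : Polynomial ℝ := (leg j).comp (Polynomial.C h⁻¹ * Polynomial.X - Polynomial.C (k : ℝ))
      with hq
    have hdeg : q.natDegree < m := by
      refine lt_of_le_of_lt (Polynomial.natDegree_comp_le.trans ?_) hj
      refine (Nat.mul_le_mul (natDegree_leg_le j) (?_ : _ ≤ 1)).trans_eq (mul_one j)
      refine (Polynomial.natDegree_sub_le _ _).trans (max_le ?_ (by simp))
      exact (Polynomial.natDegree_C_mul_le _ _).trans Polynomial.natDegree_X_le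
    refine ⟨fun i => q.coeff i • x, fun t ht => ?_⟩
    simp only
    rw [cellFun_of_mem ht]
    have : legL j (t / h - k) = q.eval t := by
      simp [hq, legL, Polynomial.eval_comp, div_eq_inv_mul]
    rw [this, Polynomial.eval_eq_sum_range' hdeg, Finset.sum_smul]
    exact Finset.sum_congr rfl fun i _ => by rw [smul_smul, mul_comm]
  · exact ⟨0, fun t ht => by simp [cellFun_of_ne hh hkn ht]⟩

lemma hasBoundedTimeSupport_cellFun (h : ℝ) (n j : ℕ) (x : X) :
    HasBoundedTimeSupport fun t => cellFun h n j t • x := by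
  refine ⟨((n : ℝ) + 1) * h, fun t ht => ?_⟩
  simp only
  rw [cellFun, if_neg fun hn => not_lt.2 hn.2 ht, zero_smul]

/-- Integration against `cellFun` is integration over the reference cell. -/
lemma integral_cellFun {h : ℝ} (hh : 0 < h) (n j : ℕ) (g : ℝ → X) :
    ∫ t in Ioi (0 : ℝ), cellFun h n j t • g t
      = h • ∫ τ in (0 : ℝ)..1, legL j τ • g (h * (n + τ)) := by
  have hn0 : (0 : ℝ) ≤ n := n.cast_nonneg
  have e1 : (fun t => cellFun h n j t • g t)
      = (Ioc ((n : ℝ) * h) (((n : ℝ) + 1) * h)).indicator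
        fun t => legL j (t / h - n) • g t := by
    funext t
    by_cases ht : t ∈ Ioc ((n : ℝ) * h) (((n : ℝ) + 1) * h)
    · rw [cellFun_of_mem ht, indicator_of_mem ht]
    · rw [cellFun, if_neg ht, zero_smul, indicator_of_notMem ht]
  have hsub : Ioi (0 : ℝ) ∩ Ioc ((n : ℝ) * h) (((n : ℝ) + 1) * h)
      = Ioc ((n : ℝ) * h) (((n : ℝ) + 1) * h) :=
    inter_eq_right.2 fun t ht => lt_of_le_of_lt (by positivity) ht.1
  rw [e1, MeasureTheory.setIntegral_indicator measurableSet_Ioc, hsub,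
    ← intervalIntegral.integral_of_le (by nlinarith)]
  have e2 : ∀ τ : ℝ, legL j τ • g (h * (n + τ))
      = (fun t => legL j (t / h - n) • g t) (h * τ + h * n) := by
    intro τ
    simp only
    congr 2
    · field_simp; ring
    · ring
  rw [intervalIntegral.integral_congr fun τ _ => e2 τ,
    intervalIntegral.integral_comp_mul_add (fun t => legL j (t / h - n) • g t) hh.ne',
    smul_smul, mul_inv_cancel₀ hh.ne', one_smul]
  congr 1 <;> ring

lemma eventually_cell {h : ℝ} (hh : 0 < h) (n : ℕ) :
    ∀ᶠ t in 𝓝[>] ((n : ℝ) * h), t ∈ Ioc ((n : ℝ) * h) (((n : ℝ) + 1) * h) :=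
  Ioc_mem_nhdsGT (by nlinarith)

lemma limRight_cellFun {h : ℝ} (hh : 0 < h) (m n j : ℕ) (x : X) :
    limRight (fun t => cellFun h n j t • x) ((m : ℝ) * h)
      = if m = n then (-1 : ℝ) ^ j • x else 0 := by
  refine Filter.Tendsto.limUnder_eq ?_
  split_ifs with hmn
  · subst hmn
    have h1 : Continuous fun t : ℝ => legL j (t / h - m) • x :=
      (((continuous_legL j).comp ((continuous_id.div_const h).sub continuous_const))).smul
        continuous_const
    have h2 := (h1.tendsto ((m : ℝ) * h)).mono_left
      (nhdsWithin_le_nhds (s := Ioi ((m : ℝ) * h)))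
    rw [mul_div_cancel_right₀ _ hh.ne', sub_self, legL_at_zero] at h2
    refine h2.congr' ?_
    filter_upwards [eventually_cell hh m] with t ht
    rw [cellFun_of_mem ht]
  · refine tendsto_const_nhds.congr' ?_
    filter_upwards [eventually_cell hh m] with t ht
    rw [cellFun_of_ne hh hmn ht, zero_smul]

variable {h : ℝ} {m : ℕ} {w : ℝ → X} {U : ℕ → ℝ → X}

lemma eq_cell (hh : 0 < h)
    (hU : ∀ n, IsPoly m (U n) ∧ ∀ τ ∈ Ioc (0 : ℝ) 1, w (h * (n + τ)) = U n τ)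
    {n : ℕ} {t : ℝ} (ht : t ∈ Ioc ((n : ℝ) * h) (((n : ℝ) + 1) * h)) :
    w t = U n (t / h - n) := by
  rw [← (hU n).2]
  · congr 1; field_simp; ring
  · constructor
    · rw [sub_pos, lt_div_iff₀ hh]; exact ht.1
    · rw [sub_le_iff_le_add, div_le_iff₀ hh, add_comm]; exact ht.2

lemma timeJump_cell (hh : 0 < h)
    (hU : ∀ n, IsPoly m (U n) ∧ ∀ τ ∈ Ioc (0 : ℝ) 1, w (h * (n + τ)) = U n τ) (n : ℕ) :
    timeJump h w n = U n 0 - if n = 0 then 0 else U (n - 1) 1 := by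
  have h1 : limRight w ((n : ℝ) * h) = U n 0 := by
    refine Filter.Tendsto.limUnder_eq ?_
    have h1 : Continuous fun t : ℝ => U n (t / h - n) :=
      (hU n).1.continuous.comp ((continuous_id.div_const h).sub continuous_const)
    have h2 := (h1.tendsto ((n : ℝ) * h)).mono_left
      (nhdsWithin_le_nhds (s := Ioi ((n : ℝ) * h)))
    rw [mul_div_cancel_right₀ _ hh.ne', sub_self] at h2
    refine h2.congr' ?_
    filter_upwards [eventually_cell hh n] with t ht
    rw [eq_cell hh hU ht]
  rw [timeJump, h1]
  congr 1
  split_ifs with hn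
  · rfl
  · have h2 := (hU (n - 1)).2 1 (by simp)
    rw [← h2]
    congr 1
    have : ((n - 1 : ℕ) : ℝ) = n - 1 := by
      rw [Nat.cast_sub (by omega), Nat.cast_one]
    rw [this]; ring

lemma deriv_cell (hh : 0 < h)
    (hU : ∀ n, IsPoly m (U n) ∧ ∀ τ ∈ Ioc (0 : ℝ) 1, w (h * (n + τ)) = U n τ) {n : ℕ}
    {U' : ℝ → X} (hd : ∀ t, HasDerivAt (U n) (U' t) t) {τ : ℝ} (hτ : τ ∈ Ioo (0 : ℝ) 1) :
    deriv w (h * (n + τ)) = h⁻¹ • U' τ := by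
  have h1 : HasDerivAt (fun t : ℝ => t / h - n) h⁻¹ (h * (n + τ)) := by
    simpa [one_div] using ((hasDerivAt_id (h * (n + τ))).div_const h).sub_const (n : ℝ)
  have e : h * (n + τ) / h - n = τ := by field_simp; ring
  have h2 : HasDerivAt (fun t => U n (t / h - n)) (h⁻¹ • U' τ) (h * (n + τ)) := by
    have h3 : HasDerivAt (U n) (U' τ) (h * (n + τ) / h - n) := by rw [e]; exact hd τ
    exact h3.scomp (h * (n + τ)) h1
  refine (h2.congr_of_eventuallyEq ?_).deriv
  have h4 : Ioo ((n : ℝ) * h) (((n : ℝ) + 1) * h) ∈ 𝓝 (h * (n + τ)) :=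
    Ioo_mem_nhds (by nlinarith [hτ.1]) (by nlinarith [hτ.2])
  filter_upwards [h4] with t ht
  exact eq_cell hh hU ⟨ht.1, ht.2.le⟩

end Cells

/-- A real scalar action on a space over `𝕜` which makes it a normed space is the restriction of
the action of `𝕜`. -/
lemma isScalarTower_real (𝕜 X : Type*) [RCLike 𝕜] [NormedAddCommGroup X] [NormedSpace 𝕜 X]
    [NormedSpace ℝ X] : IsScalarTower ℝ 𝕜 X where
  smul_assoc r a x := by
    let f : 𝕜 →+ X := (AddMonoidHom.mk' (fun a => a • x) fun a b => add_smul a b x)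
    exact map_real_smul f (continuous_id.smul continuous_const) r a

lemma inner_real_smul_left {𝕜 X : Type*} [RCLike 𝕜] [NormedAddCommGroup X]
    [InnerProductSpace 𝕜 X] [NormedSpace ℝ X] (r : ℝ) (x y : X) :
    inner 𝕜 (r • x) y = r • inner 𝕜 x y := by
  have := isScalarTower_real 𝕜 X
  rw [RCLike.real_smul_eq_coe_smul (K := 𝕜), inner_smul_left, RCLike.conj_ofReal,
    RCLike.real_smul_eq_coe_mul]

lemma inner_real_smul_right {𝕜 X : Type*} [RCLike 𝕜] [NormedAddCommGroup X]
    [InnerProductSpace 𝕜 X] [NormedSpace ℝ X] (r : ℝ) (x y : X) :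
    inner 𝕜 x (r • y) = r • inner 𝕜 x y := by
  have := isScalarTower_real 𝕜 X
  rw [RCLike.real_smul_eq_coe_smul (K := 𝕜), inner_smul_right, RCLike.real_smul_eq_coe_mul]

end DGWave

/-! ### The error equation on the cells -/

namespace DGWave

set_option linter.unusedSectionVars false

lemma legD_reflect (n : ℕ) (t : ℝ) : legD n (1 - t) = -((-1) ^ n * legD n t) := by
  have h1 : HasDerivAt (fun t : ℝ => legL n (1 - t)) (-legD n (1 - t)) t :=
    (hasDerivAt_legL n (1 - t)).comp_const_sub 1 t
  have h2 : HasDerivAt (fun t : ℝ => legL n (1 - t)) ((-1) ^ n * legD n t) t := by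
    simp only [legL_symm]
    exact (hasDerivAt_legL n t).const_mul _
  linarith [h1.unique h2]

lemma legD_eq_ker (p : ℕ) (t : ℝ) : legD p t = kerR p t - (-1) ^ p * kerL p t := by
  have h1 := kerR_eq_legD p t
  have h2 := kerR_eq_legD p (1 - t)
  rw [← kerL_eq, legD_reflect, legD_reflect, pow_succ] at h2
  have h3 : ((-1 : ℝ) ^ p) ^ 2 = 1 := by rw [← pow_mul, mul_comm, pow_mul]; simp
  linear_combination (-1 / 2 : ℝ) * h1 + (-1 : ℝ) ^ p / 2 * h2
    + (legD (p + 1) t - legD p t) / 2 * h3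

/-- A polynomial all of whose values lie in the kernel of a bounded operator is a polynomial with
values in that kernel. -/
lemma IsPoly.lift_ker {V M : Type*} [NormedAddCommGroup V] [NormedSpace ℝ V] [CompleteSpace V]
    [NormedAddCommGroup M] [NormedSpace ℝ M] [CompleteSpace M] {B : V →L[ℝ] M} {m : ℕ}
    {f : ℝ → V} (hf : IsPoly m f) (h : ∀ t, B (f t) = 0) :
    ∃ g : ℝ → LinearMap.ker (B : V →ₗ[ℝ] M), IsPoly m g ∧ ∀ t, (g t : V) = f t := by
  have hker : ∀ j, legC j f ∈ LinearMap.ker (B : V →ₗ[ℝ] M) := by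
    intro j
    have h1 := legC_clm j hf.continuous.continuousOn B
    simp only [h] at h1
    rw [LinearMap.mem_ker, ContinuousLinearMap.coe_coe, ← h1]
    simp [legC]
  refine ⟨fun t => ∑ j ∈ Finset.range m, legL j t • (2 * (j : ℝ) + 1) • ⟨legC j f, hker j⟩,
    ⟨_, fun t => rfl⟩, fun t => ?_⟩
  rw [← hf.legProj_eq t, legProj, Submodule.coe_sum]
  refine Finset.sum_congr rfl fun j _ => ?_
  rw [mul_comm (2 * (j : ℝ) + 1), mul_smul]
  rfl

section ErrorEquation

variable {V H M : Type*} [NormedAddCommGroup V] [NormedSpace ℝ V] [CompleteSpace V]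
  [NormedAddCommGroup H] [NormedSpace ℝ H] [CompleteSpace H]
  [NormedAddCommGroup M] [NormedSpace ℝ M] [CompleteSpace M]

/-- The interpolant of an exact solution solves the discrete equation up to a residual which is a
multiple of the highest Legendre polynomial. -/
lemma hasDerivAt_incl_interp {ι A : V →L[ℝ] H} {h : ℝ} {f f' : ℝ → V} (p : ℕ)
    (hf : ContinuousOn f (Icc 0 1)) (hd : ∀ t ∈ Ioo (0 : ℝ) 1, HasDerivAt f (f' t) t)
    (hf' : ContinuousOn f' (Icc 0 1)) (heq : ∀ t ∈ Icc (0 : ℝ) 1, ι (f' t) = h • A (f t)) (t : ℝ) :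
    HasDerivAt (fun t => ι (interp p f t))
      (h • A (interp p f t) - (h * legL p t) • A (endDefect p f)
        + kerL p t • ι (f 0 - interp p f 0)) t := by
  have h1 := ι.hasFDerivAt.comp_hasDerivAt t (hasDerivAt_interp p hf hd hf' t)
  refine h1.congr_deriv ?_
  have h2 : ι (legProj (p + 1) f' t) = h • A (legProj (p + 1) f t) := by
    rw [← legProj_clm _ hf', ← legProj_clm _ hf]
    simp only [legProj, Finset.smul_sum]
    refine Finset.sum_congr rfl fun j _ => ?_
    rw [smul_comm h]
    congr 1
    rw [legC, legC, ← intervalIntegral.integral_smul]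
    refine intervalIntegral.integral_congr fun τ hτ => ?_
    rw [uIcc_of_le zero_le_one] at hτ
    simp only [heq τ hτ]
    rw [smul_comm]
  have h3 : interp p f t = legProj (p + 1) f t + legL p t • endDefect p f := rfl
  rw [map_add, h2, map_smul, h3, map_add, map_smul, smul_add, smul_smul]
  abel

/-- Discrete and exact solutions on the first `N` cells, in local coordinates. -/
structure CellProblem (ι A : V →L[ℝ] H) (B : V →L[ℝ] M) (h : ℝ) (p N : ℕ) (U : ℕ → ℝ → V)
    (F : ℕ → ℕ → ℝ → V) : Prop where
  poly : ∀ n, IsPoly (p + 1) (U n)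
  discrete : ∀ n < N, ∀ t, HasDerivAt (fun t => ι (U n t)) (h • A (U n t)
    - kerL p t • (ι (U n 0) - if n = 0 then 0 else ι (U (n - 1) 1))) t
  smooth : ∀ n < N, SmoothChain (F n)
  exact : ∀ n < N, ∀ t ∈ Icc (0 : ℝ) 1, ι (F n 1 t) = h • A (F n 0 t)
  initial : 0 < N → F 0 0 0 = 0
  glue : ∀ n, n + 1 < N → F n 0 1 = F (n + 1) 0 0
  trace_one : ∀ n < N, B (U n 1) = B (F n 0 1)
  trace_legC : ∀ n < N, ∀ j < p, legC j (fun t => B (U n t)) = legC j fun t => B (F n 0 t)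

variable {ι A : V →L[ℝ] H} {B : V →L[ℝ] M} {h : ℝ} {p N : ℕ} {U : ℕ → ℝ → V}
  {F : ℕ → ℕ → ℝ → V}

/-- The inclusion restricted to the kernel of the trace operator. -/
noncomputable abbrev onKer (B : V →L[ℝ] M) (L : V →L[ℝ] H) :
    LinearMap.ker (B : V →ₗ[ℝ] M) →L[ℝ] H := L ∘L (LinearMap.ker (B : V →ₗ[ℝ] M)).subtypeL

namespace CellProblem

lemma trace_sub_interp (c : CellProblem ι A B h p N U F) {n : ℕ} (hn : n < N) (t : ℝ) :
    B (U n t - interp p (F n 0) t) = 0 := by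
  have hcont := (c.smooth n hn).cont 0
  have hP := (c.poly n).clm B
  have hI := (isPoly_interp p (F n 0)).clm B
  have key : ∀ j < p, legC j (fun t => B (U n t)) = legC j fun t => B (interp p (F n 0) t) := by
    intro j hj
    rw [c.trace_legC n hn j hj, legC_clm j hcont,
      legC_clm j (isPoly_interp p (F n 0)).continuous.continuousOn, legC_interp hj]
  -- the difference is a multiple of the highest Legendre polynomial and vanishes at `1`
  have hD := hP.sub hI
  have h1 := hD.legProj_eq
  have h2 : ∀ t, B (U n t) - B (interp p (F n 0) t) = ((2 * (p : ℝ) + 1) * legL p t) •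
      legC p (fun t => B (U n t) - B (interp p (F n 0) t)) := by
    intro t
    rw [← h1 t, legProj, Finset.sum_range_succ, Finset.sum_eq_zero, zero_add]
    intro j hj
    rw [legC_sub j hP.continuous.continuousOn hI.continuous.continuousOn,
      key j (Finset.mem_range.1 hj), sub_self, smul_zero]
  have h3 := h2 1
  rw [interp_one, c.trace_one n hn, sub_self, legL_at_one, mul_one] at h3
  rw [map_sub, h2, mul_comm, mul_smul, ← h3, smul_zero]

end CellProblem

end ErrorEquation

namespace CellProblem

variable {V H M : Type*} [NormedAddCommGroup V] [NormedSpace ℝ V] [CompleteSpace V]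
  [NormedAddCommGroup H] [InnerProductSpace ℝ H] [CompleteSpace H]
  [NormedAddCommGroup M] [NormedSpace ℝ M] [CompleteSpace M]
  {ι A : V →L[ℝ] H} {B : V →L[ℝ] M} {h : ℝ} {p N : ℕ} {U : ℕ → ℝ → V}
  {F : ℕ → ℕ → ℝ → V}

lemma exists_correction (c : CellProblem ι A B h p N U F)
    (g : SkewGenerator (onKer B ι) (onKer B A)) (n : ℕ) :
    ∃ (η : ℝ → LinearMap.ker (B : V →ₗ[ℝ] M)) (z : LinearMap.ker (B : V →ₗ[ℝ] M)), n < N →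
      IsPoly (p + 1) η ∧ onKer B A z - onKer B ι z = -A (endDefect p (F n 0)) ∧
      ∀ t, U n t - interp p (F n 0) t = η t + legL p t • (z : V) := by
  by_cases hn : n < N
  · obtain ⟨θ, hθ, hθ'⟩ := ((c.poly n).sub (isPoly_interp p (F n 0))).lift_ker
      (c.trace_sub_interp hn)
    obtain ⟨z, hz⟩ := g.surj 1 one_pos (-A (endDefect p (F n 0)))
    rw [one_smul] at hz
    refine ⟨fun t => θ t - legL p t • z, z, fun _ =>
      ⟨hθ.sub (isPoly_legL_smul (Nat.lt_succ_self p) z), hz, fun t => ?_⟩⟩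
    rw [← hθ' t]
    simp
  · exact ⟨0, 0, fun h => absurd h hn⟩

variable {η : ℕ → ℝ → LinearMap.ker (B : V →ₗ[ℝ] M)} {z : ℕ → LinearMap.ker (B : V →ₗ[ℝ] M)}

lemma cellEq (c : CellProblem ι A B h p N U F) (g : SkewGenerator (onKer B ι) (onKer B A))
    (hηz : ∀ n < N, IsPoly (p + 1) (η n) ∧
      onKer B A (z n) - onKer B ι (z n) = -A (endDefect p (F n 0)) ∧
      ∀ t, U n t - interp p (F n 0) t = η n t + legL p t • (z n : V)) {n : ℕ} (hn : n < N) :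
    CellEq (onKer B ι) (onKer B A) h p (η n)
      (if n = 0 then 0 else onKer B ι (η (n - 1) 1))
      (onKer B ι (if n = 0 then 0 else z (n - 1))) (onKer B ι (z n)) where
  poly := (hηz n hn).1
  skew := g.skew
  eq t := by
    obtain ⟨-, hz, hU⟩ := hηz n hn
    have hw := hasDerivAt_incl_interp (ι := ι) (A := A) (h := h) p ((c.smooth n hn).cont 0)
      ((c.smooth n hn).deriv 0) ((c.smooth n hn).cont 1) (c.exact n hn) t
    have hu := c.discrete n hn t
    have hL : HasDerivAt (fun t => legL p t • ι (z n : V)) (legD p t • ι (z n : V)) t :=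
      (hasDerivAt_legL p t).smul_const _
    have hfun : (fun t => onKer B ι (η n t))
        = fun t => ι (U n t) - ι (interp p (F n 0) t) - legL p t • ι (z n : V) := by
      funext t
      rw [← map_sub, hU t]
      simp
    rw [hfun]
    refine ((hu.sub hw).sub hL).congr_deriv ?_
    -- the value handed over from the previous cell
    have hprev : (ι (F n 0 0) : H) - (if n = 0 then 0 else ι (U (n - 1) 1))
        = -((if n = 0 then 0 else onKer B ι (η (n - 1) 1))
          + onKer B ι (if n = 0 then 0 else z (n - 1))) := by
      rcases n with _ | n
      · simp [c.initial hn]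
      · have h1 := (hηz n (by omega)).2.2 1
        rw [interp_one, legL_at_one, one_smul, c.glue n hn] at h1
        have h2 := congrArg ι h1
        rw [map_sub, map_add] at h2
        simp only [Nat.add_eq_zero_iff, one_ne_zero, and_false, if_false, Nat.add_sub_cancel]
        rw [ContinuousLinearMap.comp_apply, ContinuousLinearMap.comp_apply,
          Submodule.subtypeL_apply, Submodule.subtypeL_apply, ← h2]
        abel
    have hA : A (U n t) - A (interp p (F n 0) t) = A (η n t : V) + legL p t • A (z n : V) := by
      rw [← map_sub, hU t, map_add, map_smul]
    have h0 : ι (U n 0) - ι (interp p (F n 0) 0)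
        = ι (η n 0 : V) + (-1 : ℝ) ^ p • ι (z n : V) := by
      rw [← map_sub, hU 0, map_add, map_smul, legL_at_zero]
    have hz' : A (endDefect p (F n 0)) = ι (z n : V) - A (z n : V) := by
      have hz1 : A (z n : V) - ι (z n : V) = -A (endDefect p (F n 0)) := hz
      rw [← neg_sub, hz1, neg_neg]
    simp only [ContinuousLinearMap.comp_apply, Submodule.subtypeL_apply] at hprev ⊢
    generalize (if n = 0 then (0 : H) else ι (η (n - 1) 1 : V)) = e at hprev ⊢
    generalize ι ((if n = 0 then 0 else z (n - 1) : LinearMap.ker (B : V →ₗ[ℝ] M)) : V) = zm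
      at hprev ⊢
    generalize (if n = 0 then (0 : H) else ι (U (n - 1) 1)) = um at hprev ⊢
    have e1 : h • A (U n t) = h • A (interp p (F n 0) t)
        + h • (A (η n t : V) + legL p t • A (z n : V)) := by
      rw [← hA, smul_sub]; abel
    have e2 : um = ι (F n 0 0) + (e + zm) := by
      rw [← sub_eq_iff_eq_add', ← neg_sub, hprev]; abel
    have e3 : ι (U n 0) = ι (interp p (F n 0) 0)
        + (ι (η n 0 : V) + (-1 : ℝ) ^ p • ι (z n : V)) := by
      rw [← h0]; abel
    rw [e1, e2, e3, hz', legD_eq_ker, map_sub]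
    module

/-- The discretisation error on all cells, in terms of bounds for two consecutive derivatives of the
exact solution. -/
theorem exists_norm_sub_le (g : SkewGenerator (onKer B ι) (onKer B A)) :
    ∃ C : ℝ, 0 < C ∧ ∀ {h : ℝ} {p N : ℕ} {U : ℕ → ℝ → V} {F : ℕ → ℕ → ℝ → V}, 0 < h →
      CellProblem ι A B h p N U F → ∀ {s : ℕ} {b b' : ℝ}, s ≤ p + 1 → 0 < b → 0 ≤ b' →
      (∀ n < N, ∀ t ∈ Icc (0 : ℝ) 1, ‖F n s t‖ ≤ b) →
      (∀ n < N, ∀ t ∈ Icc (0 : ℝ) 1, ‖F n (s + 1) t‖ ≤ b') →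
      ∀ n < N, ∀ t ∈ Icc (0 : ℝ) 1, ‖F n 0 t - U n t‖
        ≤ C * (((p + 1 - s).factorial : ℝ) / (p + 1).factorial * (b' + N * (h + (p + 1)) * b)) := by
  obtain ⟨C₀, hC₀, hC⟩ := g.exists_bound
  set a := 45 * ‖A‖ + 1 with ha
  have ha0 : 0 < a := by positivity
  refine ⟨3961 + C₀ * ((10 ^ 77 + 1) * a), by positivity, ?_⟩
  intro h p N U F hh c s b b' hs hb hb' hF hF' n hn t ht
  set β := ((p + 1 - s).factorial : ℝ) / (p + 1).factorial with hβ
  have hβ0 : 0 < β := by positivity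
  choose η z hηz using c.exists_correction g
  have hp : (0 : ℝ) ≤ p := p.cast_nonneg
  have hsq : 1 ≤ √((p : ℝ) + 1) := Real.one_le_sqrt.2 (by linarith)
  have hsq' : √((p : ℝ) + 1) ≤ p + 1 := by
    nlinarith [Real.sq_sqrt (by linarith : (0 : ℝ) ≤ (p : ℝ) + 1)]
  have hz : ∀ n < N, ‖onKer B A (z n) - onKer B ι (z n)‖ ≤ √((p : ℝ) + 1) * (a * (β * b)) := by
    intro n hn
    rw [(hηz n hn).2.1, norm_neg]
    refine (A.le_opNorm _).trans ?_
    refine (mul_le_mul_of_nonneg_left (norm_endDefect_le (c.smooth n hn) hs hb.le (hF n hn))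
      (norm_nonneg _)).trans ?_
    rw [← hβ, ha]
    have : 0 ≤ √((p : ℝ) + 1) * (β * b) := by positivity
    linarith
  have hη := g.norm_graph_le hh.le (p := p) (N := N) (η := η)
    (e := fun n => if n = 0 then 0 else onKer B ι (η (n - 1) 1))
    (zm := fun n => if n = 0 then 0 else z (n - 1)) (z := z) (by simp) (by simp) (by simp) (by simp)
    (fun n hn => c.cellEq g hηz hn) (ε := a * (β * b)) (by positivity) hz hn ht
  have hN : (1 : ℝ) ≤ N := by exact_mod_cast (by omega : 1 ≤ N)
  have hK : (p : ℝ) + 1 ≤ N * (h + (p + 1)) := by nlinarith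
  set K := (N : ℝ) * (h + (p + 1)) with hKd
  have h1 : ‖U n t - interp p (F n 0) t‖ ≤ C₀ * ((10 ^ 77 + 1) * a) * (β * (K * b)) := by
    rw [(hηz n hn).2.2 t]
    have h2 := (hC (η n t)).trans (mul_le_mul_of_nonneg_left hη hC₀.le)
    have h3 := (hC (z n)).trans (mul_le_mul_of_nonneg_left (hz n hn) hC₀.le)
    have h4 : ‖legL p t • (z n : V)‖ ≤ ‖z n‖ := by
      rw [norm_smul, Real.norm_eq_abs]
      exact mul_le_of_le_one_left (norm_nonneg _) (abs_legL_le_one p ht)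
    have h5 : C₀ * (√((p : ℝ) + 1) * (a * (β * b))) ≤ C₀ * (K * (a * (β * b))) := by
      have := hsq'.trans hK
      gcongr
    have h6 : ‖(η n t : V)‖ = ‖η n t‖ := rfl
    refine (norm_add_le _ _).trans ((add_le_add (h6.le.trans h2) (h4.trans (h3.trans h5))).trans ?_)
    rw [mul_assoc (a * (β * b)), ← hKd]
    exact le_of_eq (by ring)
  have h7 := norm_sub_interp_le (c.smooth n hn) hs hb.le (hF n hn) hb' (hF' n hn) ht
  rw [← hβ] at h7
  have h8 : ‖F n 0 t - U n t‖
      ≤ ‖F n 0 t - interp p (F n 0) t‖ + ‖U n t - interp p (F n 0) t‖ := by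
    rw [norm_sub_rev (U n t)]
    exact norm_sub_le_norm_sub_add_norm_sub _ _ _
  refine (h8.trans (add_le_add h7 h1)).trans ?_
  have h9 : b' + 3960 * ((p : ℝ) + 1) * b ≤ 3961 * (b' + K * b) := by
    have := mul_le_mul_of_nonneg_right hK hb.le
    have : 0 ≤ K * b := by positivity
    linarith
  have h10 := mul_le_mul_of_nonneg_left h9 hβ0.le
  have h11 : C₀ * ((10 ^ 77 + 1) * a) * (β * (K * b))
      ≤ C₀ * ((10 ^ 77 + 1) * a) * (β * (b' + K * b)) := by
    gcongr
    linarith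
  refine (add_le_add h10 h11).trans_eq ?_
  ring

end CellProblem

end DGWave

/-! ### The discontinuous Galerkin method in local coordinates -/

namespace DGWave

section Projection

variable {X : Type*} [NormedAddCommGroup X] [NormedSpace ℝ X] {h : ℝ} {p m : ℕ} {ξ w : ℝ → X}
  {U : ℕ → ℝ → X}

lemma projection_node (hw : IsDGProjection h p ξ w)
    (hU : ∀ n, IsPoly m (U n) ∧ ∀ τ ∈ Ioc (0 : ℝ) 1, w (h * (n + τ)) = U n τ) (n : ℕ) :
    U n 1 = ξ (h * (n + 1)) := by
  rw [← (hU n).2 1 (by simp)]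
  have := hw.interpolation (n + 1) (by omega)
  push_cast at this
  rwa [mul_comm] at this

lemma projection_legC (hh : 0 < h) (hw : IsDGProjection h p ξ w)
    (hU : ∀ n, IsPoly m (U n) ∧ ∀ τ ∈ Ioc (0 : ℝ) 1, w (h * (n + τ)) = U n τ) (n : ℕ) {j : ℕ}
    (hj : j < p) : legC j (U n) = legC j fun τ => ξ (h * (n + τ)) := by
  have h1 := hw.orthogonality (cellFun h n j)
    (by simpa using isPiecewisePoly_cellFun hh n hj (1 : ℝ))
    (by simpa using hasBoundedTimeSupport_cellFun h n j (1 : ℝ))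
  rw [integral_cellFun hh, integral_cellFun hh] at h1
  have h2 := smul_right_injective X hh.ne' h1
  rw [legC, legC, ← h2, intervalIntegral.integral_of_le zero_le_one,
    intervalIntegral.integral_of_le zero_le_one]
  refine setIntegral_congr_fun measurableSet_Ioc fun τ hτ => ?_
  simp only [(hU n).2 τ hτ]

end Projection

section Galerkin

variable {𝕜 V H M : Type*} [RCLike 𝕜]
  [NormedAddCommGroup V] [InnerProductSpace 𝕜 V] [NormedSpace ℝ V]
  [NormedAddCommGroup H] [InnerProductSpace 𝕜 H] [NormedSpace ℝ H]
  [NormedAddCommGroup M] [InnerProductSpace 𝕜 M] [NormedSpace ℝ M]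

/-- A bounded operator over `𝕜`, regarded as a real bounded operator for given real structures. -/
noncomputable def realCLM (L : V →L[𝕜] H) : V →L[ℝ] H :=
  have := isScalarTower_real 𝕜 V
  have := isScalarTower_real 𝕜 H
  L.restrictScalars ℝ

@[simp] lemma realCLM_apply (L : V →L[𝕜] H) (v : V) : realCLM L v = L v := rfl

variable {P : WaveSystem 𝕜 V H M} {h : ℝ} {p : ℕ} {ξ : ℝ → M} {uh : ℝ → V} {U : ℕ → ℝ → V}

/-- Testing with Legendre polynomials on a single cell. -/
lemma galerkin_cell [CompleteSpace H] (hh : 0 < h) (d : P.IsDGSolution h p ξ uh)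
    (hU : ∀ n, IsPoly (p + 1) (U n) ∧ ∀ τ ∈ Ioc (0 : ℝ) 1, uh (h * (n + τ)) = U n τ) (n : ℕ)
    {w' : ℝ → H} (hw' : Continuous w')
    (hd : ∀ t, HasDerivAt (fun t => P.incl (U n t)) (w' t) t) {j : ℕ} (hj : j < p + 1) :
    h • legC j (fun τ => h⁻¹ • w' τ - P.Astar (U n τ)) + (-1 : ℝ) ^ j •
      (P.incl (U n 0) - if n = 0 then 0 else P.incl (U (n - 1) 1)) = 0 := by
  have hUi : ∀ n, IsPoly (p + 1) (fun t => P.incl (U n t)) ∧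
      ∀ τ ∈ Ioc (0 : ℝ) 1, P.incl (uh (h * (n + τ))) = P.incl (U n τ) := fun n =>
    ⟨(hU n).1.clm (realCLM P.incl), fun τ hτ => by rw [(hU n).2 τ hτ]⟩
  set J := P.incl (U n 0) - if n = 0 then 0 else P.incl (U (n - 1) 1) with hJ
  refine ext_inner_left 𝕜 fun x => ?_
  have key := d.galerkin (fun t => cellFun h n j t • x) (isPiecewisePoly_cellFun hh n hj x)
    (hasBoundedTimeSupport_cellFun h n j x)
  have e1 : ∑' m : ℕ, inner 𝕜 (limRight (fun t => cellFun h n j t • x) ((m : ℝ) * h))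
      (timeJump h (fun s => P.incl (uh s)) m) = (-1 : ℝ) ^ j • inner 𝕜 x J := by
    rw [tsum_eq_single n, limRight_cellFun hh, if_pos rfl, inner_real_smul_left,
      timeJump_cell hh hUi]
    intro m hm
    rw [limRight_cellFun hh, if_neg hm, inner_zero_left]
  have hcont : Continuous fun τ => h⁻¹ • w' τ - P.Astar (U n τ) :=
    (continuous_const.smul hw').sub (P.Astar.continuous.comp (hU n).1.continuous)
  have e2 : ∫ t in Ioi (0 : ℝ), inner 𝕜 (cellFun h n j t • x)
      (deriv (fun s => P.incl (uh s)) t - P.Astar (uh t))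
      = h • inner 𝕜 x (legC j fun τ => h⁻¹ • w' τ - P.Astar (U n τ)) := by
    simp_rw [inner_real_smul_left]
    rw [integral_cellFun hh n j fun t => inner 𝕜 x
      (deriv (fun s => P.incl (uh s)) t - P.Astar (uh t))]
    congr 1
    rw [legC, intervalIntegral.integral_of_le zero_le_one,
      intervalIntegral.integral_of_le zero_le_one, integral_Ioc_eq_integral_Ioo,
      integral_Ioc_eq_integral_Ioo,
      ← integral_inner]
    · refine setIntegral_congr_fun measurableSet_Ioo fun τ hτ => ?_
      rw [deriv_cell hh hUi hd hτ, (hU n).2 τ ⟨hτ.1, hτ.2.le⟩, inner_real_smul_right]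
    · exact ((((continuous_legL j).smul hcont).integrableOn_Icc (a := (0 : ℝ)) (b := 1))).mono_set
        Ioo_subset_Icc_self
  rw [e1, e2] at key
  rw [inner_add_right, inner_real_smul_right, inner_real_smul_right, inner_zero_right]
  exact key

/-- The discrete evolution equation in strong form: the jump at the left end point acts through
the reproducing kernel `kerL`. -/
lemma hasDerivAt_cell [CompleteSpace H] (hh : 0 < h) (d : P.IsDGSolution h p ξ uh)
    (hU : ∀ n, IsPoly (p + 1) (U n) ∧ ∀ τ ∈ Ioc (0 : ℝ) 1, uh (h * (n + τ)) = U n τ) (n : ℕ)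
    (t : ℝ) : HasDerivAt (fun t => P.incl (U n t)) (h • P.Astar (U n t)
      - kerL p t • (P.incl (U n 0) - if n = 0 then 0 else P.incl (U (n - 1) 1))) t := by
  set J := P.incl (U n 0) - if n = 0 then 0 else P.incl (U (n - 1) 1) with hJ
  obtain ⟨w', hw', hd⟩ := ((hU n).1.clm (realCLM P.incl)).exists_deriv
  have hA : IsPoly (p + 1) fun t => P.Astar (U n t) := (hU n).1.clm (realCLM P.Astar)
  refine (hd t).congr_deriv ?_
  refine IsPoly.eq_of_legC (hw'.mono (Nat.le_succ p))
    ((hA.const_smul h).sub (isPoly_kerL_smul p J)) (fun j hj => ?_) t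
  have h1 := galerkin_cell hh d hU n hw'.continuous hd hj
  have c1 : ContinuousOn w' (Icc 0 1) := hw'.continuous.continuousOn
  have c2 : ContinuousOn (fun t => P.Astar (U n t)) (Icc 0 1) := hA.continuous.continuousOn
  rw [legC_sub j (f := fun τ => h⁻¹ • w' τ) (c1.const_smul h⁻¹) c2, legC_const_smul, smul_sub,
    smul_smul,
    mul_inv_cancel₀ hh.ne', one_smul, ← hJ] at h1
  rw [legC_sub j (f := fun t => h • P.Astar (U n t)) (c2.const_smul h)
      (isPoly_kerL_smul p J).continuous.continuousOn,
    legC_const_smul, legC_kerL_smul (by omega), eq_sub_iff_add_eq, ← sub_eq_zero, ← h1]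
  abel

end Galerkin

end DGWave

/-! ### The exact solution in local coordinates -/

namespace DGWave

set_option linter.unusedSectionVars false

section Extension

variable {E : Type*} [NormedAddCommGroup E] [NormedSpace ℝ E] [CompleteSpace E] {T : ℝ}

/-- A function with bounded derivative on an open interval extends continuously to the closure. -/
lemma continuousOn_extendFrom_of_norm_deriv_le (hT : 0 < T) {f f' : ℝ → E} {b : ℝ} (hb : 0 ≤ b)
    (hf : ∀ t ∈ Ioo 0 T, HasDerivAt f (f' t) t) (hf' : ∀ t ∈ Ioo 0 T, ‖f' t‖ ≤ b) :
    ContinuousOn (extendFrom (Ioo 0 T) f) (Icc 0 T) := by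
  have hL : LipschitzOnWith ⟨b, hb⟩ f (Ioo 0 T) :=
    (convex_Ioo 0 T).lipschitzOnWith_of_nnnorm_hasDerivWithin_le
      (fun t ht => (hf t ht).hasDerivWithinAt) fun t ht => hf' t ht
  have hlim : ∀ a ∈ Icc 0 T, ∃ y, Tendsto f (𝓝[Ioo 0 T] a) (𝓝 y) := by
    intro a ha
    have : (𝓝[Ioo 0 T] a).NeBot := by
      rw [← mem_closure_iff_nhdsWithin_neBot, closure_Ioo hT.ne]
      exact ha
    have hc : Cauchy (𝓝[Ioo 0 T] a) := cauchy_nhds.mono nhdsWithin_le_nhds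
    exact CompleteSpace.complete (hc.map_of_le hL.uniformContinuousOn
      (le_principal_iff.2 self_mem_nhdsWithin))
  obtain ⟨y, hy⟩ := hlim 0 (left_mem_Icc.2 hT.le)
  obtain ⟨z, hz⟩ := hlim T (right_mem_Icc.2 hT.le)
  rw [nhdsWithin_Ioo_eq_nhdsGT hT] at hy
  rw [nhdsWithin_Ioo_eq_nhdsLT hT] at hz
  exact continuousOn_Icc_extendFrom_Ioo hL.continuousOn hy hz

lemma hasDerivAt_iteratedDeriv {u : ℝ → E}
    (hu : ContDiffOn ℝ ((⊤ : ℕ∞) : WithTop ℕ∞) u (Ioo 0 T)) (l : ℕ) {t : ℝ} (ht : t ∈ Ioo 0 T) :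
    HasDerivAt (iteratedDeriv l u) (iteratedDeriv (l + 1) u t) t := by
  have h1 : DifferentiableAt ℝ (iteratedDerivWithin l u (Ioo 0 T)) t :=
    ((hu.differentiableOn_iteratedDerivWithin (m := l) (by exact_mod_cast WithTop.coe_lt_top l)
      isOpen_Ioo.uniqueDiffOn) t ht).differentiableAt (isOpen_Ioo.mem_nhds ht)
  have h2 : iteratedDerivWithin l u (Ioo 0 T) =ᶠ[𝓝 t] iteratedDeriv l u := by
    filter_upwards [isOpen_Ioo.mem_nhds ht] with x hx
      using iteratedDerivWithin_of_isOpen isOpen_Ioo hx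
  rw [iteratedDeriv_succ]
  exact (h1.congr_of_eventuallyEq h2.symm).hasDerivAt

/-- The derivatives of a smooth function whose derivatives are bounded extend to the closed
interval, with the same bounds. -/
lemma exists_extension (hT : 0 < T) {u : ℝ → E}
    (hu : ContDiffOn ℝ ((⊤ : ℕ∞) : WithTop ℕ∞) u (Ioo 0 T)) {b : ℕ → ℝ}
    (hb : ∀ l, ∀ t ∈ Ioo 0 T, ‖iteratedDeriv l u t‖ ≤ b l) :
    ∃ G : ℕ → ℝ → E, (∀ l, ContinuousOn (G l) (Icc 0 T)) ∧
      (∀ l, ∀ t ∈ Ioo 0 T, G l t = iteratedDeriv l u t) ∧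
      (∀ l, ∀ t ∈ Ioo 0 T, HasDerivAt (G l) (G (l + 1) t) t) ∧
      ∀ l, ∀ t ∈ Icc 0 T, ‖G l t‖ ≤ b l := by
  have hb0 : ∀ l, 0 ≤ b l := fun l =>
    (norm_nonneg _).trans (hb l (T / 2) ⟨by linarith, by linarith⟩)
  have hd := fun l t ht => hasDerivAt_iteratedDeriv hu l (t := t) ht
  have hcont := fun l => continuousOn_extendFrom_of_norm_deriv_le hT (hb0 (l + 1)) (hd l)
    (hb (l + 1))
  have heq : ∀ l, ∀ t ∈ Ioo 0 T, extendFrom (Ioo 0 T) (iteratedDeriv l u) t = iteratedDeriv l u t :=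
    fun l => extendFrom_extends fun t ht => (hd l t ht).continuousAt.continuousWithinAt
  refine ⟨fun l => extendFrom (Ioo 0 T) (iteratedDeriv l u), hcont, heq, fun l t ht => ?_,
    fun l t ht => ?_⟩
  · beta_reduce
    rw [heq (l + 1) t ht]
    refine (hd l t ht).congr_of_eventuallyEq ?_
    filter_upwards [isOpen_Ioo.mem_nhds ht] with x hx using heq l x hx
  · have h1 : MapsTo (extendFrom (Ioo 0 T) (iteratedDeriv l u)) (Ioo 0 T)
        (Metric.closedBall 0 (b l)) := by
      intro x hx
      rw [mem_closedBall_zero_iff, heq l x hx]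
      exact hb l x hx
    have h2 := h1.closure_of_continuousOn (by rw [closure_Ioo hT.ne]; exact hcont l)
    rw [closure_Ioo hT.ne, Metric.isClosed_closedBall.closure_eq] at h2
    exact mem_closedBall_zero_iff.1 (h2 ht)

lemma smoothChain_cell {G : ℕ → ℝ → E} (hG : ∀ l, ContinuousOn (G l) (Icc 0 T))
    (hG' : ∀ l, ∀ t ∈ Ioo 0 T, HasDerivAt (G l) (G (l + 1) t) t) {h : ℝ} (hh : 0 < h) {n : ℕ}
    (hn : h * (n + 1) ≤ T) : SmoothChain fun l τ => h ^ l • G l (h * (n + τ)) where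
  cont l := by
    refine ContinuousOn.const_smul ?_ _
    refine (hG l).comp (by fun_prop) fun τ hτ => ⟨?_, ?_⟩
    · have := hτ.1; positivity
    · exact (mul_le_mul_of_nonneg_left (by linarith [hτ.2]) hh.le).trans hn
  deriv l τ hτ := by
    have hn0 : (0 : ℝ) ≤ n := n.cast_nonneg
    have h1 : HasDerivAt (fun τ : ℝ => h * (n + τ)) h τ := by
      simpa using ((hasDerivAt_id τ).const_add (n : ℝ)).const_mul h
    have h2 := (hG' l (h * (n + τ)) ⟨mul_pos hh (by linarith [hτ.1]),
      (mul_lt_mul_of_pos_left (by linarith [hτ.2]) hh).trans_le hn⟩).scomp τ h1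
    have h3 := h2.const_smul (h ^ l)
    rw [smul_smul, ← pow_succ] at h3
    exact h3

end Extension

section Exact

variable {𝕜 V H M : Type*} [RCLike 𝕜]
  [NormedAddCommGroup V] [InnerProductSpace 𝕜 V] [CompleteSpace V] [NormedSpace ℝ V]
  [NormedAddCommGroup H] [InnerProductSpace 𝕜 H] [CompleteSpace H] [NormedSpace ℝ H]
  [NormedAddCommGroup M] [InnerProductSpace 𝕜 M] [CompleteSpace M] [NormedSpace ℝ M]
  {P : WaveSystem 𝕜 V H M} {T : ℝ} {ξ : ℝ → M} {u : ℝ → V}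

/-- On the closed interval the exact solution coincides with the continuous extension, which solves
the evolution equation there. -/
lemma exact_extension (hT : 0 < T) (hs : P.IsExactSolution T ξ u) {G : ℕ → ℝ → V}
    (hG : ∀ l, ContinuousOn (G l) (Icc 0 T))
    (hGu : ∀ t ∈ Ioo 0 T, G 0 t = u t)
    (hG' : ∀ l, ∀ t ∈ Ioo 0 T, HasDerivAt (G l) (G (l + 1) t) t) :
    (∀ t ∈ Icc 0 T, G 0 t = u t) ∧ ∀ t ∈ Icc 0 T, P.incl (G 1 t) = P.Astar (G 0 t) := by
  have hcl : Icc 0 T ⊆ closure (Ioo 0 T) := by rw [closure_Ioo hT.ne]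
  constructor
  · have h1 : EqOn (fun t => P.incl (G 0 t)) (fun t => P.incl (u t)) (Ioo 0 T) :=
      fun t ht => congrArg P.incl (hGu t ht)
    have h2 := h1.of_subset_closure (P.incl.continuous.comp_continuousOn (hG 0)) hs.continuousOn
      Ioo_subset_Icc_self hcl
    exact fun t ht => P.incl_injective (h2 ht)
  · have h1 : EqOn (fun t => P.incl (G 1 t)) (fun t => P.Astar (G 0 t)) (Ioo 0 T) := by
      intro t ht
      have h2 := (realCLM P.incl).hasFDerivAt.comp_hasDerivAt t (hG' 0 t ht)
      have h3 : HasDerivAt (fun s => P.incl (G 0 s)) (P.Astar (G 0 t)) t := by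
        rw [hGu t ht]
        refine (hs.evolution t ht).congr_of_eventuallyEq ?_
        filter_upwards [isOpen_Ioo.mem_nhds ht] with x hx
        rw [hGu x hx]
      exact h2.unique h3
    exact h1.of_subset_closure (P.incl.continuous.comp_continuousOn (hG 1))
      (P.Astar.continuous.comp_continuousOn (hG 0)) Ioo_subset_Icc_self hcl

/-- The exact and the discrete solution form a `CellProblem` on all cells before time `T`. -/
lemma exists_cellProblem (hT : 0 < T) (hs : P.IsExactSolution T ξ u)
    (hu : ContDiffOn ℝ ((⊤ : ℕ∞) : WithTop ℕ∞) u (Ioo 0 T)) {b : ℕ → ℝ}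
    (hb : ∀ l, ∀ t ∈ Ioo 0 T, ‖iteratedDeriv l u t‖ ≤ b l) {h : ℝ} (hh : 0 < h) {p : ℕ}
    {uh : ℝ → V} (d : P.IsDGSolution h p ξ uh) {N : ℕ} (hN : h * N ≤ T) :
    ∃ (U : ℕ → ℝ → V) (F : ℕ → ℕ → ℝ → V),
      CellProblem (realCLM P.incl) (realCLM P.Astar) (realCLM P.B) h p N U F ∧
      (∀ n < N, ∀ l, ∀ τ ∈ Icc (0 : ℝ) 1, ‖F n l τ‖ ≤ h ^ l * b l) ∧
      ∀ n < N, ∀ τ ∈ Ioc (0 : ℝ) 1,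
        F n 0 τ = u (h * (n + τ)) ∧ U n τ = uh (h * (n + τ)) := by
  obtain ⟨U, hU⟩ := exists_cell_poly hh d.piecewisePoly
  obtain ⟨G, hG, hGu, hG', hGb⟩ := exists_extension hT hu hb
  obtain ⟨hGu0, hGA⟩ := exact_extension hT hs hG (fun t ht => by simpa using hGu 0 t ht) hG'
  have hcell : ∀ n < N, h * ((n : ℝ) + 1) ≤ T := fun n hn =>
    (mul_le_mul_of_nonneg_left (by exact_mod_cast hn) hh.le).trans hN
  have hmem : ∀ n < N, ∀ τ ∈ Icc (0 : ℝ) 1, h * ((n : ℝ) + τ) ∈ Icc 0 T := fun n hn τ hτ =>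
    ⟨by have := hτ.1; positivity,
      (mul_le_mul_of_nonneg_left (by linarith [hτ.2]) hh.le).trans (hcell n hn)⟩
  have hUB : ∀ n, IsPoly (p + 1) (fun t => P.B (U n t)) ∧
      ∀ τ ∈ Ioc (0 : ℝ) 1, P.B (uh (h * (n + τ))) = P.B (U n τ) := fun n =>
    ⟨(hU n).1.clm (realCLM P.B), fun τ hτ => by rw [(hU n).2 τ hτ]⟩
  have hB : ∀ n < N, ∀ τ ∈ Ioc (0 : ℝ) 1, P.B (G 0 (h * (n + τ))) = ξ (h * (n + τ)) := by
    intro n hn τ hτ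
    have h1 := hmem n hn τ ⟨hτ.1.le, hτ.2⟩
    rw [hGu0 _ h1]
    exact hs.boundary _ ⟨mul_pos hh (by have := hτ.1; positivity), h1.2⟩
  refine ⟨U, fun n l τ => h ^ l • G l (h * (n + τ)), ⟨fun n => (hU n).1,
    fun n _ t => hasDerivAt_cell hh d hU n t, fun n hn => smoothChain_cell hG hG' hh (hcell n hn),
    fun n hn t ht => ?_, fun hN => ?_, fun n hn => ?_, fun n hn => ?_, fun n hn j hj => ?_⟩,
    fun n hn l τ hτ => ?_, fun n hn τ hτ => ⟨?_, ((hU n).2 τ hτ).symm⟩⟩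
  · simp only [map_smul, realCLM_apply, pow_one, pow_zero, one_smul]
    rw [hGA _ (hmem n hn t ht)]
  · simp [hGu0 0 (left_mem_Icc.2 hT.le), hs.initial]
  · simp
  · simp only [realCLM_apply, pow_zero, one_smul]
    rw [projection_node d.boundary hUB n, hB n hn 1 (by simp)]
  · simp only [realCLM_apply, pow_zero, one_smul]
    rw [projection_legC hh d.boundary hUB n hj, legC, legC,
      intervalIntegral.integral_of_le zero_le_one, intervalIntegral.integral_of_le zero_le_one]
    refine setIntegral_congr_fun measurableSet_Ioc fun τ hτ => ?_
    simp only [hB n hn τ hτ]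
  · rw [norm_smul, Real.norm_of_nonneg (by positivity)]
    exact mul_le_mul_of_nonneg_left (hGb l _ (hmem n hn τ hτ)) (by positivity)
  · simp only [pow_zero, one_smul]
    exact hGu0 _ (hmem n hn τ ⟨hτ.1.le, hτ.2⟩)

end Exact

end DGWave

/-! ### Choice of the smoothness index -/

namespace DGWave

lemma add_pow_mul_factorial_le (m s : ℕ) :
    ((m : ℝ) + s) ^ s * m.factorial ≤ Real.exp 1 ^ s * (m + s).factorial := by
  induction s with
  | zero => simp
  | succ s ih =>
    have h1 : ((m : ℝ) + s + 1) ^ s ≤ Real.exp 1 * ((m : ℝ) + s) ^ s := by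
      rcases Nat.eq_zero_or_pos s with rfl | hs
      · simp
      · have hx : (0 : ℝ) < (m : ℝ) + s := by positivity
        have h2 : (m : ℝ) + s + 1 ≤ ((m : ℝ) + s) * Real.exp (1 / ((m : ℝ) + s)) := by
          have := mul_le_mul_of_nonneg_left (Real.add_one_le_exp (1 / ((m : ℝ) + s))) hx.le
          rw [mul_add, mul_one_div_cancel hx.ne'] at this
          linarith
        refine (pow_le_pow_left₀ (by positivity) h2 s).trans ?_
        rw [mul_pow, mul_comm, ← Real.exp_nat_mul]
        refine mul_le_mul_of_nonneg_right (Real.exp_le_exp.2 ?_) (by positivity)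
        rw [mul_one_div, div_le_one hx]
        linarith [m.cast_nonneg (α := ℝ)]
    have h3 : ((m : ℝ) + (s + 1 : ℕ)) ^ (s + 1) * m.factorial
        = ((m : ℝ) + s + 1) * (((m : ℝ) + s + 1) ^ s * m.factorial) := by
      push_cast; ring
    have h4 : Real.exp 1 ^ (s + 1) * ((m + (s + 1)).factorial : ℝ)
        = ((m : ℝ) + s + 1) * (Real.exp 1 * (Real.exp 1 ^ s * (m + s).factorial)) := by
      rw [← add_assoc, Nat.factorial_succ]; push_cast; ring
    rw [h3, h4]
    refine mul_le_mul_of_nonneg_left ?_ (by positivity)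
    calc ((m : ℝ) + s + 1) ^ s * m.factorial
        ≤ Real.exp 1 * ((m : ℝ) + s) ^ s * m.factorial := by gcongr
      _ ≤ Real.exp 1 * (Real.exp 1 ^ s * (m + s).factorial) := by
          rw [mul_assoc]
          exact mul_le_mul_of_nonneg_left ih (Real.exp_pos 1).le

lemma factorial_div_le {n s : ℕ} (hn : 0 < n) (hs : s ≤ n) :
    ((n - s).factorial : ℝ) / n.factorial ≤ (Real.exp 1 / n) ^ s := by
  obtain ⟨m, rfl⟩ := Nat.exists_eq_add_of_le' hs
  have h := add_pow_mul_factorial_le m s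
  rw [Nat.add_sub_cancel, div_pow, div_le_div_iff₀ (by positivity) (by positivity)]
  push_cast
  linarith

/-- The size of the `s`-th derivative terms in the error bound. -/
lemma rate_base_le {ω γ h : ℝ} (hω : 1 ≤ ω) (hγ : 0 < γ) (hh : 0 < h) {n s : ℕ} (hn : 0 < n)
    (hs : s ≤ n) :
    ((n - s).factorial : ℝ) / n.factorial * (h ^ s * (γ ^ s * (s.factorial : ℝ) ^ ω))
      ≤ (Real.exp 1 * γ * (s : ℝ) ^ ω / (n / h)) ^ s := by
  have h1 : (s.factorial : ℝ) ^ ω ≤ ((s : ℝ) ^ ω) ^ s := by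
    have h2 : (s.factorial : ℝ) ≤ (s : ℝ) ^ s := by exact_mod_cast Nat.factorial_le_pow s
    refine (Real.rpow_le_rpow (by positivity) h2 (by linarith)).trans_eq ?_
    rw [← Real.rpow_natCast, ← Real.rpow_natCast, ← Real.rpow_mul (by positivity),
      ← Real.rpow_mul (by positivity), mul_comm]
  calc _ ≤ (Real.exp 1 / n) ^ s * (h ^ s * (γ ^ s * ((s : ℝ) ^ ω) ^ s)) := by
        gcongr
        exact factorial_div_le hn hs
    _ = _ := by
        rw [← mul_pow, ← mul_pow, ← mul_pow]
        congr 1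
        field_simp

lemma rpow_le_mul_exp {ω x : ℝ} (hω : 0 < ω) (hx : 0 ≤ x) :
    x ^ ω ≤ (2 * ω) ^ ω * Real.exp (x / 2) := by
  have h1 : x ≤ 2 * ω * Real.exp (x / (2 * ω)) := by
    have h2 := Real.add_one_le_exp (x / (2 * ω))
    have h3 : x = 2 * ω * (x / (2 * ω)) := by field_simp
    calc x = 2 * ω * (x / (2 * ω)) := h3
      _ ≤ _ := by gcongr; linarith
  refine (Real.rpow_le_rpow hx h1 hω.le).trans_eq ?_
  rw [Real.mul_rpow (by positivity) (by positivity), ← Real.exp_mul]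
  congr 2
  field_simp

/-- The scale of the choice of the smoothness index: with `c = (e² γ) ^ (1 / ω)` and
`y = (n / h) ^ (1 / ω) / c` one takes as many derivatives as `y` and the degree `n` allow. -/
noncomputable def rateScale (ω γ : ℝ) : ℝ := (Real.exp 2 * γ) ^ (1 / ω)

lemma rateScale_pos {ω γ : ℝ} (hγ : 0 < γ) : 0 < rateScale ω γ :=
  Real.rpow_pos_of_pos (mul_pos (Real.exp_pos 2) hγ) _

lemma rpow_one_div_rpow {ω x : ℝ} (hω : 0 < ω) (hx : 0 ≤ x) : (x ^ (1 / ω)) ^ ω = x := by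
  rw [← Real.rpow_mul hx, one_div_mul_cancel hω.ne', Real.rpow_one]

/-- For a suitable number `s` of derivatives the error bound decays at the asserted rate. -/
lemma exists_rate {ω γ : ℝ} (hω : 1 ≤ ω) (hγ : 0 < γ) :
    ∃ K : ℝ, 0 < K ∧ ∀ h : ℝ, 0 < h → ∀ p : ℕ, ∃ s ≤ p + 1,
      ((p + 1 - s).factorial : ℝ) / (p + 1).factorial * (h ^ s * (γ ^ s * (s.factorial : ℝ) ^ ω))
        * (γ * ((s : ℝ) + 1) ^ ω + 1 + ((p + 1 : ℕ) : ℝ) / h)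
      ≤ K * (h ^ (1 / ω) / (h ^ (1 / ω) + 1 / (2 * rateScale ω γ))) ^ ((p : ℝ) ^ (1 / ω)) := by
  have hω0 : 0 < ω := by linarith
  set c := rateScale ω γ with hc
  have hc0 : 0 < c := rateScale_pos hγ
  have hcω : c ^ ω = Real.exp 2 * γ := rpow_one_div_rpow hω0 (by positivity)
  set K₀ := γ + 1 + c ^ ω with hK₀
  have hK₀' : 0 < K₀ := by positivity
  refine ⟨Real.exp (3 / 2) * K₀ * (2 * ω) ^ ω, by positivity, fun h hh p => ?_⟩
  set n := p + 1 with hn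
  have hn0 : (0 : ℝ) < n := by positivity
  have hn1 : (1 : ℝ) ≤ n := by simp [hn]
  have hpn : (p : ℝ) ≤ n := by simp [hn]
  set α := 1 / ω with hα
  have hα0 : 0 < α := by positivity
  have hα1 : α ≤ 1 := by rw [hα, div_le_one hω0]; exact hω
  set H := h ^ α with hH
  have hH0 : 0 < H := Real.rpow_pos_of_pos hh _
  set y := (n : ℝ) ^ α / H / c with hy
  have hnα : 0 < (n : ℝ) ^ α := Real.rpow_pos_of_pos hn0 _
  have hy0 : 0 < y := by positivity
  have hyω : (n : ℝ) / h = c ^ ω * y ^ ω := by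
    rw [← Real.mul_rpow hc0.le hy0.le, hy, mul_div_cancel₀ _ hc0.ne',
      Real.div_rpow hnα.le hH0.le, hα, hH, rpow_one_div_rpow hω0 hn0.le,
      rpow_one_div_rpow hω0 hh.le]
  have hσ : 1 / (2 * c) / H = y / 2 / (n : ℝ) ^ α := by
    rw [hy]; field_simp
  have hP : (p : ℝ) ^ α ≤ (n : ℝ) ^ α := Real.rpow_le_rpow (by positivity) hpn hα0.le
  have hP0 : 0 ≤ (p : ℝ) ^ α := by positivity
  have hbase : H / (H + 1 / (2 * c)) = (1 + 1 / (2 * c) / H)⁻¹ := by field_simp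
  rw [hbase, Real.inv_rpow (by positivity), hσ]
  rcases le_or_gt ⌊y⌋₊ n with hyn | hyn
  · refine ⟨⌊y⌋₊, hyn, ?_⟩
    set s := ⌊y⌋₊ with hs
    have hsy : (s : ℝ) ≤ y := Nat.floor_le hy0.le
    have hys : y < s + 1 := Nat.lt_floor_add_one y
    have h1 : Real.exp 1 * γ * (s : ℝ) ^ ω / (n / h) ≤ Real.exp (-1) := by
      rw [hyω, hcω, div_le_iff₀ (by positivity)]
      have h2 : Real.exp (-1) * (Real.exp 2 * γ * y ^ ω) = Real.exp 1 * γ * y ^ ω := by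
        rw [← mul_assoc, ← mul_assoc, ← Real.exp_add]; norm_num
      rw [h2]
      gcongr
    have h3 := (rate_base_le hω hγ hh (Nat.succ_pos p) hyn).trans
      (pow_le_pow_left₀ (by positivity) h1 s)
    rw [← Real.exp_nat_mul] at h3
    have h4 : γ * ((s : ℝ) + 1) ^ ω + 1 + (n : ℝ) / h ≤ K₀ * (y + 1) ^ ω := by
      have a1 : ((s : ℝ) + 1) ^ ω ≤ (y + 1) ^ ω := by gcongr
      have a2 : (1 : ℝ) ≤ (y + 1) ^ ω := Real.one_le_rpow (by linarith) hω0.le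
      have a3 : y ^ ω ≤ (y + 1) ^ ω := by gcongr; linarith
      have a4 := mul_le_mul_of_nonneg_left a1 hγ.le
      have a5 := mul_le_mul_of_nonneg_left a3 (by positivity : 0 ≤ c ^ ω)
      rw [hyω, hK₀]
      linarith
    have h5 := rpow_le_mul_exp hω0 (by linarith : 0 ≤ y + 1)
    have h6 : (1 + y / 2 / (n : ℝ) ^ α) ^ ((p : ℝ) ^ α) ≤ Real.exp (y / 2) := by
      have a1 : 1 + y / 2 / (n : ℝ) ^ α ≤ Real.exp (y / 2 / (n : ℝ) ^ α) := by
        rw [add_comm]; exact Real.add_one_le_exp _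
      refine (Real.rpow_le_rpow (by positivity) a1 hP0).trans ?_
      rw [← Real.exp_mul]
      refine Real.exp_le_exp.2 ?_
      rw [div_mul_eq_mul_div, div_le_iff₀ hnα]
      exact mul_le_mul_of_nonneg_left hP (by positivity)
    have h7 : Real.exp (-(y / 2)) ≤ ((1 + y / 2 / (n : ℝ) ^ α) ^ ((p : ℝ) ^ α))⁻¹ := by
      rw [Real.exp_neg]
      exact inv_anti₀ (by positivity) h6
    calc _ ≤ Real.exp (s * -1) * (K₀ * ((2 * ω) ^ ω * Real.exp ((y + 1) / 2))) := by
          refine mul_le_mul h3 (h4.trans ?_) (by positivity) (by positivity)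
          gcongr
      _ ≤ Real.exp (1 - y) * (K₀ * ((2 * ω) ^ ω * Real.exp ((y + 1) / 2))) := by
          gcongr; linarith
      _ = Real.exp (3 / 2) * K₀ * (2 * ω) ^ ω * Real.exp (-(y / 2)) := by
          have : Real.exp (1 - y) * Real.exp ((y + 1) / 2)
              = Real.exp (3 / 2) * Real.exp (-(y / 2)) := by
            rw [← Real.exp_add, ← Real.exp_add]; congr 1; ring
          linear_combination K₀ * (2 * ω) ^ ω * this
      _ ≤ _ := by gcongr
  · refine ⟨n, le_rfl, ?_⟩
    set x := y / n with hx
    have hny : (n : ℝ) ≤ y :=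
      (Nat.cast_le.2 hyn.le).trans (Nat.floor_le hy0.le)
    have hx1 : 1 ≤ x := by rw [hx, one_le_div hn0]; exact hny
    have hx0 : 0 < x := by linarith
    have hyx : y = n * x := by rw [hx]; field_simp
    have hxω : 0 < x ^ ω := Real.rpow_pos_of_pos hx0 _
    have h1 : Real.exp 1 * γ * (n : ℝ) ^ ω / (n / h) = Real.exp (-1) * (x ^ ω)⁻¹ := by
      have hnω : 0 < (n : ℝ) ^ ω := Real.rpow_pos_of_pos hn0 _
      rw [hyω, hcω, hyx, Real.mul_rpow hn0.le hx0.le, div_eq_iff (by positivity)]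
      have h2 : Real.exp (-1) * Real.exp 2 = Real.exp 1 := by rw [← Real.exp_add]; norm_num
      rw [← h2]
      field_simp
    have h3 := rate_base_le hω hγ hh (Nat.succ_pos p) (le_refl n)
    rw [h1, mul_pow, ← Real.exp_nat_mul] at h3
    have h4 : γ * ((n : ℝ) + 1) ^ ω + 1 + (n : ℝ) / h ≤ K₀ * ((n : ℝ) + 1) ^ ω * x ^ ω := by
      have b1 : (1 : ℝ) ≤ ((n : ℝ) + 1) ^ ω := Real.one_le_rpow (by linarith) hω0.le
      have b2 : (1 : ℝ) ≤ x ^ ω := Real.one_le_rpow hx1 hω0.le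
      have b3 : (n : ℝ) ^ ω ≤ ((n : ℝ) + 1) ^ ω := by gcongr; linarith
      have b4 : ((n : ℝ) + 1) ^ ω ≤ ((n : ℝ) + 1) ^ ω * x ^ ω :=
        le_mul_of_one_le_right (by positivity) b2
      have b5 : c ^ ω * ((n : ℝ) ^ ω * x ^ ω) ≤ c ^ ω * (((n : ℝ) + 1) ^ ω * x ^ ω) := by gcongr
      have b6 := mul_le_mul_of_nonneg_left b4 hγ.le
      rw [hyω, hyx, Real.mul_rpow hn0.le hx0.le, hK₀]
      linarith
    have h5 := rpow_le_mul_exp hω0 (by linarith : 0 ≤ (n : ℝ) + 1)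
    have hPp : (p : ℝ) ^ α ≤ ω * p := by
      rcases Nat.eq_zero_or_pos p with rfl | hp
      · simp [Real.zero_rpow hα0.ne']
      · have hp1 : (1 : ℝ) ≤ p := by exact_mod_cast hp
        have := Real.rpow_le_rpow_of_exponent_le hp1 hα1
        rw [Real.rpow_one] at this
        nlinarith
    have h6 : (1 + y / 2 / (n : ℝ) ^ α) ^ ((p : ℝ) ^ α) ≤ (x ^ ω) ^ p * Real.exp (n / 2) := by
      have a0 : y / 2 / (n : ℝ) ^ α = x * ((n : ℝ) / (n : ℝ) ^ α / 2) := by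
        rw [hyx]; field_simp
      have a1 : 1 + y / 2 / (n : ℝ) ^ α ≤ x * Real.exp ((n : ℝ) / (n : ℝ) ^ α / 2) := by
        have := mul_le_mul_of_nonneg_left (Real.add_one_le_exp ((n : ℝ) / (n : ℝ) ^ α / 2)) hx0.le
        rw [a0]
        linarith
      refine (Real.rpow_le_rpow (by positivity) a1 hP0).trans ?_
      rw [Real.mul_rpow hx0.le (Real.exp_pos _).le, ← Real.exp_mul]
      refine mul_le_mul ?_ (Real.exp_le_exp.2 ?_) (Real.exp_pos _).le (by positivity)
      · rw [← Real.rpow_natCast, ← Real.rpow_mul hx0.le]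
        exact Real.rpow_le_rpow_of_exponent_le hx1 hPp
      · rw [div_div, div_mul_eq_mul_div, div_le_div_iff₀ (by positivity) two_pos]
        have := mul_le_mul_of_nonneg_left hP hn0.le
        linarith
    have h7 : ((x ^ ω) ^ p * Real.exp (n / 2))⁻¹
        ≤ ((1 + y / 2 / (n : ℝ) ^ α) ^ ((p : ℝ) ^ α))⁻¹ :=
      inv_anti₀ (by positivity) h6
    calc _ ≤ Real.exp (n * -1) * ((x ^ ω)⁻¹) ^ n
            * (K₀ * ((2 * ω) ^ ω * Real.exp (((n : ℝ) + 1) / 2)) * x ^ ω) := by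
          refine mul_le_mul h3 (h4.trans ?_) (by positivity) (by positivity)
          gcongr
      _ = Real.exp (1 / 2) * K₀ * (2 * ω) ^ ω * ((x ^ ω) ^ p * Real.exp (n / 2))⁻¹ := by
          have e1 : Real.exp ((n : ℝ) * -1) * Real.exp (((n : ℝ) + 1) / 2)
              = Real.exp (1 / 2) * (Real.exp (n / 2))⁻¹ := by
            rw [← Real.exp_neg, ← Real.exp_add, ← Real.exp_add]; congr 1; ring
          have e2 : ((x ^ ω)⁻¹) ^ n * x ^ ω = ((x ^ ω) ^ p)⁻¹ := by
            rw [hn, pow_succ, mul_assoc, inv_mul_cancel₀ hxω.ne', mul_one, inv_pow]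
          rw [mul_inv, ← e2]
          linear_combination K₀ * (2 * ω) ^ ω * (((x ^ ω)⁻¹) ^ n * x ^ ω) * e1
      _ ≤ _ := by
          gcongr
          norm_num

end DGWave

/-! ### The abstract wave problem -/

namespace DGWave

/-- The real inner product `Re (x, y)` on a Hilbert space over `𝕜`, with a given real structure. -/
noncomputable abbrev realInner (𝕜 H : Type*) [RCLike 𝕜] [NormedAddCommGroup H]
    [InnerProductSpace 𝕜 H] [NormedSpace ℝ H] : InnerProductSpace ℝ H where
  inner x y := RCLike.re (inner 𝕜 x y)
  norm_sq_eq_re_inner x := by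
    rw [norm_sq_eq_re_inner (𝕜 := 𝕜) x]; rfl
  conj_inner_symm x y := by
    simp [inner_re_symm (𝕜 := 𝕜) x y]
  add_left x y z := by simp [inner_add_left]
  smul_left x y r := by simp [inner_real_smul_left, RCLike.smul_re]

variable {𝕜 V H M : Type*} [RCLike 𝕜]
  [NormedAddCommGroup V] [InnerProductSpace 𝕜 V] [NormedSpace ℝ V]
  [NormedAddCommGroup H] [InnerProductSpace 𝕜 H] [NormedSpace ℝ H]
  [NormedAddCommGroup M] [InnerProductSpace 𝕜 M] [NormedSpace ℝ M]

/-- On the kernel of the trace operator an admissible system is a skew-symmetric generator. -/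
lemma skewGenerator_of_admissible {P : WaveSystem 𝕜 V H M} (hP : P.Admissible) :
    letI := realInner 𝕜 H
    SkewGenerator (onKer (realCLM P.B) (realCLM P.incl))
      (onKer (realCLM P.B) (realCLM P.Astar)) := by
  let _ := realInner 𝕜 H
  refine ⟨fun v w hvw => Subtype.ext (P.incl_injective hvw), fun w => hP.dissipative w w.2,
    fun x hx f => ?_⟩
  obtain ⟨K, -, hK⟩ := hP.resolvent
  obtain ⟨v, ⟨hv, hvf⟩, -⟩ := (hK (x : 𝕜) (by simpa using hx) f).1
  refine ⟨⟨v, hv⟩, ?_⟩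
  have := isScalarTower_real 𝕜 H
  rw [← hvf, ← RCLike.real_smul_eq_coe_smul (K := 𝕜)]
  rfl

end DGWave

theorem mainTheorem5 (ω γ : ℝ) (hω : 1 ≤ ω) (hγ : 0 < γ) :
    ∃ σ : ℝ, 0 < σ ∧
      ∀ (𝕜 V H M : Type*) [RCLike 𝕜]
        [NormedAddCommGroup V] [InnerProductSpace 𝕜 V] [CompleteSpace V] [NormedSpace ℝ V]
        [NormedAddCommGroup H] [InnerProductSpace 𝕜 H] [CompleteSpace H] [NormedSpace ℝ H]
        [NormedAddCommGroup M] [InnerProductSpace 𝕜 M] [CompleteSpace M] [NormedSpace ℝ M]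
        (P : WaveSystem 𝕜 V H M), P.Admissible →
      ∃ C : ℝ, 0 < C ∧
        ∀ (T Cu : ℝ) (ξ : ℝ → M) (u : ℝ → V), 0 < T → 0 < Cu →
          P.IsExactSolution T ξ u →
          ContDiffOn ℝ ((⊤ : ℕ∞) : WithTop ℕ∞) u (Ioo 0 T) →
          (∀ (l : ℕ), ∀ t ∈ Ioo 0 T,
            ‖iteratedDeriv l u t‖ ≤ Cu * γ ^ l * (l.factorial : ℝ) ^ ω) →
        ∀ (h : ℝ) (p : ℕ) (uh : ℝ → V), 0 < h →
          P.IsDGSolution h p ξ uh →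
        ∀ t : ℝ, 0 < t → h * (⌈t / h⌉₊ : ℝ) ≤ T →
          ‖u t - uh t‖ ≤ C * Cu * max (h * (⌈t / h⌉₊ : ℝ)) 1 *
            (h ^ (1 / ω) / (h ^ (1 / ω) + σ)) ^ ((p : ℝ) ^ (1 / ω)) := by
  obtain ⟨K, hK0, hK⟩ := DGWave.exists_rate hω hγ
  refine ⟨1 / (2 * DGWave.rateScale ω γ),
    one_div_pos.2 (mul_pos two_pos (DGWave.rateScale_pos hγ)), ?_⟩
  intro 𝕜 V H M _ _ _ _ _ _ _ _ _ _ _ _ _ P hP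
  let _ := DGWave.realInner 𝕜 H
  obtain ⟨C, hC0, hC⟩ :=
    DGWave.CellProblem.exists_norm_sub_le (DGWave.skewGenerator_of_admissible hP)
  refine ⟨C * K, mul_pos hC0 hK0, ?_⟩
  intro T Cu ξ u hT hCu hs hu hb h p uh hh d t ht htT
  obtain ⟨s, hsp, hrate⟩ := hK h hh p
  set N := ⌈t / h⌉₊ with hN
  have hth : 0 < t / h := div_pos ht hh
  have hN0 : 0 < N := Nat.ceil_pos.2 hth
  obtain ⟨n, hn⟩ : ∃ n, N = n + 1 := ⟨N - 1, by omega⟩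
  have hτ : t / h - n ∈ Ioc (0 : ℝ) 1 := by
    have h1 : t / h ≤ N := Nat.le_ceil _
    have h2 : (n : ℝ) < t / h := Nat.lt_ceil.1 (by omega)
    rw [hn] at h1
    push_cast at h1
    exact ⟨by linarith, by linarith⟩
  obtain ⟨U, F, c, hF, hcell⟩ := DGWave.exists_cellProblem hT hs hu hb hh d htT
  have hnN : n < N := by omega
  have ht' : h * (n + (t / h - n)) = t := by field_simp; ring
  obtain ⟨hu', huh'⟩ := hcell n hnN _ hτ
  rw [ht'] at hu' huh'
  have key := hC hh c hsp (b := h ^ s * (Cu * γ ^ s * (s.factorial : ℝ) ^ ω))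
    (b' := h ^ (s + 1) * (Cu * γ ^ (s + 1) * ((s + 1).factorial : ℝ) ^ ω)) (by positivity)
    (by positivity) (fun n hn t ht => hF n hn s t ht) (fun n hn t ht => hF n hn (s + 1) t ht) n hnN
    _ ⟨hτ.1.le, hτ.2⟩
  rw [hu', huh'] at key
  refine key.trans ?_
  set m := max (h * (N : ℝ)) 1 with hm
  have hm1 : h * N ≤ m := le_max_left _ _
  have hm0 : 0 < m := zero_lt_one.trans_le (le_max_right _ _)
  have hhm : h ≤ m := by
    refine le_trans ?_ hm1
    exact le_mul_of_one_le_right hh.le (by exact_mod_cast hN0)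
  set β := ((p + 1 - s).factorial : ℝ) / (p + 1).factorial with hβ
  set G := h ^ s * (γ ^ s * (s.factorial : ℝ) ^ ω) with hG
  have hG0 : 0 < G := by positivity
  have e1 : h ^ s * (Cu * γ ^ s * (s.factorial : ℝ) ^ ω) = Cu * G := by rw [hG]; ring
  have e2 : h ^ (s + 1) * (Cu * γ ^ (s + 1) * ((s + 1).factorial : ℝ) ^ ω)
      = Cu * G * (h * (γ * ((s : ℝ) + 1) ^ ω)) := by
    rw [Nat.factorial_succ, Nat.cast_mul, Real.mul_rpow (by positivity) (by positivity), hG]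
    push_cast
    ring
  rw [e1, e2]
  have e3 : (N : ℝ) * (h + (p + 1)) = h * N * (1 + ((p + 1 : ℕ) : ℝ) / h) := by
    push_cast
    field_simp
  have hbound : Cu * G * (h * (γ * ((s : ℝ) + 1) ^ ω)) + N * (h + (p + 1)) * (Cu * G)
      ≤ Cu * m * (G * (γ * ((s : ℝ) + 1) ^ ω + 1 + ((p + 1 : ℕ) : ℝ) / h)) := by
    have f1 : h * (γ * ((s : ℝ) + 1) ^ ω) ≤ m * (γ * ((s : ℝ) + 1) ^ ω) := by gcongr
    have f2 : h * N * (1 + ((p + 1 : ℕ) : ℝ) / h) ≤ m * (1 + ((p + 1 : ℕ) : ℝ) / h) := by gcongr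
    have f3 := mul_le_mul_of_nonneg_left (add_le_add f1 f2) (by positivity : 0 ≤ Cu * G)
    rw [e3]
    linarith
  calc C * (β * _) ≤ C * (β * (Cu * m * (G * (γ * ((s : ℝ) + 1) ^ ω + 1
        + ((p + 1 : ℕ) : ℝ) / h)))) := by gcongr
    _ = C * (Cu * m) * (β * G * (γ * ((s : ℝ) + 1) ^ ω + 1 + ((p + 1 : ℕ) : ℝ) / h)) := by ring
    _ ≤ C * (Cu * m) * (K * _) := by gcongr
    _ = _ := by ring
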